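/- Let $H$ be a fixed finite multigraph (loops and parallel edges allowed) in which any two distinct vertices $h,h'$ satisfy $|N_H(h)\cap N_H(h')|\le 1$, where $N_H(h)=\{h' : hh'\in E(H)\}$. For a finite simple graph $G$, lists $L_v\subseteq V(H)$ $(v\in V(G))$ and weights $w_{v,h}$ $(v\in V(G),\,h\in V(H))$ in a commutative semiring $R$, let $$p_{(G,L)\to H}(x)=\sum_{f}\ \prod_{u\in V(G)} w_{u,f(u)}\,x_{f(u)}\ \in R[x_h : h\in V(H)],$$ where $f$ runs over all list $H$-colourings of $(G,L)$, that is, all maps $f:V(G)\to V(H)$ such that $f(v)\in L_v$ for every $v\in V(G)$ and $f(u)f(v)\in E(H)$ for every edge $uv$ of $G$. There is a constant $C$, depending only on $H$, such that for every $t\ge 4$ there is an algorithm which, given any $P_t$-free graph $G$ (one without the path on $t$ vertices as an induced subgraph), any lists $L$ and any weights $w$, outputs the polynomial $p_{(G,L)\to H}(x)$ as a list of its coefficients, and which, whenever $n=|V(G)|\ge 2$, takes at most $2^{C\sqrt{t\,n\log n}}$ steps. Here an algorithm is a finite program that may depend on $H$ and $t$ but not on $R$ or on the input; it works on binary trees whose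 leaves are $\mathrm{nil}$ or opaque elements of $R$ (first-order LISP with recursive functions). Fetching or binding a variable, evaluating a constant ($\mathrm{nil}$, or $0$ or $1$ of $R$), forming a pair or taking one apart, a test for $\mathrm{nil}$, a function call, and an addition or multiplication in $R$ each count as one step. The graph and the lists are given by $0/1$ matrices and the weights by a matrix of elements of $R$. -/

import Mathlib

open scoped Graph SimpleGraph

universe u

/-! ### The machine model

Programs are finite systems of first-order recursive function definitions over binary trees
(pure first-order LISP), the leaves of a tree being `nil` or opaque elements of a commutative
semiring `R`.  Trees are passed around as pointers, so every elementary step (fetching a variable,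
allocating or taking apart a pair, testing for `nil`, binding a variable, calling a function,
adding or multiplying two semiring elements) is a constant number of operations of a RAM or
pointer machine, and it is charged one unit of time.  Programs contain no elements of `R` other
than the constants `0` and `1`, and they cannot compare elements of `R` or branch on them. -/

namespace Lisp

/-- Values: binary trees with leaves `nil` or elements of `R`. -/
inductive Val (R : Type u) : Type u
  | nil : Val R
  | atom (r : R) : Val R
  | cons (a b : Val R) : Val R

namespace Val

variable {R : Type u}

/-- First component of a pair (`nil` if the value is not a pair). -/
def head : Val R → Val R
  | cons a _ => a
  | _ => nil

/-- Second component of a pair (`nil` if the value is not a pair). -/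
def tail : Val R → Val R
  | cons _ b => b
  | _ => nil

/-- The list `[a₁, …, aₖ]` as the tree `cons a₁ (… (cons aₖ nil))`. -/
def ofList : List (Val R) → Val R
  | [] => nil
  | a :: l => cons a (ofList l)

/-- A family indexed by `Fin n` as a list of length `n`. -/
def ofFamily {n : ℕ} (f : Fin n → Val R) : Val R := ofList (List.ofFn f)

/-- A natural number in unary. -/
def ofNat : ℕ → Val R
  | 0 => nil
  | n + 1 => cons nil (ofNat n)

open Classical in
/-- A truth value: `nil` is false, `cons nil nil` is true. -/
noncomputable def ofProp (p : Prop) : Val R := if p then cons nil nil else nil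

end Val

/-- Expressions. Variables are de Bruijn indices into the current environment. -/
inductive Code : Type
  | var (i : ℕ)
  | nil
  | cons (a b : Code)
  | head (a : Code)
  | tail (a : Code)
  | cond (c a b : Code)
  | bind (a b : Code)
  | call (f : ℕ) (a : Code)
  | zero
  | one
  | add (a b : Code)
  | mul (a b : Code)

/-- A program: the list of the bodies of its functions, each with one argument (variable `0`).
The function with index `0` is the main one. -/
abbrev Program : Type := List Code

/-- `Eval P env c v k`: in program `P` and environment `env`, the expression `c` evaluates to `v`
in exactly `k` elementary steps. -/
inductive Eval {R : Type u} [CommSemiring R] (P : Program) :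
    List (Val R) → Code → Val R → ℕ → Prop
  | var {env : List (Val R)} {i : ℕ} {v : Val R} :
      env[i]? = some v → Eval P env (.var i) v 1
  | nil {env : List (Val R)} : Eval P env .nil .nil 1
  | cons {env : List (Val R)} {a b : Code} {x y : Val R} {k l : ℕ} :
      Eval P env a x k → Eval P env b y l → Eval P env (.cons a b) (.cons x y) (k + l + 1)
  | head {env : List (Val R)} {a : Code} {x : Val R} {k : ℕ} :
      Eval P env a x k → Eval P env (.head a) x.head (k + 1)
  | tail {env : List (Val R)} {a : Code} {x : Val R} {k : ℕ} :
      Eval P env a x k → Eval P env (.tail a) x.tail (k + 1)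
  | cond_true {env : List (Val R)} {c a b : Code} {x y : Val R} {k l : ℕ} :
      Eval P env c x k → x ≠ .nil → Eval P env a y l → Eval P env (.cond c a b) y (k + l + 1)
  | cond_false {env : List (Val R)} {c a b : Code} {y : Val R} {k l : ℕ} :
      Eval P env c .nil k → Eval P env b y l → Eval P env (.cond c a b) y (k + l + 1)
  | bind {env : List (Val R)} {a b : Code} {x y : Val R} {k l : ℕ} :
      Eval P env a x k → Eval P (x :: env) b y l → Eval P env (.bind a b) y (k + l + 1)
  | call {env : List (Val R)} {f : ℕ} {a body : Code} {x y : Val R} {k l : ℕ} :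
      Eval P env a x k → P[f]? = some body → Eval P [x] body y l →
        Eval P env (.call f a) y (k + l + 1)
  | zero {env : List (Val R)} : Eval P env .zero (.atom 0) 1
  | one {env : List (Val R)} : Eval P env .one (.atom 1) 1
  | add {env : List (Val R)} {a b : Code} {r s : R} {k l : ℕ} :
      Eval P env a (.atom r) k → Eval P env b (.atom s) l →
        Eval P env (.add a b) (.atom (r + s)) (k + l + 1)
  | mul {env : List (Val R)} {a b : Code} {r s : R} {k l : ℕ} :
      Eval P env a (.atom r) k → Eval P env b (.atom s) l →
        Eval P env (.mul a b) (.atom (r * s)) (k + l + 1)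

/-- On input `x`, the program `P` halts with output `y` after exactly `k` elementary steps. -/
def Program.Runs {R : Type u} [CommSemiring R] (P : Program) (x y : Val R) (k : ℕ) : Prop :=
  Eval P [x] (.call 0 (.var 0)) y k

end Lisp

/-! ### List colourings and the partition function -/

namespace HCol

variable {α β V : Type*} {R : Type u}

/-- The neighbourhood of a vertex in a multigraph (it contains `h` iff there is a loop at `h`). -/
def nbhd (H : Graph α β) (h : α) : Set α := {h' | H.Adj h h'}

/-- The list `H`-colourings of `(G, L)`: the graph homomorphisms from `G` to `H` respecting the
lists. -/
def listColourings (H : Graph α β) (G : SimpleGraph V) (L : V → Set V(H)) : Set (V → V(H)) :=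
  {f | (∀ u v, G.Adj u v → H.Adj (f u) (f v)) ∧ ∀ v, f v ∈ L v}

/-- The partition function `∑_f ∏_u w_{u,f(u)} x_{f(u)}`, a polynomial in variables `x_h`,
`h ∈ V(H)`. -/
noncomputable def partitionFunction [CommSemiring R] [Fintype V] (H : Graph α β) [Finite V(H)]
    (G : SimpleGraph V) (L : V → Set V(H)) (w : V → V(H) → R) : MvPolynomial V(H) R :=
  ∑ f ∈ (listColourings H G L).toFinite.toFinset,
    ∏ u, MvPolynomial.C (w u (f u)) * MvPolynomial.X (f u)

/-! ### Representation of inputs and outputs, relative to a numbering `e` of `V(H)` -/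

open Lisp

/-- The input: the adjacency matrix of `G`, the incidence matrix of the lists, and the matrix of
the weights, each as the list of its rows. -/
noncomputable def input {H : Graph α β} {q n : ℕ} (e : Fin q ≃ V(H)) (G : SimpleGraph (Fin n))
    (L : Fin n → Set V(H)) (w : Fin n → V(H) → R) : Val R :=
  .cons (.ofFamily fun u => .ofFamily fun v => .ofProp (G.Adj u v)) <|
    .cons (.ofFamily fun u => .ofFamily fun i => .ofProp (e i ∈ L u))
      (.ofFamily fun u => .ofFamily fun i => .atom (w u (e i)))

/-- A monomial with its coefficient: the exponent vector, with entries in unary, paired with the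
coefficient. -/
def encodeTerm {H : Graph α β} {q : ℕ} (e : Fin q ≃ V(H)) (m : (V(H) →₀ ℕ) × R) : Val R :=
  .cons (.ofFamily fun i => .ofNat (m.1 (e i))) (.atom m.2)

/-- `y` is a coefficient table of the polynomial `p`: a list of monomials with coefficients, no
monomial being listed twice, whose sum is `p`. -/
def IsCoeffTable [CommSemiring R] {H : Graph α β} {q : ℕ} (e : Fin q ≃ V(H)) (y : Val R)
    (p : MvPolynomial V(H) R) : Prop :=
  ∃ l : List ((V(H) →₀ ℕ) × R), y = .ofList (l.map (encodeTerm e)) ∧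
    (l.map Prod.fst).Nodup ∧ (l.map fun m => MvPolynomial.monomial m.1 m.2).sum = p

end HCol

/-!
The program branches in two phases. It carries an accumulator table and multiplies it by one
monomial whenever a vertex receives a colour, so polynomials are only ever scaled by monomials and
added. Every table has at most `(n + 1) ^ |V(H)|` entries, and it remains to bound the number of
branchings, up to factors polynomial in `n`.

*First phase.* Choosing the colour `h` for a vertex `v` shrinks the lists of those neighbours of `v`
whose lists are not contained in the neighbourhood of `h`. As long as some vertex has only one
colour left, or some choice shrinks at least `D` lists, the program branches on it: `v` receives
`h`, or `h` is removed from the list of `v` (`partition_branch`). The total size of the lists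
decreases in both branches, and by more than `D` in the first one unless the choice is forced, so
there are `n ^ O(n / D)` leaves (`branchBound_branch`, `exists_branch`). At a leaf, every list has
two distinct colours `a` and `b`. Since `a` and `b` have at most one common neighbour, while the
list of a neighbour `u` of `v` has two elements, one of the choices `a` and `b` for `v` shrinks the
list of `u`. Hence the degrees at a leaf are at most `2 * (D - 1)` (`card_nbrs_le`).

*Second phase.* The graph is now a `P_t`-free graph of maximum degree less than `2 * D`. The program
treats its components one by one (`partition_split`). In a connected graph it tries all colours of a
starting vertex, removes that vertex and treats the components of the remainder; each such component
is entered through a vertex `v` that has just been coloured and has a neighbour in the component: the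
program tries all colourings of the neighbours of `v` in the component and goes on with what is left.
The vertices through which the nested components have been entered form an induced path
(`Frontier.nested`), as in the argument of Gyárfás, so the depth is less than `t` and the number of
branchings is at most `|V(H)| ^ O(D * t)`, up to a polynomial factor (`exists_solve`).

With `D ^ 2 * t` of order `n log n`, both bounds are `2 ^ O(√(t n log n))` (`exists_growth_bound`).
The threshold enters the program in the form `n * (Nat.log 2 n + 1) + 1 ≤ r * (r * t)`, which can be
tested with unary arithmetic.

Costs are computed with a weakest-precondition calculus for the machine (`Lisp.wp`). The lemmas
`calls_…` specify the functions of the program on arbitrary data, and the lemmas `run_…` restate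
them for sets, with costs bounded by powers of a number `N` that dominates all parameters (`Big`).
-/


/-! ### A cost-aware calculus for programs -/

namespace Lisp

variable {R : Type u} [CommSemiring R]

attribute [simp] Val.head Val.tail Val.ofList

/-- `Calls P f x y K`: function `f` of `P` maps `x` to `y` in at most `K` steps. -/
def Calls (P : Program) (f : ℕ) (x y : Val R) (K : ℕ) : Prop :=
  ∃ body, P[f]? = some body ∧ ∃ k ≤ K, Eval P [x] body y k

/-- `wp P c env Q`: evaluating `c` in `env` yields a value `v` and a step bound `k` with `Q v k`.
It is defined by recursion on `c`, with `Calls` as the interface to function calls, so that after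
unfolding a body it turns into a list of specifications of the functions called there. -/
def wp (P : Program) : Code → List (Val R) → (Val R → ℕ → Prop) → Prop
  | .var i, env, Q => match env[i]? with
    | some v => Q v 1
    | none => False
  | .nil, _, Q => Q .nil 1
  | .cons a b, env, Q => wp P a env fun x k => wp P b env fun y l => Q (.cons x y) (k + l + 1)
  | .head a, env, Q => wp P a env fun x k => Q x.head (k + 1)
  | .tail a, env, Q => wp P a env fun x k => Q x.tail (k + 1)
  | .cond c a b, env, Q => wp P c env fun x k =>
      (x ≠ .nil → wp P a env fun y l => Q y (k + l + 1)) ∧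
      (x = .nil → wp P b env fun y l => Q y (k + l + 1))
  | .bind a b, env, Q => wp P a env fun x k => wp P b (x :: env) fun y l => Q y (k + l + 1)
  | .call f a, env, Q => wp P a env fun x k => ∃ y K, Calls P f x y K ∧ Q y (k + K + 1)
  | .zero, _, Q => Q (.atom 0) 1
  | .one, _, Q => Q (.atom 1) 1
  | .add a b, env, Q => wp P a env fun x k => wp P b env fun y l =>
      ∃ r s, x = .atom r ∧ y = .atom s ∧ Q (.atom (r + s)) (k + l + 1)
  | .mul a b, env, Q => wp P a env fun x k => wp P b env fun y l =>
      ∃ r s, x = .atom r ∧ y = .atom s ∧ Q (.atom (r * s)) (k + l + 1)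

/-- Soundness of `wp`. The bound `k` need not be attained, since the costs of the calls are bounds. -/
theorem wp_sound {P : Program} {c : Code} {env : List (Val R)} {Q : Val R → ℕ → Prop}
    (h : wp P c env Q) : ∃ y k, Q y k ∧ ∃ k' ≤ k, Eval P env c y k' := by
  induction c generalizing env Q with
  | var i =>
    simp only [wp] at h
    split at h
    · exact ⟨_, _, h, 1, le_rfl, .var ‹_›⟩
    · exact h.elim
  | nil => exact ⟨_, _, h, 1, le_rfl, .nil⟩
  | zero => exact ⟨_, _, h, 1, le_rfl, .zero⟩
  | one => exact ⟨_, _, h, 1, le_rfl, .one⟩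
  | cons a b iha ihb =>
    obtain ⟨x, k, h, k', hk, ea⟩ := iha h
    obtain ⟨y, l, h, l', hl, eb⟩ := ihb h
    exact ⟨_, _, h, _, by omega, .cons ea eb⟩
  | head a iha =>
    obtain ⟨x, k, h, k', hk, ea⟩ := iha h
    exact ⟨_, _, h, _, by omega, .head ea⟩
  | tail a iha =>
    obtain ⟨x, k, h, k', hk, ea⟩ := iha h
    exact ⟨_, _, h, _, by omega, .tail ea⟩
  | cond c a b ihc iha ihb =>
    obtain ⟨x, k, ⟨h1, h2⟩, k', hk, ec⟩ := ihc h
    by_cases hx : x = .nil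
    · obtain ⟨y, l, h, l', hl, eb⟩ := ihb (h2 hx)
      subst hx
      exact ⟨_, _, h, _, by omega, .cond_false ec eb⟩
    · obtain ⟨y, l, h, l', hl, ea⟩ := iha (h1 hx)
      exact ⟨_, _, h, _, by omega, .cond_true ec hx ea⟩
  | bind a b iha ihb =>
    obtain ⟨x, k, h, k', hk, ea⟩ := iha h
    obtain ⟨y, l, h, l', hl, eb⟩ := ihb h
    exact ⟨_, _, h, _, by omega, .bind ea eb⟩
  | call f a iha =>
    obtain ⟨x, k, ⟨y, K, ⟨body, hb, l, hl, e⟩, h⟩, k', hk, ea⟩ := iha h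
    exact ⟨_, _, h, _, by omega, .call ea hb e⟩
  | add a b iha ihb =>
    obtain ⟨x, k, h, k', hk, ea⟩ := iha h
    obtain ⟨y, l, ⟨r, s, rfl, rfl, h⟩, l', hl, eb⟩ := ihb h
    exact ⟨_, _, h, _, by omega, .add ea eb⟩
  | mul a b iha ihb =>
    obtain ⟨x, k, h, k', hk, ea⟩ := iha h
    obtain ⟨y, l, ⟨r, s, rfl, rfl, h⟩, l', hl, eb⟩ := ihb h
    exact ⟨_, _, h, _, by omega, .mul ea eb⟩

/-- The postcondition that the value is `y` and the cost at most `K`. -/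
structure Returns (y : Val R) (K : ℕ) (v : Val R) (k : ℕ) : Prop where
  value : v = y
  cost : k ≤ K

theorem Calls.of_wp {P : Program} {f : ℕ} {body : Code} {x y : Val R} {K : ℕ}
    (hf : P[f]? = some body) (h : wp P body [x] (Returns y K)) : Calls P f x y K := by
  obtain ⟨v, k, ⟨rfl, hk⟩, k', hk', e⟩ := wp_sound h
  exact ⟨body, hf, k', hk'.trans hk, e⟩

theorem Calls.mono {P : Program} {f : ℕ} {x y : Val R} {K K' : ℕ}
    (h : Calls P f x y K) (hK : K ≤ K') : Calls P f x y K' := by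
  obtain ⟨b, hb, k, hk, e⟩ := h
  exact ⟨b, hb, k, hk.trans hK, e⟩

theorem Calls.cast {P : Program} {f : ℕ} {x y y' : Val R} {K K' : ℕ}
    (h : Calls P f x y K) (hy : y = y') (hK : K ≤ K') : Calls P f x y' K' :=
  hy ▸ h.mono hK

/-- Access to the `i`-th entry of a list. -/
def Code.proj : ℕ → Code → Code
  | 0, c => .head c
  | i + 1, c => proj i (.tail c)

/-- The list of the values of the given expressions. A function of several arguments receives them
as one list. -/
def Code.list : List Code → Code
  | [] => .nil
  | a :: l => .cons a (Code.list l)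

/-- The truth value true. -/
def Code.tt : Code := .cons .nil .nil

/-- The `i`-th argument of the current function, read below `d` binders. -/
def Code.arg (d i : ℕ) : Code := Code.proj i (.var d)

/-- An expression with the given constant tree as its value; atoms are read as `nil`. -/
def Code.quote : Val Unit → Code
  | .nil => .nil
  | .atom _ => .nil
  | .cons a b => .cons (quote a) (quote b)

end Lisp

/-! ### The program -/

namespace HCol
open Lisp Lisp.Code

-- the positions of the functions in `program`
section indices

abbrev fMux : ℕ := 1
abbrev fZeros : ℕ := 2
abbrev fAny : ℕ := 3
abbrev fFirst : ℕ := 4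
abbrev fRow : ℕ := 5
abbrev fAnd : ℕ := 6
abbrev fDiff : ℕ := 7
abbrev fOr : ℕ := 8
abbrev fNbrs : ℕ := 9
abbrev fReach : ℕ := 10
abbrev fUpd : ℕ := 11
abbrev fInc : ℕ := 12
abbrev fScale : ℕ := 13
abbrev fEq : ℕ := 14
abbrev fAddTerm : ℕ := 15
abbrev fAddTable : ℕ := 16
abbrev fDead : ℕ := 17
abbrev fBad : ℕ := 18
abbrev fAppend : ℕ := 19
abbrev fMul : ℕ := 20
abbrev fGe : ℕ := 21
abbrev fHalf : ℕ := 22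
abbrev fLog : ℕ := 23
abbrev fGood : ℕ := 24
abbrev fFindColour : ℕ := 25
abbrev fFindPair : ℕ := 26
abbrev fPick : ℕ := 27
abbrev fSolve : ℕ := 28
abbrev fBranch : ℕ := 29
abbrev fFull : ℕ := 30
abbrev fAssignLists : ℕ := 31
abbrev fAssignTable : ℕ := 32
abbrev fRemove : ℕ := 33

end indices

/-- Arguments `p, a, b`: the list whose `i`-th entry is `a i` if `p i` holds and `b i` otherwise. -/
def muxBody : Code :=
  cond (arg 0 0)
    (cons (cond (head (arg 0 0)) (head (arg 0 1)) (head (arg 0 2)))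
      (call fMux (list [tail (arg 0 0), tail (arg 0 1), tail (arg 0 2)])))
    nil

/-- The bit vector of the empty set, of the length of the argument. -/
def zerosBody : Code := cond (var 0) (cons nil (call fZeros (tail (var 0)))) nil

/-- Whether the set given by a bit vector is nonempty. -/
def anyBody : Code := cond (var 0) (cond (head (var 0)) tt (call fAny (tail (var 0)))) nil

/-- The singleton of the least element of a nonempty set. -/
def firstBody : Code :=
  cond (head (var 0)) (cons tt (call fZeros (tail (var 0))))
      (cons nil (call fFirst (tail (var 0))))

/-- Arguments `{i}, a`: the entry `a i`. -/
def rowBody : Code :=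
  cond (head (arg 0 0)) (head (arg 0 1)) (call fRow (list [tail (arg 0 0), tail (arg 0 1)]))

/-- Intersection of two sets. -/
def andBody : Code := call fMux (list [arg 0 0, arg 0 1, arg 0 0])

/-- Difference of two sets. -/
def diffBody : Code := call fMux (list [arg 0 1, call fZeros (arg 0 0), arg 0 0])

/-- Union of two sets. -/
def orBody : Code := call fMux (list [arg 0 0, arg 0 0, arg 0 1])

/-- Arguments `X, M, A`: the union of `A` and of the sets `M i`, `i ∈ X`. -/
def nbrsBody : Code :=
  cond (arg 0 0)
    (call fNbrs (list [tail (arg 0 0), tail (arg 0 1),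
      cond (head (arg 0 0)) (call fOr (list [head (arg 0 1), arg 0 2])) (arg 0 2)]))
    (arg 0 2)

/-- Arguments `S, X, M`: the closure of `X` under the adjacency `M` within `S`. -/
def reachBody : Code :=
  bind (call fAnd (list [arg 0 0, call fNbrs (list [arg 0 1, arg 0 2, arg 0 1])]))
    (cond (call fAny (call fDiff (list [var 0, arg 1 1])))
      (call fReach (list [arg 1 0, var 0, arg 1 2]))
      (arg 1 1))

/-- Arguments `L, X, A`: the lists `L`, those of the vertices in `X` intersected with `A`. -/
def updBody : Code :=
  cond (arg 0 0)
    (cons (cond (head (arg 0 1)) (call fAnd (list [head (arg 0 0), arg 0 2])) (head (arg 0 0)))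
      (call fUpd (list [tail (arg 0 0), tail (arg 0 1), arg 0 2])))
    nil

/-- Arguments `a, p`: the exponent vector `a`, increased by one at the positions in `p`. -/
def incBody : Code :=
  cond (arg 0 0)
    (cons (cond (head (arg 0 1)) (cons nil (head (arg 0 0))) (head (arg 0 0)))
      (call fInc (list [tail (arg 0 0), tail (arg 0 1)])))
    nil

/-- Arguments `l, {h}, r`: the table `l` multiplied by `r * x_h`. -/
def scaleBody : Code :=
  cond (arg 0 0)
    (cons (cons (call fInc (list [head (head (arg 0 0)), arg 0 1]))
        (mul (tail (head (arg 0 0))) (arg 0 2)))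
      (call fScale (list [tail (arg 0 0), arg 0 1, arg 0 2])))
    nil

/-- Equality of two trees without atoms. -/
def eqBody : Code :=
  cond (arg 0 0)
    (cond (arg 0 1)
      (cond (call fEq (list [head (arg 0 0), head (arg 0 1)]))
        (call fEq (list [tail (arg 0 0), tail (arg 0 1)])) nil) nil)
    (cond (arg 0 1) nil tt)

/-- Arguments `l, m`: the table of the sum of the table `l` and the term `m`. -/
def addTermBody : Code :=
  cond (arg 0 0)
    (cond (call fEq (list [head (head (arg 0 0)), head (arg 0 1)]))
      (cons (cons (head (arg 0 1)) (add (tail (head (arg 0 0))) (tail (arg 0 1)))) (tail (arg 0 0)))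
      (cons (head (arg 0 0)) (call fAddTerm (list [tail (arg 0 0), arg 0 1]))))
    (cons (arg 0 1) nil)

/-- The table of the sum of two tables. -/
def addTableBody : Code :=
  cond (arg 0 0)
    (call fAddTable (list [tail (arg 0 0), call fAddTerm (list [arg 0 1, head (arg 0 0)])]))
    (arg 0 1)

/-- Arguments `S, L`: whether some vertex of `S` has an empty list. -/
def deadBody : Code :=
  cond (arg 0 0)
    (cond (cond (head (arg 0 0)) (cond (call fAny (head (arg 0 1))) nil tt) nil) tt
      (call fDead (list [tail (arg 0 0), tail (arg 0 1)])))
    nil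

/-- Arguments `S, L, A`: the number of vertices of `S` whose list is not contained in `A`. -/
def badBody : Code :=
  cond (arg 0 0)
    (cond (cond (head (arg 0 0)) (call fAny (call fDiff (list [head (arg 0 1), arg 0 2]))) nil)
      (cons nil (call fBad (list [tail (arg 0 0), tail (arg 0 1), arg 0 2])))
      (call fBad (list [tail (arg 0 0), tail (arg 0 1), arg 0 2])))
    nil

/-- Addition of unary numbers. -/
def appendBody : Code :=
  cond (arg 0 0) (cons nil (call fAppend (list [tail (arg 0 0), arg 0 1]))) (arg 0 1)

/-- Multiplication of unary numbers. -/
def mulBody : Code :=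
  cond (arg 0 0)
    (call fAppend (list [arg 0 1, call fMul (list [tail (arg 0 0), arg 0 1])])) nil

/-- Arguments `a, b`: whether `b ≤ a`, for unary numbers. -/
def geBody : Code :=
  cond (arg 0 1)
    (cond (arg 0 0) (call fGe (list [tail (arg 0 0), tail (arg 0 1)])) nil) tt

/-- The unary number `a / 2`. -/
def halfBody : Code :=
  cond (tail (var 0)) (cons nil (call fHalf (tail (tail (var 0))))) nil

/-- The unary number `Nat.log 2 a + 1`. -/
def logBody : Code :=
  bind (call fHalf (var 0)) (cond (var 0) (cons nil (call fLog (var 0))) tt)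

/-- Arguments `{h}, [{v}, S, L, M, θ]`: whether the pair `(v, h)` is good in the sense of `Good`. -/
def goodBody (A T : Val Unit) : Code :=
  cond (call fAny (call fDiff (list [call fRow (list [proj 0 (arg 0 1), proj 2 (arg 0 1)]), arg 0 0])))
    (bind (call fBad (list [call fAnd (list [call fRow (list [proj 0 (arg 0 1), proj 3 (arg 0 1)]),
        proj 1 (arg 0 1)]), proj 2 (arg 0 1), call fRow (list [arg 0 0, quote A])]))
      (call fGe (list [call fMul (list [var 0, call fMul (list [var 0, quote T])]),
        proj 4 (arg 1 1)])))
    tt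

/-- Arguments `X, [{v}, S, L, M, θ]`: the first colour `h` of `X` such that the pair `(v, h)` is good,
as a singleton, or `nil`. -/
def findColourBody : Code :=
  cond (call fAny (arg 0 0))
    (bind (call fFirst (arg 0 0))
      (cond (call fGood (list [var 0, arg 1 1])) (var 0)
        (call fFindColour (list [call fDiff (list [arg 1 0, var 0]), arg 1 1]))))
    nil

/-- Arguments `X, [S, L, M, θ]`: a good pair `(v, h)` with `v ∈ X` and `h ∈ L v`, or `nil`. -/
def findPairBody : Code :=
  cond (call fAny (arg 0 0))
    (bind (call fFirst (arg 0 0))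
      (bind (call fFindColour (list [call fRow (list [var 0, proj 1 (arg 1 1)]),
          cons (var 0) (arg 1 1)]))
        (cond (var 0) (cons (var 1) (var 0))
          (call fFindPair (list [call fDiff (list [arg 2 0, var 1]), arg 2 1])))))
    nil

/-- Arguments `F, M, A, D`: the set `M v ∩ A` for the first `v ∈ F` for which it is nonempty, and `D`
if there is no such `v`. -/
def pickBody : Code :=
  cond (arg 0 0)
    (cond (cond (head (arg 0 0)) (call fAny (call fAnd (list [head (arg 0 1), arg 0 2]))) nil)
      (call fAnd (list [head (arg 0 1), arg 0 2]))
      (call fPick (list [tail (arg 0 0), tail (arg 0 1), arg 0 2, arg 0 3])))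
    (arg 0 3)

/-- The bit vector of the whole set, of the length of the argument. -/
def fullBody : Code := cond (var 0) (cons tt (call fFull (tail (var 0)))) nil

/-- Arguments `{v}, {h}, L, M`: the lists after `v` has received the colour `h`. -/
def assignListsBody (A : Val Unit) : Code :=
  call fUpd (list [arg 0 2, call fRow (list [arg 0 0, arg 0 3]), call fRow (list [arg 0 1, quote A])])

/-- Arguments `{v}, {h}, l, W`: the table `l` multiplied by the term of the choice of `h` for `v`. -/
def assignTableBody : Code :=
  call fScale (list [arg 0 2, arg 0 1,
    call fRow (list [arg 0 1, call fRow (list [arg 0 0, arg 0 3])])])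

/-- Arguments `{v}, {h}, L`: the lists after the removal of `h` from the list of `v`. -/
def removeBody : Code :=
  call fUpd (list [arg 0 2, arg 0 0,
    call fDiff (list [call fRow (list [arg 0 0, arg 0 2]), arg 0 1])])

/-- The second phase, with arguments `S, Q, F, L, l, M, W`: the table `l` times the partition function
of the subgraph on the uncoloured vertices `S`. The vertices of `Q ⊆ S` are coloured first, one
after the other, and move to `F`. When `Q` is empty, one connected component of `S` is treated with
the neighbours of some vertex of `F` as its new `Q` (with a single vertex as its new `Q` if no vertex
of `F` has a neighbour there), and its table is the accumulator for the
remaining components. -/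
def solveBody : Code :=
  cond (call fAny (arg 0 1))
    (bind (call fFirst (arg 0 1))
      (bind (call fRow (list [var 0, arg 1 3]))
        (cond (call fAny (var 0))
          (bind (call fFirst (var 0))
            (call fAddTable (list [
              call fSolve (list [call fDiff (list [arg 3 0, var 2]),
                call fDiff (list [arg 3 1, var 2]), call fOr (list [arg 3 2, var 2]),
                call fAssignLists (list [var 2, var 0, arg 3 3, arg 3 5]),
                call fAssignTable (list [var 2, var 0, arg 3 4, arg 3 6]), arg 3 5, arg 3 6]),
              call fSolve (list [arg 3 0, arg 3 1, arg 3 2,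
                call fRemove (list [var 2, var 0, arg 3 3]), arg 3 4, arg 3 5, arg 3 6])])))
          nil)))
    (cond (call fAny (arg 0 0))
      (bind (call fReach (list [arg 0 0, call fFirst (arg 0 0), arg 0 5]))
        (call fSolve (list [call fDiff (list [arg 1 0, var 0]), arg 1 1, arg 1 2, arg 1 3,
          call fSolve (list [var 0,
            call fPick (list [arg 1 2, arg 1 5, var 0, call fFirst (arg 1 0)]),
            arg 1 1, arg 1 3, arg 1 4, arg 1 5, arg 1 6]), arg 1 5, arg 1 6])))
      (arg 0 4))

/-- The first phase, with arguments `S, L, l, M, W, θ`: as `solveBody`, but it branches on a good pair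
as long as there is one and only then starts the second phase. -/
def branchBody : Code :=
  cond (call fDead (list [arg 0 0, arg 0 1])) nil
    (bind (call fFindPair (list [arg 0 0, list [arg 0 0, arg 0 1, arg 0 3, arg 0 5]]))
      (cond (var 0)
        (call fAddTable (list [
          call fBranch (list [call fDiff (list [arg 1 0, head (var 0)]),
            call fAssignLists (list [head (var 0), tail (var 0), arg 1 1, arg 1 3]),
            call fAssignTable (list [head (var 0), tail (var 0), arg 1 2, arg 1 4]),
            arg 1 3, arg 1 4, arg 1 5]),
          call fBranch (list [arg 1 0,
            call fRemove (list [head (var 0), tail (var 0), arg 1 1]), arg 1 2,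
            arg 1 3, arg 1 4, arg 1 5])]))
        (bind (call fZeros (arg 1 0))
          (call fSolve (list [arg 2 0, var 0, var 0, arg 2 1, arg 2 2, arg 2 3, arg 2 4])))))

/-- The main function, with argument `(M, (L, W))`; `Z` is the exponent vector of the monomial `1`. The threshold `θ` is
`n * (Nat.log 2 n + 1) + 1`. -/
def mainBody (Z : Val Unit) : Code :=
  bind (call fZeros (head (var 0)))
    (call fBranch (list [call fFull (var 0), head (tail (var 1)),
      list [cons (quote Z) one], head (var 1), tail (tail (var 1)),
      cons nil (call fMul (list [var 0, call fLog (var 0)]))]))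

/-- The program; `A` is the adjacency matrix of `H`, `T` and `Z` are the numbers `t` and `q = |V(H)|`
in unary. As a list of `q` copies of `nil`, `Z` is also the zero exponent vector. -/
def program (A T Z : Val Unit) : Program :=
  [mainBody Z, muxBody, zerosBody, anyBody, firstBody, rowBody, andBody, diffBody, orBody,
    nbrsBody, reachBody, updBody, incBody, scaleBody, eqBody, addTermBody, addTableBody,
    deadBody, badBody, appendBody, mulBody, geBody, halfBody, logBody, goodBody A T,
    findColourBody, findPairBody, pickBody, solveBody, branchBody, fullBody, assignListsBody A,
    assignTableBody, removeBody]

end HCol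

/-! ### Sets, families and unary numbers -/

namespace HCol

open Lisp Lisp.Code Lisp.Val
open scoped Classical

variable {R : Type u}

theorem ofFamily_zero (f : Fin 0 → Val R) : ofFamily f = .nil := by simp [ofFamily]

theorem ofFamily_succ {m : ℕ} (f : Fin (m + 1) → Val R) :
    ofFamily f = .cons (f 0) (ofFamily fun i => f i.succ) := by
  simp [ofFamily, List.ofFn_succ]

@[simp] theorem ofProp_eq_nil {p : Prop} : (ofProp p : Val R) = .nil ↔ ¬ p := by
  unfold ofProp; split <;> simp_all

theorem ofProp_true {p : Prop} (h : p) : (ofProp p : Val R) = .cons .nil .nil := by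
  simp [ofProp, h]

/-- A predicate on `Fin m` as the list of its truth values. -/
noncomputable def bits {m : ℕ} (p : Fin m → Prop) : Val R := ofFamily fun i => ofProp (p i)

theorem bits_zero (f : Fin 0 → Prop) : (bits f : Val R) = .nil := by simp [bits, ofFamily]

theorem bits_succ {m : ℕ} (f : Fin (m + 1) → Prop) :
    (bits f : Val R) = .cons (ofProp (f 0)) (bits fun i => f i.succ) := by
  simp [bits, ofFamily, List.ofFn_succ]

theorem bits_congr {m : ℕ} {f g : Fin m → Prop} (h : ∀ i, f i ↔ g i) :
    (bits f : Val R) = bits g := by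
  congr 1; ext i; exact h i

theorem ofNat_eq_ofFamily (m : ℕ) : (ofNat m : Val R) = ofFamily fun _ : Fin m => .nil := by
  induction m with
  | zero => simp [ofFamily_zero, ofNat]
  | succ m ih => rw [ofFamily_succ, ofNat, ih]

theorem ofNat_zero : (ofNat 0 : Val R) = .nil := rfl
theorem ofNat_succ (m : ℕ) : (ofNat (m + 1) : Val R) = .cons .nil (ofNat m) := rfl

variable [CommSemiring R] {A T Z : Val Unit}

attribute [simp] wp Code.proj Code.list Code.arg Code.tt

theorem calls_mux {m : ℕ} (p : Fin m → Prop) (a b : Fin m → Val R) :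
    Calls (program A T Z) fMux (ofList [bits p, ofFamily a, ofFamily b])
      (ofFamily fun i => if p i then a i else b i) (40 * m + 10) := by
  induction m with
  | zero =>
    refine .of_wp (body := muxBody) rfl ?_
    simp [muxBody, bits_zero, ofFamily_zero]
    exact ⟨rfl, by omega⟩
  | succ m ih =>
    refine .of_wp (body := muxBody) rfl ?_
    by_cases h : p 0 <;> simp [muxBody, bits_succ, ofFamily_succ, h] <;>
      exact ⟨_, _, ih _ _ _, rfl, by omega⟩

theorem calls_zeros {m : ℕ} (a : Fin m → Val R) :
    Calls (program A T Z) fZeros (ofFamily a) (ofFamily fun _ : Fin m => .nil) (10 * m + 5) := by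
  induction m with
  | zero =>
    refine .of_wp (body := zerosBody) rfl ?_
    simp [zerosBody, ofFamily_zero]
    exact ⟨rfl, by omega⟩
  | succ m ih =>
    refine .of_wp (body := zerosBody) rfl ?_
    simp [zerosBody, ofFamily_succ]
    exact ⟨_, _, ih _, rfl, by omega⟩

theorem calls_full {m : ℕ} (a : Fin m → Val R) :
    Calls (program A T Z) fFull (ofFamily a) (bits fun _ : Fin m => True) (10 * m + 5) := by
  induction m with
  | zero =>
    refine .of_wp (body := fullBody) rfl ?_
    simp [fullBody, ofFamily_zero, bits_zero]
    exact ⟨rfl, by omega⟩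
  | succ m ih =>
    refine .of_wp (body := fullBody) rfl ?_
    simp [fullBody, ofFamily_succ, bits_succ]
    exact ⟨_, _, ih _, by rw [ofProp_true trivial], by omega⟩

theorem calls_any {m : ℕ} (p : Fin m → Prop) :
    Calls (program A T Z) fAny (bits p : Val R) (ofProp (∃ i, p i)) (10 * m + 5) := by
  induction m with
  | zero =>
    refine .of_wp (body := anyBody) rfl ?_
    simp [anyBody, bits_zero, ofProp]
    exact ⟨rfl, by omega⟩
  | succ m ih =>
    refine .of_wp (body := anyBody) rfl ?_
    by_cases h : p 0
    · simp [anyBody, bits_succ, h, Fin.exists_fin_succ, ofProp]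
      exact ⟨rfl, by omega⟩
    · simp [anyBody, bits_succ, h, Fin.exists_fin_succ]
      exact ⟨_, _, ih _, rfl, by omega⟩

theorem calls_first {m : ℕ} (p : Fin m → Prop) (hp : ∃ i, p i) :
    ∃ v, p v ∧ Calls (program A T Z) fFirst (bits p : Val R) (bits fun i => i = v) (20 * m + 5) := by
  induction m with
  | zero => exact hp.elim fun i => i.elim0
  | succ m ih =>
    by_cases h : p 0
    · refine ⟨0, h, .of_wp (body := firstBody) rfl ?_⟩
      simp [firstBody, bits_succ, h]
      refine ⟨_, _, calls_zeros _, ?_, by omega⟩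
      simp [ofProp, bits]
    · obtain ⟨v, hv, hc⟩ := ih (fun i => p i.succ) (by simpa [Fin.exists_fin_succ, h] using hp)
      refine ⟨v.succ, hv, .of_wp (body := firstBody) rfl ?_⟩
      simp [firstBody, bits_succ, h]
      refine ⟨_, _, hc, ?_, by omega⟩
      simp [ofProp, (Fin.succ_ne_zero _).symm]

theorem calls_row {m : ℕ} (v : Fin m) (a : Fin m → Val R) :
    Calls (program A T Z) fRow (ofList [bits fun i => i = v, ofFamily a]) (a v) (30 * m + 5) := by
  induction m with
  | zero => exact v.elim0
  | succ m ih =>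
    refine .of_wp (body := rowBody) rfl ?_
    cases v using Fin.cases with
    | zero =>
      simp [rowBody, bits_succ, ofFamily_succ]
      exact ⟨rfl, by omega⟩
    | succ v =>
      simp [rowBody, bits_succ, ofFamily_succ, (Fin.succ_ne_zero _).symm]
      exact ⟨_, _, ih v _, rfl, by omega⟩

theorem calls_and {m : ℕ} (p r : Fin m → Prop) :
    Calls (program A T Z) fAnd (ofList [(bits p : Val R), bits r]) (bits fun i => p i ∧ r i)
      (40 * m + 40) := by
  refine .of_wp (body := andBody) rfl ?_
  simp [andBody]
  refine ⟨_, _, calls_mux p (fun i => ofProp (r i)) (fun i => ofProp (p i)), ?_, by omega⟩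
  unfold bits
  congr 1; ext i; by_cases h : p i <;> simp [h, ofProp]

theorem calls_or {m : ℕ} (p r : Fin m → Prop) :
    Calls (program A T Z) fOr (ofList [(bits p : Val R), bits r]) (bits fun i => p i ∨ r i)
      (40 * m + 40) := by
  refine .of_wp (body := orBody) rfl ?_
  simp [orBody]
  refine ⟨_, _, calls_mux p (fun i => ofProp (p i)) (fun i => ofProp (r i)), ?_, by omega⟩
  unfold bits
  congr 1; ext i; by_cases h : p i <;> simp [h, ofProp]

theorem calls_diff {m : ℕ} (p r : Fin m → Prop) :
    Calls (program A T Z) fDiff (ofList [(bits p : Val R), bits r]) (bits fun i => p i ∧ ¬ r i)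
      (50 * m + 50) := by
  refine .of_wp (body := diffBody) rfl ?_
  simp [diffBody]
  refine ⟨_, _, calls_zeros _, _, _, calls_mux r _ (fun i => ofProp (p i)), ?_, by omega⟩
  unfold bits
  congr 1; ext i; by_cases h : r i <;> simp [h, ofProp]

theorem calls_nbrs {m n : ℕ} (X : Fin n → Prop) (M : Fin n → Fin m → Prop) (a : Fin m → Prop) :
    Calls (program A T Z) fNbrs (ofList [(bits X : Val R), ofFamily fun i => bits (M i), bits a])
      (bits fun j => a j ∨ ∃ i, X i ∧ M i j) (n * (40 * m + 100) + 20) := by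
  induction n generalizing a with
  | zero =>
    refine .of_wp (body := nbrsBody) rfl ?_
    simp [nbrsBody, bits_zero]
    exact ⟨rfl, by omega⟩
  | succ n ih =>
    refine .of_wp (body := nbrsBody) rfl ?_
    rw [Nat.succ_mul]
    by_cases h : X 0
    · simp [nbrsBody, bits_succ, ofFamily_succ, h]
      refine ⟨_, _, calls_or _ _, _, _, ih _ _ _, ?_, by omega⟩
      apply bits_congr
      intro j; rw [Fin.exists_fin_succ]; tauto
    · simp [nbrsBody, bits_succ, ofFamily_succ, h]
      refine ⟨_, _, ih _ _ _, ?_, by omega⟩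
      apply bits_congr
      intro j; rw [Fin.exists_fin_succ]; tauto

theorem calls_upd {m n : ℕ} (L : Fin n → Fin m → Prop) (X : Fin n → Prop) (a : Fin m → Prop) :
    Calls (program A T Z) fUpd (ofList [(ofFamily fun i => bits (L i) : Val R), bits X, bits a])
      (ofFamily fun i => bits fun j => L i j ∧ (X i → a j)) (n * (40 * m + 150) + 20) := by
  induction n with
  | zero =>
    refine .of_wp (body := updBody) rfl ?_
    simp [updBody, ofFamily_zero]
    exact ⟨rfl, by omega⟩
  | succ n ih =>
    refine .of_wp (body := updBody) rfl ?_
    rw [Nat.succ_mul]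
    by_cases h : X 0
    · simp [updBody, bits_succ, ofFamily_succ, h]
      exact ⟨_, _, calls_and _ _, _, _, ih _ _, rfl, by omega⟩
    · simp [updBody, bits_succ, ofFamily_succ, h]
      exact ⟨_, _, ih _ _, rfl, by omega⟩

theorem calls_inc {m : ℕ} (a : Fin m → ℕ) (p : Fin m → Prop) :
    Calls (program A T Z) fInc (ofList [(ofFamily fun i => ofNat (a i) : Val R), bits p])
      (ofFamily fun i => ofNat (a i + if p i then 1 else 0)) (50 * m + 20) := by
  induction m with
  | zero =>
    refine .of_wp (body := incBody) rfl ?_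
    simp [incBody, ofFamily_zero]
    exact ⟨rfl, by omega⟩
  | succ m ih =>
    refine .of_wp (body := incBody) rfl ?_
    by_cases h : p 0
    · simp [incBody, bits_succ, ofFamily_succ, h]
      exact ⟨_, _, ih _ _, rfl, by omega⟩
    · simp [incBody, bits_succ, ofFamily_succ, h]
      exact ⟨_, _, ih _ _, rfl, by omega⟩

/-- The cost is bounded in terms of the first number alone, although `fEq` treats both alike: the
recursion stops as soon as one of the numbers is exhausted. -/
theorem calls_eq_ofNat (a b : ℕ) :
    Calls (program A T Z) fEq (ofList [(ofNat a : Val R), ofNat b]) (ofProp (a = b))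
      (60 * a + 20) := by
  induction a generalizing b with
  | zero =>
    refine .of_wp (body := eqBody) rfl ?_
    cases b with
    | zero => simp [eqBody, ofNat, ofProp]; exact ⟨rfl, by omega⟩
    | succ b => simp [eqBody, ofNat, ofProp]; exact ⟨rfl, by omega⟩
  | succ a ih =>
    refine .of_wp (body := eqBody) rfl ?_
    cases b with
    | zero => simp [eqBody, ofNat, ofProp]; exact ⟨rfl, by omega⟩
    | succ b =>
      simp [eqBody, ofNat_succ]
      refine ⟨.cons .nil .nil, 30, ?_, ?_, ?_⟩
      · exact .of_wp (body := eqBody) rfl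
          (by simp [eqBody]; exact ⟨rfl, by omega⟩)
      · intro _
        exact ⟨_, _, ih b, rfl, by omega⟩
      · simp

theorem calls_eq {m B : ℕ} (a b : Fin m → ℕ) (ha : ∀ i, a i ≤ B) :
    Calls (program A T Z) fEq
      (ofList [(ofFamily fun i => ofNat (a i) : Val R), ofFamily fun i => ofNat (b i)])
      (ofProp (a = b)) (m * (60 * B + 80) + 20) := by
  induction m with
  | zero =>
    refine .of_wp (body := eqBody) rfl ?_
    simp [eqBody, ofFamily_zero]
    exact ⟨by rw [ofProp_true (Subsingleton.elim _ _)], by omega⟩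
  | succ m ih =>
    refine .of_wp (body := eqBody) rfl ?_
    simp [eqBody, ofFamily_succ]
    have := Nat.mul_le_mul_left 60 (ha 0)
    rw [Nat.succ_mul]
    have key : a = b ↔ a 0 = b 0 ∧ (fun i : Fin m => a i.succ) = fun i => b i.succ := by
      simp [funext_iff, Fin.forall_fin_succ]
    refine ⟨_, _, calls_eq_ofNat _ _, ?_, ?_⟩
    · intro h
      have h := ofProp_eq_nil.not.1 h
      rw [not_not] at h
      refine ⟨_, _, ih (fun i => a i.succ) (fun i => b i.succ) fun i => ha _, ?_, by omega⟩
      simp [key, h]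
    · intro h
      rw [ofProp_eq_nil] at h
      exact ⟨by simp [key, h, ofProp], by omega⟩

theorem calls_append (a b : ℕ) :
    Calls (program A T Z) fAppend (ofList [(ofNat a : Val R), ofNat b]) (ofNat (a + b))
      (20 * a + 10) := by
  induction a with
  | zero =>
    refine .of_wp (body := appendBody) rfl ?_
    simp [appendBody, ofNat_zero]
    exact ⟨rfl, by omega⟩
  | succ a ih =>
    refine .of_wp (body := appendBody) rfl ?_
    simp [appendBody, ofNat_succ]
    exact ⟨_, _, ih, by rw [Nat.succ_add]; rfl, by omega⟩

theorem calls_mul (a b : ℕ) :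
    Calls (program A T Z) fMul (ofList [(ofNat a : Val R), ofNat b]) (ofNat (a * b))
      (a * (20 * b + 50) + 10) := by
  induction a with
  | zero =>
    refine .of_wp (body := mulBody) rfl ?_
    simp [mulBody, ofNat_zero]
    exact ⟨rfl, by omega⟩
  | succ a ih =>
    refine .of_wp (body := mulBody) rfl ?_
    simp [mulBody, ofNat_succ]
    rw [Nat.succ_mul, Nat.succ_mul]
    exact ⟨_, _, ih, _, _, calls_append _ _, by rw [add_comm], by omega⟩

theorem calls_ge (a b : ℕ) :
    Calls (program A T Z) fGe (ofList [(ofNat a : Val R), ofNat b]) (ofProp (b ≤ a))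
      (30 * b + 20) := by
  induction b generalizing a with
  | zero =>
    refine .of_wp (body := geBody) rfl ?_
    simp [geBody, ofNat_zero, ofProp]
    exact ⟨rfl, by omega⟩
  | succ b ih =>
    refine .of_wp (body := geBody) rfl ?_
    cases a with
    | zero => simp [geBody, ofNat_zero, ofNat_succ, ofProp]; exact ⟨rfl, by omega⟩
    | succ a =>
      simp [geBody, ofNat_succ]
      exact ⟨_, _, ih a, rfl, by omega⟩

theorem calls_half (a : ℕ) :
    Calls (program A T Z) fHalf (ofNat a : Val R) (ofNat (a / 2)) (10 * a + 10) := by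
  induction a using Nat.twoStepInduction with
  | zero => exact .of_wp (body := halfBody) rfl (by simp [halfBody, ofNat]; exact ⟨rfl, by omega⟩)
  | one => exact .of_wp (body := halfBody) rfl (by simp [halfBody, ofNat]; exact ⟨rfl, by omega⟩)
  | more a ih _ =>
    refine .of_wp (body := halfBody) rfl ?_
    simp [halfBody, ofNat_succ]
    exact ⟨_, _, ih, rfl, by omega⟩

theorem calls_log {m : ℕ} (a : ℕ) (ha : a ≤ m) :
    Calls (program A T Z) fLog (ofNat a : Val R) (ofNat (Nat.log 2 a + 1))
      (a * (10 * m + 30) + 10 * m + 30) := by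
  induction a using Nat.strong_induction_on with
  | _ a ih =>
    refine .of_wp (body := logBody) rfl ?_
    simp [logBody]
    refine ⟨_, _, calls_half a, ?_, ?_⟩
    · intro h
      have h2 : 2 ≤ a := by
        by_contra h2
        rw [Nat.div_eq_of_lt (by omega)] at h
        exact h rfl
      refine ⟨_, _, ih (a / 2) (by omega) (by omega), ?_, ?_⟩
      · rw [Nat.log_of_one_lt_of_le (by omega) h2]; rfl
      · have h3 : (a / 2 + 1) * (10 * m + 30) ≤ a * (10 * m + 30) :=
          Nat.mul_le_mul_right _ (by omega)
        rw [Nat.succ_mul] at h3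
        omega
    · intro h
      have h2 : a < 2 := by
        by_contra h2
        obtain ⟨k, hk⟩ : ∃ k, a / 2 = k + 1 := ⟨a / 2 - 1, by omega⟩
        rw [hk] at h
        cases h
      refine ⟨by rw [Nat.log_of_lt h2]; rfl, by omega⟩

end HCol

/-! ### Statistics of lists of colours -/

namespace HCol

open Lisp Lisp.Code Lisp.Val
open scoped Classical

variable {R : Type u} [CommSemiring R] {A T Z : Val Unit}

theorem calls_dead {m n : ℕ} (S : Fin n → Prop) (L : Fin n → Fin m → Prop) :
    Calls (program A T Z) fDead (ofList [(bits S : Val R), ofFamily fun i => bits (L i)])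
      (ofProp (∃ i, S i ∧ ∀ j, ¬ L i j)) (n * (10 * m + 100) + 20) := by
  induction n with
  | zero =>
    refine .of_wp (body := deadBody) rfl ?_
    simp [deadBody, bits_zero, ofProp]
    exact ⟨rfl, by omega⟩
  | succ n ih =>
    refine .of_wp (body := deadBody) rfl ?_
    rw [Nat.succ_mul]
    by_cases h : S 0
    · simp [deadBody, bits_succ, ofFamily_succ, h]
      refine ⟨_, _, calls_any _, fun h1 => ?_, fun h1 => ?_⟩
      · rw [ofProp_eq_nil, not_not] at h1
        refine ⟨_, _, ih _ _, ?_, by omega⟩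
        congr 1
        rw [Fin.exists_fin_succ]
        refine propext ⟨fun h2 => .inr h2, ?_⟩
        rintro (⟨-, h2⟩ | h2)
        · exact absurd h1 (by simpa using h2)
        · exact h2
      · rw [ofProp_eq_nil] at h1
        refine ⟨?_, by omega⟩
        rw [ofProp_true]
        exact ⟨0, h, by simpa using h1⟩
    · simp [deadBody, bits_succ, ofFamily_succ, h]
      refine ⟨_, _, ih _ _, ?_, by omega⟩
      congr 1
      rw [Fin.exists_fin_succ]
      simp [h]

theorem calls_bad {m n : ℕ} (S : Fin n → Prop) (L : Fin n → Fin m → Prop) (a : Fin m → Prop) :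
    Calls (program A T Z) fBad (ofList [(bits S : Val R), ofFamily fun i => bits (L i), bits a])
      (ofNat (Finset.univ.filter fun i => S i ∧ ∃ j, L i j ∧ ¬ a j).card)
      (n * (60 * m + 200) + 20) := by
  induction n with
  | zero =>
    refine .of_wp (body := badBody) rfl ?_
    simp [badBody, bits_zero]
    exact ⟨rfl, by omega⟩
  | succ n ih =>
    refine .of_wp (body := badBody) rfl ?_
    rw [Nat.succ_mul, Fin.card_filter_univ_succ]
    by_cases h : S 0
    · simp only [badBody, bits_succ, ofFamily_succ]
      simp [h]
      refine ⟨_, _, calls_diff _ _, _, _, calls_any _, fun h1 => ?_, fun h1 => ?_⟩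
      · rw [ofProp_eq_nil, not_not] at h1
        refine ⟨_, _, ih _ _, ?_, by omega⟩
        rw [if_pos h1, ofNat_succ]
      · rw [ofProp_eq_nil] at h1
        refine ⟨_, _, ih _ _, ?_, by omega⟩
        rw [if_neg h1]
    · simp only [badBody, bits_succ, ofFamily_succ]
      simp [h]
      exact ⟨_, _, ih _ _, rfl, by omega⟩

theorem calls_pick {m n : ℕ} (F : Fin n → Prop) (M : Fin n → Fin m → Prop) (a : Fin m → Prop)
    (d : Val R) :
    (∃ v, F v ∧ (∃ i, M v i ∧ a i) ∧ Calls (program A T Z) fPick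
      (ofList [(bits F : Val R), ofFamily fun i => bits (M i), bits a, d])
        (bits fun i => M v i ∧ a i) (n * (100 * m + 200) + 30)) ∨
    ((∀ v, F v → ¬ ∃ i, M v i ∧ a i) ∧ Calls (program A T Z) fPick
      (ofList [(bits F : Val R), ofFamily fun i => bits (M i), bits a, d])
        d (n * (100 * m + 200) + 30)) := by
  induction n with
  | zero =>
    refine .inr ⟨fun v => v.elim0, .of_wp (body := pickBody) rfl ?_⟩
    simp [pickBody, bits_zero]
    exact ⟨rfl, by omega⟩
  | succ n ih =>
    rw [Nat.succ_mul]
    by_cases h : F 0 ∧ ∃ i, M 0 i ∧ a i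
    · refine .inl ⟨0, h.1, h.2, .of_wp (body := pickBody) rfl ?_⟩
      simp [pickBody, bits_succ, ofFamily_succ, h.1]
      refine ⟨_, _, calls_and _ _, _, _, calls_any _, fun h1 => ?_, fun h1 => ?_⟩
      · exact ⟨_, _, calls_and _ _, rfl, by omega⟩
      · exact absurd h.2 (by simpa using h1)
    · have key : ∀ y, Calls (program A T Z) fPick
          (ofList [(bits (fun i => F i.succ) : Val R), ofFamily fun i => bits (M i.succ), bits a, d])
          y (n * (100 * m + 200) + 30) →
          Calls (program A T Z) fPick
          (ofList [(bits F : Val R), ofFamily fun i => bits (M i), bits a, d])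
          y (n * (100 * m + 200) + (100 * m + 200) + 30) := by
        intro y hy
        refine .of_wp (body := pickBody) rfl ?_
        by_cases h0 : F 0
        · simp [pickBody, bits_succ, ofFamily_succ, h0]
          refine ⟨_, _, calls_and _ _, _, _, calls_any _, fun h1 => ?_, fun h1 => ?_⟩
          · exact absurd ⟨h0, by simpa using h1⟩ h
          · exact ⟨_, _, hy, rfl, by omega⟩
        · simp [pickBody, bits_succ, ofFamily_succ, h0]
          exact ⟨_, _, hy, rfl, by omega⟩
      rcases ih (fun i => F i.succ) (fun i => M i.succ) with ⟨v, h1, h2, h3⟩ | ⟨h1, h3⟩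
      · exact .inl ⟨v.succ, h1, h2, key _ h3⟩
      · refine .inr ⟨fun v => ?_, key _ h3⟩
        cases v using Fin.cases with
        | zero => exact fun h2 h3 => h ⟨h2, h3⟩
        | succ v => exact h1 v

/-! ### Coefficient tables -/

variable {α β : Type*} {H : Graph α β} {q : ℕ} (e : Fin q ≃ V(H))

/-- A table, that is, a list of monomials with coefficients, as a tree. -/
def encodeTable (l : List ((V(H) →₀ ℕ) × R)) : Val R := .ofList (l.map (encodeTerm e))

/-- Adds a term to a table, merging it with the entry of the same monomial if there is one. -/
noncomputable def addTerm {M : Type*} : List (M × R) → M × R → List (M × R)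
  | [], x => [x]
  | y :: l, x => if y.1 = x.1 then (x.1, y.2 + x.2) :: l else y :: addTerm l x

/-- Adds the terms of the first table to the second one. -/
noncomputable def addTable {M : Type*} : List (M × R) → List (M × R) → List (M × R)
  | [], b => b
  | x :: a, b => addTable a (addTerm b x)

/-- No monomial occurs twice in the table `l`, and all exponents are at most `B`. The second condition
bounds the length of the table. -/
structure IsTable {σ : Type*} (B : ℕ) (l : List ((σ →₀ ℕ) × R)) : Prop where
  nodup : (l.map Prod.fst).Nodup
  le : ∀ y ∈ l, ∀ i, y.1 i ≤ B

/-- The polynomial given by a table. -/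
noncomputable def tableSum {σ : Type*} (l : List ((σ →₀ ℕ) × R)) : MvPolynomial σ R :=
  (l.map fun m => MvPolynomial.monomial m.1 m.2).sum

theorem mem_map_addTerm {M : Type*} {l : List (M × R)} {x : M × R} {a : M} :
    a ∈ (addTerm l x).map Prod.fst ↔ a = x.1 ∨ a ∈ l.map Prod.fst := by
  induction l with
  | nil => simp [addTerm]
  | cons y l ih =>
    unfold addTerm
    split_ifs with h
    · simp only [List.map_cons, List.mem_cons, h]; tauto
    · rw [List.map_cons, List.mem_cons, ih, List.map_cons, List.mem_cons]; tauto

theorem nodup_addTerm {M : Type*} {l : List (M × R)} {x : M × R} (h : (l.map Prod.fst).Nodup) :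
    ((addTerm l x).map Prod.fst).Nodup := by
  induction l with
  | nil => simp [addTerm]
  | cons y l ih =>
    rw [List.map_cons, List.nodup_cons] at h
    unfold addTerm
    split_ifs with hy
    · simpa [← hy] using h
    · rw [List.map_cons, List.nodup_cons, mem_map_addTerm]
      exact ⟨by tauto, ih h.2⟩

theorem IsTable.addTerm {σ : Type*} {B : ℕ} {l : List ((σ →₀ ℕ) × R)} {x : (σ →₀ ℕ) × R}
    (h : IsTable B l) (hx : ∀ i, x.1 i ≤ B) : IsTable B (addTerm l x) := by
  refine ⟨nodup_addTerm h.1, fun y hy => ?_⟩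
  have := mem_map_addTerm.1 (List.mem_map_of_mem (f := Prod.fst) hy)
  rcases this with h1 | h1
  · rwa [h1]
  · obtain ⟨z, hz, h2⟩ := List.mem_map.1 h1
    rw [← h2]; exact h.2 z hz

theorem tableSum_addTerm {σ : Type*} (l : List ((σ →₀ ℕ) × R)) (x : (σ →₀ ℕ) × R) :
    tableSum (addTerm l x) = tableSum l + MvPolynomial.monomial x.1 x.2 := by
  induction l with
  | nil => simp [addTerm, tableSum]
  | cons y l ih =>
    unfold addTerm
    split_ifs with hy
    · simp [tableSum, hy, add_right_comm]
    · simp only [tableSum, List.map_cons, List.sum_cons] at ih ⊢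
      rw [ih, add_assoc]

theorem IsTable.addTable {σ : Type*} {B : ℕ} {a b : List ((σ →₀ ℕ) × R)}
    (ha : ∀ y ∈ a, ∀ i, y.1 i ≤ B) (hb : IsTable B b) : IsTable B (addTable a b) := by
  induction a generalizing b with
  | nil => exact hb
  | cons x a ih => exact ih (fun y hy => ha y (by simp [hy])) (hb.addTerm (ha x (by simp)))

theorem tableSum_addTable {σ : Type*} (a b : List ((σ →₀ ℕ) × R)) :
    tableSum (addTable a b) = tableSum a + tableSum b := by
  induction a generalizing b with
  | nil => simp [addTable, tableSum]
  | cons x a ih =>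
    rw [addTable, ih, tableSum_addTerm]
    simp only [tableSum, List.map_cons, List.sum_cons]
    ring

include e in
omit [CommSemiring R] in
/-- There are at most `(B + 1) ^ q` monomials with exponents at most `B`. -/
theorem IsTable.length_le {B : ℕ} {l : List ((V(H) →₀ ℕ) × R)} (h : IsTable B l) :
    l.length ≤ (B + 1) ^ q := by
  rw [← List.length_map (f := Prod.fst)]
  let g : (V(H) →₀ ℕ) → (Fin q → ℕ) := fun m i => m (e i)
  have hg : Function.Injective g := by
    intro a b hab
    ext x
    simpa [g] using congrFun hab (e.symm x)
  have h1 : ((l.map Prod.fst).map g).Nodup := h.nodup.map hg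
  rw [← List.length_map (f := g), ← List.toFinset_card_of_nodup h1]
  refine (Finset.card_le_card (t := Fintype.piFinset fun _ : Fin q => Finset.range (B + 1))
    fun x hx => ?_).trans (by simp)
  simp only [List.mem_toFinset, List.mem_map] at hx
  obtain ⟨_, ⟨y, hy, rfl⟩, rfl⟩ := hx
  simp only [Fintype.mem_piFinset, Finset.mem_range]
  intro i
  have := h.le y hy (e i)
  simp only [g]
  omega

theorem calls_addTerm {B : ℕ} (l : List ((V(H) →₀ ℕ) × R)) (hl : ∀ y ∈ l, ∀ i, y.1 i ≤ B)
    (x : (V(H) →₀ ℕ) × R) :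
    Calls (program A T Z) fAddTerm (ofList [encodeTable e l, encodeTerm e x])
      (encodeTable e (addTerm l x)) (l.length * (q * (60 * B + 80) + 100) + 50) := by
  induction l with
  | nil =>
    refine .of_wp (body := addTermBody) rfl ?_
    simp [addTermBody, encodeTable, addTerm]
    exact ⟨rfl, by omega⟩
  | cons y l ih =>
    refine .of_wp (body := addTermBody) rfl ?_
    rw [List.length_cons, Nat.succ_mul]
    simp [addTermBody, encodeTable, encodeTerm]
    have key : ((fun i => y.1 (e i)) = fun i => x.1 (e i)) ↔ y.1 = x.1 := by
      refine ⟨fun h => ?_, fun h => by rw [h]⟩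
      ext v
      simpa using congrFun h (e.symm v)
    refine ⟨_, _, calls_eq (fun i => y.1 (e i)) (fun i => x.1 (e i)) (B := B)
      fun i => hl y (by simp) _, fun h => ?_, fun h => ?_⟩
    · rw [ofProp_eq_nil, not_not, key] at h
      refine ⟨?_, by omega⟩
      simp [addTerm, h, encodeTerm]
    · rw [ofProp_eq_nil, key] at h
      refine ⟨_, _, ih fun y hy => hl y (by simp [hy]), ?_, by omega⟩
      simp [addTerm, h, encodeTerm, encodeTable]

theorem calls_addTable {B : ℕ} (a b : List ((V(H) →₀ ℕ) × R)) (ha : ∀ y ∈ a, ∀ i, y.1 i ≤ B)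
    (hb : IsTable B b) :
    Calls (program A T Z) fAddTable (ofList [encodeTable e a, encodeTable e b])
      (encodeTable e (addTable a b))
      (a.length * ((B + 1) ^ q * (q * (60 * B + 80) + 100) + 150) + 50) := by
  induction a generalizing b with
  | nil =>
    refine .of_wp (body := addTableBody) rfl ?_
    simp [addTableBody, encodeTable, addTable]
    exact ⟨rfl, by omega⟩
  | cons x a ih =>
    refine .of_wp (body := addTableBody) rfl ?_
    rw [List.length_cons, Nat.succ_mul]
    have h1 : (encodeTable e (x :: a) : Val R) = .cons (encodeTerm e x) (encodeTable e a) := rfl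
    simp [addTableBody, h1]
    have h2 := Nat.mul_le_mul_right (q * (60 * B + 80) + 100) (hb.length_le e)
    refine ⟨_, _, calls_addTerm e b hb.le x, _, _,
      ih _ (fun y hy => ha y (by simp [hy])) (hb.addTerm (ha x (by simp))), rfl, by omega⟩

/-- Multiplication of a table by `r * x_c`. -/
noncomputable def scale {σ : Type*} (c : σ) (r : R) (l : List ((σ →₀ ℕ) × R)) :
    List ((σ →₀ ℕ) × R) :=
  l.map fun m => (m.1 + Finsupp.single c 1, m.2 * r)

theorem IsTable.scale {σ : Type*} {B : ℕ} {l : List ((σ →₀ ℕ) × R)} (h : IsTable B l) (c : σ)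
    (r : R) : IsTable (B + 1) (scale c r l) := by
  refine ⟨?_, ?_⟩
  · have : (HCol.scale c r l).map Prod.fst = (l.map Prod.fst).map (· + Finsupp.single c 1) := by
      simp [HCol.scale, Function.comp_def]
    rw [this]
    exact h.nodup.map (add_left_injective _)
  · intro y hy i
    obtain ⟨z, hz, rfl⟩ := List.mem_map.1 hy
    have := h.le z hz i
    simp only [Finsupp.add_apply, Finsupp.single_apply]
    split_ifs <;> omega

theorem tableSum_scale {σ : Type*} (c : σ) (r : R) (l : List ((σ →₀ ℕ) × R)) :
    tableSum (scale c r l) = tableSum l * (MvPolynomial.C r * MvPolynomial.X c) := by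
  have h : (MvPolynomial.C r * MvPolynomial.X c : MvPolynomial σ R)
      = MvPolynomial.monomial (Finsupp.single c 1) r := by
    rw [MvPolynomial.X, MvPolynomial.C_mul_monomial, mul_one]
  rw [h]
  induction l with
  | nil => simp [scale, tableSum]
  | cons y l ih =>
    simp only [tableSum, scale, List.map_cons, List.sum_cons] at ih ⊢
    rw [ih, add_mul, MvPolynomial.monomial_mul]

theorem calls_scale (l : List ((V(H) →₀ ℕ) × R)) (c : Fin q) (r : R) :
    Calls (program A T Z) fScale (ofList [encodeTable e l, bits fun i => i = c, .atom r])
      (encodeTable e (scale (e c) r l)) (l.length * (50 * q + 100) + 20) := by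
  induction l with
  | nil =>
    refine .of_wp (body := scaleBody) rfl ?_
    simp [scaleBody, encodeTable, scale]
    exact ⟨rfl, by omega⟩
  | cons y l ih =>
    refine .of_wp (body := scaleBody) rfl ?_
    rw [List.length_cons, Nat.succ_mul]
    have h1 : (encodeTable e (y :: l) : Val R) = .cons (encodeTerm e y) (encodeTable e l) := rfl
    simp [scaleBody, h1, encodeTerm]
    refine ⟨_, _, calls_inc (fun i => y.1 (e i)) _, _, _, ih, ?_, by omega⟩
    simp [encodeTable, scale, encodeTerm, Finsupp.single_apply, eq_comm]

end HCol

/-! ### Constants in programs -/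

namespace Lisp

variable {R : Type u}

/-- The size of a tree. -/
def Val.size : Val R → ℕ
  | .nil => 1
  | .atom _ => 1
  | .cons a b => a.size + b.size + 1

/-- The value of a quoted constant in the trees over `R`. -/
def Val.lift : Val Unit → Val R
  | .nil => .nil
  | .atom _ => .nil
  | .cons a b => .cons a.lift b.lift

@[simp] theorem wp_quote [CommSemiring R] {P : Program} {env : List (Val R)} {A : Val Unit}
    {Q : Val R → ℕ → Prop} : wp P (.quote A) env Q ↔ Q A.lift (Val.size (R := Unit) A) := by
  induction A generalizing Q with
  | nil => simp [Code.quote, Val.lift, Val.size]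
  | atom r => simp [Code.quote, Val.lift, Val.size]
  | cons a b iha ihb => simp [Code.quote, Val.lift, Val.size, iha, ihb]

open Val

theorem lift_ofFamily {m : ℕ} (f : Fin m → Val Unit) :
    (lift (ofFamily f) : Val R) = ofFamily fun i => lift (f i) := by
  induction m with
  | zero => simp [ofFamily, lift]
  | succ m ih =>
    rw [HCol.ofFamily_succ, HCol.ofFamily_succ, lift, ih]

theorem lift_ofProp (p : Prop) : (lift (ofProp p) : Val R) = ofProp p := by
  unfold ofProp; split_ifs <;> simp [lift]

theorem lift_bits {m : ℕ} (p : Fin m → Prop) : (lift (HCol.bits p) : Val R) = HCol.bits p := by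
  simp [HCol.bits, lift_ofFamily, lift_ofProp]

theorem lift_ofNat (m : ℕ) : (lift (ofNat m) : Val R) = ofNat m := by
  induction m with
  | zero => rfl
  | succ m ih => simp [ofNat, lift, ih]

theorem size_ofFamily_le {m c : ℕ} (f : Fin m → Val Unit) (h : ∀ i, (f i).size ≤ c) :
    (ofFamily f).size ≤ m * (c + 1) + 1 := by
  induction m with
  | zero => simp [ofFamily, size]
  | succ m ih =>
    rw [HCol.ofFamily_succ, size, Nat.succ_mul]
    have := ih (fun i => f i.succ) fun i => h _
    have := h 0
    omega

theorem size_bits_le {m : ℕ} (p : Fin m → Prop) : (HCol.bits p : Val Unit).size ≤ m * 4 + 1 := by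
  refine size_ofFamily_le (c := 3) _ fun i => ?_
  unfold ofProp; split_ifs <;> simp [size]

theorem size_ofNat (m : ℕ) : (ofNat m : Val Unit).size = 2 * m + 1 := by
  induction m with
  | zero => rfl
  | succ m ih => simp [ofNat, size, ih]; ring

end Lisp

/-! ### Sets of vertices and of colours -/

namespace HCol

open Lisp Lisp.Code Lisp.Val
open scoped Classical

/-- The characteristic vector of a set. -/
noncomputable def mask {R : Type u} {m : ℕ} (S : Finset (Fin m)) : Val R := bits fun i => i ∈ S

/-- A family of sets, as the list of characteristic vectors. -/
noncomputable def masks {R : Type u} {m n : ℕ} (L : Fin n → Finset (Fin m)) : Val R :=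
  ofFamily fun i => mask (L i)

/-- The program for the target graph on `Fin q` with neighbourhoods `HN`. -/
noncomputable def prog {q : ℕ} (HN : Fin q → Finset (Fin q)) (t : ℕ) : Program :=
  program (masks HN) (ofNat t) (ofNat q)

/-- `N` dominates the parameters and the length of every table that can occur. With this, the cost of
every function outside the two search phases is bounded by a fixed power of `N`. -/
structure Big (n q t N : ℕ) : Prop where
  thousand : 1000 ≤ N
  n_le : n ≤ N
  q_le : q ≤ N
  t_le : t ≤ N
  table_le : (n + 1) ^ q ≤ N

theorem Big.pow_succ {n q t N : ℕ} (h : Big n q t N) (k : ℕ) : 1000 * N ^ k ≤ N ^ (k + 1) := by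
  have h1 := Nat.mul_le_mul h.thousand (Nat.le_refl (N ^ k))
  have h2 : N ^ (k + 1) = N * N ^ k := by ring
  omega

variable {R : Type u} [CommSemiring R] {n q t N : ℕ} {HN : Fin q → Finset (Fin q)}

theorem Big.le_sq (h : Big n q t N) : 200 * n + 200 * q + 200 * t + 200 ≤ N ^ 2 := by
  have := Nat.mul_le_mul_right N h.1
  have := h.2
  have := h.3
  have := h.4
  have := h.1
  rw [pow_two]
  omega

theorem Big.le_cube (h : Big n q t N) :
    n * (100 * n + 100 * q + 400) + 50 ≤ N ^ 3 := by
  have h1 := Nat.mul_le_mul h.2 (show 100 * n + 100 * q + 400 ≤ 201 * N by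
    have := h.2; have := h.3; have := h.1; omega)
  have h2 : 1000 * N ^ 2 ≤ N ^ 3 := h.pow_succ 2
  have h3 : N * (201 * N) = 201 * N ^ 2 := by ring
  have h4 := h.le_sq
  rw [h3] at h1
  linarith

omit [CommSemiring R] in
theorem bits_eq_mask {m : ℕ} {S : Finset (Fin m)} {p : Fin m → Prop} (h : ∀ i, p i ↔ i ∈ S) :
    (bits p : Val R) = mask S := bits_congr h

section sets

variable {m : ℕ} (S X : Finset (Fin m)) (hB : Big n q t N)
include hB

theorem run_and (hm : m ≤ n ∨ m ≤ q) : Calls (prog HN t) fAnd (ofList [(mask S : Val R), mask X])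
    (mask (S ∩ X)) (N ^ 2) := by
  have h := calls_and (A := masks HN) (T := ofNat t) (Z := ofNat q) (R := R) (· ∈ S) (· ∈ X)
  exact h.cast (bits_eq_mask (by simp)) (by have := hB.le_sq; omega)

theorem run_or (hm : m ≤ n ∨ m ≤ q) : Calls (prog HN t) fOr (ofList [(mask S : Val R), mask X])
    (mask (S ∪ X)) (N ^ 2) := by
  have h := calls_or (A := masks HN) (T := ofNat t) (Z := ofNat q) (R := R) (· ∈ S) (· ∈ X)
  exact h.cast (bits_eq_mask (by simp)) (by have := hB.le_sq; omega)

theorem run_diff (hm : m ≤ n ∨ m ≤ q) : Calls (prog HN t) fDiff (ofList [(mask S : Val R), mask X])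
    (mask (S \ X)) (N ^ 2) := by
  have h := calls_diff (A := masks HN) (T := ofNat t) (Z := ofNat q) (R := R) (· ∈ S) (· ∈ X)
  exact h.cast (bits_eq_mask (by simp)) (by have := hB.le_sq; omega)

theorem run_any (hm : m ≤ n ∨ m ≤ q) : Calls (prog HN t) fAny (mask S : Val R)
    (ofProp S.Nonempty) (N ^ 2) :=
  (calls_any _).mono (by have := hB.le_sq; omega)

theorem run_first (hm : m ≤ n ∨ m ≤ q) (hS : S.Nonempty) :
    ∃ v ∈ S, Calls (prog HN t) fFirst (mask S : Val R) (mask {v}) (N ^ 2) := by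
  obtain ⟨v, hv, h⟩ := calls_first (A := masks HN) (T := ofNat t) (Z := ofNat q) (R := R) _ hS
  exact ⟨v, hv, h.cast (bits_eq_mask (by simp)) (by have := hB.le_sq; omega)⟩

theorem run_row (hm : m ≤ n ∨ m ≤ q) (v : Fin m) (a : Fin m → Val R) :
    Calls (prog HN t) fRow (ofList [mask {v}, ofFamily a]) (a v) (N ^ 2) := by
  have h := calls_row (A := masks HN) (T := ofNat t) (Z := ofNat q) v a
  rw [show (bits fun i => i = v : Val R) = mask {v} from bits_eq_mask (by simp)] at h
  exact h.mono (by have := hB.le_sq; omega)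

end sets

section graph
variable (hB : Big n q t N)
include hB

theorem run_nbrs (X a : Finset (Fin n)) (M : Fin n → Finset (Fin n)) :
    Calls (prog HN t) fNbrs (ofList [(mask X : Val R), masks M, mask a])
      (mask (a ∪ X.biUnion M)) (N ^ 3) := by
  have h := calls_nbrs (A := masks HN) (T := ofNat t) (Z := ofNat q) (R := R)
    (· ∈ X) (fun i j => j ∈ M i) (· ∈ a)
  refine h.cast (bits_eq_mask (by simp)) (le_trans ?_ hB.le_cube)
  have : n * (40 * n + 100) ≤ n * (100 * n + 100 * q + 400) := Nat.mul_le_mul_left _ (by omega)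
  omega

theorem run_upd (X : Finset (Fin n)) (L : Fin n → Finset (Fin q)) (a : Finset (Fin q)) :
    Calls (prog HN t) fUpd (ofList [(masks L : Val R), mask X, mask a])
      (masks fun u => if u ∈ X then L u ∩ a else L u) (N ^ 3) := by
  have h := calls_upd (A := masks HN) (T := ofNat t) (Z := ofNat q) (R := R)
    (fun i j => j ∈ L i) (· ∈ X) (· ∈ a)
  have h1 : (fun i : Fin n => (bits fun j => j ∈ L i ∧ (i ∈ X → j ∈ a) : Val R))
      = fun i => mask (if i ∈ X then L i ∩ a else L i) := by
    ext1 i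
    apply bits_eq_mask
    intro j
    split_ifs with hi <;> simp [hi]
  rw [h1] at h
  refine h.mono (le_trans ?_ hB.le_cube)
  have : n * (40 * q + 150) ≤ n * (100 * n + 100 * q + 400) := Nat.mul_le_mul_left _ (by omega)
  omega

theorem run_dead (S : Finset (Fin n)) (L : Fin n → Finset (Fin q)) :
    Calls (prog HN t) fDead (ofList [(mask S : Val R), masks L])
      (ofProp (∃ v ∈ S, L v = ∅)) (N ^ 3) := by
  have h := calls_dead (A := masks HN) (T := ofNat t) (Z := ofNat q) (R := R)
    (· ∈ S) (fun i j => j ∈ L i)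
  have h1 : (∃ i ∈ S, ∀ j, j ∉ L i) ↔ ∃ v ∈ S, L v = ∅ := by
    simp [Finset.eq_empty_iff_forall_notMem]
  rw [h1] at h
  refine h.mono (le_trans ?_ hB.le_cube)
  have : n * (10 * q + 100) ≤ n * (100 * n + 100 * q + 400) := Nat.mul_le_mul_left _ (by omega)
  omega

theorem run_bad (S : Finset (Fin n)) (L : Fin n → Finset (Fin q)) (a : Finset (Fin q)) :
    Calls (prog HN t) fBad (ofList [(mask S : Val R), masks L, mask a])
      (ofNat (S.filter fun u => ¬ L u ⊆ a).card) (N ^ 3) := by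
  have h := calls_bad (A := masks HN) (T := ofNat t) (Z := ofNat q) (R := R)
    (· ∈ S) (fun i j => j ∈ L i) (· ∈ a)
  refine h.cast (by congr 2; ext i; simp [Finset.subset_iff]) (le_trans ?_ hB.le_cube)
  have : n * (60 * q + 200) ≤ n * (100 * n + 100 * q + 400) := Nat.mul_le_mul_left _ (by omega)
  omega

theorem run_pick (F : Finset (Fin n)) (M : Fin n → Finset (Fin n)) (X D : Finset (Fin n)) :
    ∃ Y, ((∃ v ∈ F, (M v ∩ X).Nonempty ∧ Y = M v ∩ X) ∨
      ((∀ v ∈ F, ¬ (M v ∩ X).Nonempty) ∧ Y = D)) ∧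
    Calls (prog HN t) fPick (ofList [(mask F : Val R), masks M, mask X, mask D])
        (mask Y) (N ^ 3) := by
  have hc : n * (100 * n + 200) + 30 ≤ N ^ 3 := by
    refine le_trans ?_ hB.le_cube
    have : n * (100 * n + 200) ≤ n * (100 * n + 100 * q + 400) := Nat.mul_le_mul_left _ (by omega)
    omega
  rcases calls_pick (A := masks HN) (T := ofNat t) (Z := ofNat q) (R := R)
    (· ∈ F) (fun i j => j ∈ M i) (· ∈ X) (mask D) with ⟨v, h1, ⟨i, h2⟩, h3⟩ | ⟨h1, h2⟩
  · refine ⟨M v ∩ X, .inl ⟨v, h1, ⟨i, by simpa using h2⟩, rfl⟩, ?_⟩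
    exact h3.cast (bits_eq_mask (by simp)) hc
  · refine ⟨D, .inr ⟨fun v hv hne => h1 v hv ?_, rfl⟩, h2.mono hc⟩
    obtain ⟨i, hi⟩ := hne
    exact ⟨i, by simpa using hi⟩

/-- The call returns the least subset `Y` of `S` that contains `X` and is closed under adjacency. -/
theorem run_reach (S X : Finset (Fin n)) (M : Fin n → Finset (Fin n)) (hX : X ⊆ S) :
    ∃ Y, X ⊆ Y ∧ Y ⊆ S ∧ (∀ a ∈ Y, ∀ s ∈ S, s ∈ M a → s ∈ Y) ∧
      (∀ B, X ⊆ B → (∀ b ∈ B, ∀ s ∈ S, s ∈ M b → s ∈ B) → Y ⊆ B) ∧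
    Calls (prog HN t) fReach (ofList [(mask S : Val R), mask X, masks M])
        (mask Y) (((S \ X).card + 1) * N ^ 4) := by
  induction hk : (S \ X).card using Nat.strong_induction_on generalizing X with
  | _ k ih =>
  subst hk
  have h0 : 1000 * N ^ 3 ≤ N ^ 4 := hB.pow_succ 3
  have h1 : 1000 * N ^ 2 ≤ N ^ 3 := hB.pow_succ 2
  have h2 := hB.le_sq
  -- one round adds the neighbours of `X` in `S`, and the recursion stops if there are no new ones
  by_cases h : ((S ∩ (X ∪ X.biUnion M)) \ X).Nonempty
  · have hX' : X ⊆ S ∩ (X ∪ X.biUnion M) := by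
      intro x hx; simp [hx, hX hx]
    have hlt : (S \ (S ∩ (X ∪ X.biUnion M))).card < (S \ X).card := by
      apply Finset.card_lt_card
      rw [Finset.ssubset_iff_of_subset (Finset.sdiff_subset_sdiff le_rfl hX')]
      obtain ⟨x, hx⟩ := h
      exact ⟨x, by simp at hx ⊢; tauto, by simp at hx ⊢; tauto⟩
    obtain ⟨Y, h3, h4, h5, h6, h7⟩ := ih _ hlt _ Finset.inter_subset_left rfl
    refine ⟨Y, hX'.trans h3, h4, h5, fun B hB1 hB2 => h6 B ?_ hB2, ?_⟩
    · intro x hx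
      simp only [Finset.mem_inter, Finset.mem_union, Finset.mem_biUnion] at hx
      obtain ⟨h8, h8' | ⟨y, hy, h9⟩⟩ := hx
      · exact hB1 h8'
      · exact hB2 y (hB1 hy) x h8 h9
    · refine .of_wp (body := reachBody) rfl ?_
      simp [reachBody]
      refine ⟨_, _, run_nbrs hB X X M, _, _, run_and S _ hB (.inl le_rfl), _, _,
        run_diff _ X hB (.inl le_rfl), _, _, run_any _ hB (.inl le_rfl), fun h8 => ?_, fun h8 => ?_⟩
      · refine ⟨_, _, h7, rfl, ?_⟩
        have := Nat.mul_le_mul_right (N ^ 4) (Nat.succ_le_of_lt hlt)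
        rw [Nat.succ_mul] at this ⊢
        rw [Nat.succ_mul]
        omega
      · rw [ofProp_eq_nil] at h8
        exact absurd h h8
  · refine ⟨X, le_rfl, hX, fun a ha s hs hsa => ?_, fun B hB1 _ => hB1, ?_⟩
    · by_contra hsX
      exact h ⟨s, by simp only [Finset.mem_sdiff, Finset.mem_inter, Finset.mem_union,
        Finset.mem_biUnion]; exact ⟨⟨hs, .inr ⟨a, ha, hsa⟩⟩, hsX⟩⟩
    · refine .of_wp (body := reachBody) rfl ?_
      simp [reachBody]
      refine ⟨_, _, run_nbrs hB X X M, _, _, run_and S _ hB (.inl le_rfl), _, _,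
        run_diff _ X hB (.inl le_rfl), _, _, run_any _ hB (.inl le_rfl), fun h8 => ?_, fun h8 => ?_⟩
      · rw [ofProp_eq_nil, not_not] at h8
        exact absurd h8 h
      · refine ⟨rfl, ?_⟩
        rw [Nat.succ_mul]
        have := Nat.zero_le ((S \ X).card * N ^ 4)
        omega

end graph

end HCol

/-! ### The choice of a pair and its effect on the lists -/

namespace HCol

open Lisp Lisp.Code Lisp.Val
open scoped Classical

variable {R : Type u} [CommSemiring R] {n q t N : ℕ} {HN : Fin q → Finset (Fin q)}

/-- The neighbours of `v` in `S` whose lists shrink when `v` receives the colour `h`. Here `HN` and `M`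
are the neighbourhoods in `H` and in `G`. -/
noncomputable def hit (HN : Fin q → Finset (Fin q)) (M : Fin n → Finset (Fin n))
    (S : Finset (Fin n)) (L : Fin n → Finset (Fin q)) (v : Fin n) (h : Fin q) : Finset (Fin n) :=
  (M v ∩ S).filter fun u => ¬ L u ⊆ HN h

/-- The pair `(v, h)` is good: either `h` is the only colour in the list of `v`, or the number `r` of
lists that shrink when `v` receives `h` satisfies `θ ≤ r * (r * t)`. -/
def Good (HN : Fin q → Finset (Fin q)) (t : ℕ) (M : Fin n → Finset (Fin n))
    (S : Finset (Fin n)) (L : Fin n → Finset (Fin q)) (θ : ℕ) (v : Fin n) (h : Fin q) : Prop :=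
  L v \ {h} = ∅ ∨ θ ≤ (hit HN M S L v h).card * ((hit HN M S L v h).card * t)

/-- The lists after `v` has received the colour `h`. -/
noncomputable def assignLists (HN : Fin q → Finset (Fin q)) (M : Fin n → Finset (Fin n))
    (L : Fin n → Finset (Fin q)) (v : Fin n) (h : Fin q) : Fin n → Finset (Fin q) :=
  fun u => if u ∈ M v then L u ∩ HN h else L u

/-- The lists after the removal of `h` from the list of `v`. -/
noncomputable def removeColour (L : Fin n → Finset (Fin q)) (v : Fin n) (h : Fin q) :
    Fin n → Finset (Fin q) :=
  fun u => if u = v then L u \ {h} else L u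

theorem size_masks_le (hB : Big n q t N) : (masks HN : Val Unit).size ≤ N ^ 3 := by
  have h := size_ofFamily_le (c := q * 4 + 1) (fun i => (mask (HN i) : Val Unit))
    fun i => size_bits_le _
  refine h.trans ?_
  have h1 : q * (q * 4 + 1 + 1) ≤ N * (N * 6) :=
    Nat.mul_le_mul hB.q_le (by have := hB.q_le; have := hB.thousand; omega)
  have h2 : N * (N * 6) = 6 * N ^ 2 := by ring
  have h3 : 1000 * N ^ 2 ≤ N ^ 3 := hB.pow_succ 2
  have h4 := hB.le_sq
  omega

omit [CommSemiring R] in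
theorem lift_masks {m n : ℕ} (L : Fin n → Finset (Fin m)) :
    (lift (masks L) : Val R) = masks L := by
  simp [masks, mask, lift_ofFamily, lift_bits]

section
variable (hB : Big n q t N)
include hB

theorem run_good (M : Fin n → Finset (Fin n))
    (S : Finset (Fin n)) (L : Fin n → Finset (Fin q)) {θ : ℕ} (hθ : θ ≤ N ^ 2) (v : Fin n)
    (h : Fin q) :
    Calls (prog HN t) fGood (ofList [(mask {h} : Val R),
      ofList [mask {v}, mask S, masks L, masks M, ofNat θ]])
      (ofProp (Good HN t M S L θ v h)) (N ^ 5) := by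
  refine .of_wp (body := goodBody (masks HN) (ofNat t)) rfl ?_
  simp [goodBody, lift_masks, lift_ofNat]
  have h2 := hB.le_sq
  have h3 : 1000 * N ^ 2 ≤ N ^ 3 := hB.pow_succ 2
  have h4 : 1000 * N ^ 3 ≤ N ^ 4 := hB.pow_succ 3
  have h5 : 1000 * N ^ 4 ≤ N ^ 5 := hB.pow_succ 4
  refine ⟨_, _, run_row hB (.inl le_rfl) v (fun i => mask (L i)), _, _,
    run_diff _ _ hB (.inr le_rfl), _, _, run_any _ hB (.inr le_rfl), fun h6 => ?_, fun h6 => ?_⟩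
  · rw [ofProp_eq_nil, not_not] at h6
    have h7 : (hit HN M S L v h).card ≤ N :=
      (Finset.card_le_univ _).trans (by simpa using hB.n_le)
    refine ⟨_, _, run_row hB (.inl le_rfl) v (fun i => mask (M i)), _, _,
      run_and _ _ hB (.inl le_rfl), _, _, run_row hB (.inr le_rfl) h (fun i => mask (HN i)), _, _,
      run_bad hB _ _ _, _, _, calls_mul _ _, _, _, calls_mul _ _, _, _, calls_ge _ _, ?_, ?_⟩
    · congr 1
      rw [Good, or_iff_right (Finset.nonempty_iff_ne_empty.1 h6), hit]
    · have h8 := size_masks_le (HN := HN) hB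
      have h9 : (ofNat t : Val Unit).size ≤ N ^ 2 := by rw [size_ofNat]; omega
      have h10 := hB.t_le
      have h0 := hB.thousand
      have e1 : (hit HN M S L v h).card * (20 * t + 50) ≤ N * (21 * N) :=
        Nat.mul_le_mul h7 (by omega)
      have e2 : (hit HN M S L v h).card * t ≤ N * N := Nat.mul_le_mul h7 h10
      have e3 : (hit HN M S L v h).card * (20 * ((hit HN M S L v h).card * t) + 50)
          ≤ N * (20 * (N * N) + 50) := Nat.mul_le_mul h7 (by omega)
      have e4 : N * (20 * (N * N) + 50) = 20 * N ^ 3 + 50 * N := by ring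
      have e5 : N * (21 * N) = 21 * N ^ 2 := by ring
      have e6 : 1000 * N ^ 1 ≤ N ^ 2 := hB.pow_succ 1
      rw [pow_one] at e6
      simp only [hit] at *
      omega
  · rw [ofProp_eq_nil] at h6
    refine ⟨?_, by omega⟩
    rw [ofProp_true]
    exact .inl (Finset.not_nonempty_iff_eq_empty.1 h6)

omit [CommSemiring R] hB in
theorem mask_ne_nil {m : ℕ} (h : Fin m) (S : Finset (Fin m)) : (mask S : Val R) ≠ .nil := by
  cases m with
  | zero => exact h.elim0
  | succ m => simp [mask, bits_succ]

theorem run_findColour (X : Finset (Fin q)) (M : Fin n → Finset (Fin n))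
    (S : Finset (Fin n)) (L : Fin n → Finset (Fin q)) {θ : ℕ} (hθ : θ ≤ N ^ 2) (v : Fin n) :
    ∃ y : Val R, ((∃ h ∈ X, Good HN t M S L θ v h ∧ y = mask {h}) ∨
      ((∀ h ∈ X, ¬ Good HN t M S L θ v h) ∧ y = .nil)) ∧
    Calls (prog HN t) fFindColour (ofList [mask X,
      ofList [mask {v}, mask S, masks L, masks M, ofNat θ]]) y ((X.card + 1) * N ^ 6) := by
  have h2 := hB.le_sq
  have h3 : 1000 * N ^ 2 ≤ N ^ 3 := hB.pow_succ 2
  have h4 : 1000 * N ^ 3 ≤ N ^ 4 := hB.pow_succ 3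
  have h5 : 1000 * N ^ 4 ≤ N ^ 5 := hB.pow_succ 4
  have h6 : 1000 * N ^ 5 ≤ N ^ 6 := hB.pow_succ 5
  induction hk : X.card using Nat.strong_induction_on generalizing X with
  | _ k ih =>
  subst hk
  rw [Nat.succ_mul]
  have h0 := Nat.zero_le (X.card * N ^ 6)
  rcases X.eq_empty_or_nonempty with rfl | hX
  · refine ⟨.nil, .inr ⟨by simp, rfl⟩, .of_wp (body := findColourBody) rfl ?_⟩
    simp [findColourBody]
    refine ⟨_, _, run_any _ hB (.inr le_rfl), fun h7 => ?_, fun h7 => ⟨rfl, by omega⟩⟩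
    simp at h7
  · obtain ⟨h, hh, hf⟩ := run_first (R := R) (HN := HN) X hB (.inr le_rfl) hX
    have hlt : (X \ {h}).card < X.card :=
      Finset.card_lt_card (by
        rw [Finset.ssubset_iff_of_subset Finset.sdiff_subset]
        exact ⟨h, hh, by simp⟩)
    have hmul : ((X \ {h}).card + 1) * N ^ 6 ≤ X.card * N ^ 6 := Nat.mul_le_mul_right _ hlt
    obtain ⟨y, h7, h8⟩ := ih _ hlt _ rfl
    by_cases hg : Good HN t M S L θ v h
    · refine ⟨_, .inl ⟨h, hh, hg, rfl⟩, .of_wp (body := findColourBody) rfl ?_⟩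
      simp [findColourBody]
      refine ⟨_, _, run_any _ hB (.inr le_rfl), fun h9 => ?_, fun h9 => ?_⟩
      · refine ⟨_, _, hf, _, _, run_good hB M S L hθ v h, fun h10 => ⟨rfl, by omega⟩, fun h10 => ?_⟩
        rw [ofProp_eq_nil] at h10
        exact absurd hg h10
      · rw [ofProp_eq_nil] at h9
        exact absurd hX h9
    · refine ⟨y, ?_, .of_wp (body := findColourBody) rfl ?_⟩
      · rcases h7 with ⟨g, h8, h9, h10⟩ | ⟨h8, h9⟩
        · exact .inl ⟨g, (Finset.mem_sdiff.1 h8).1, h9, h10⟩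
        · refine .inr ⟨fun g hg' => ?_, h9⟩
          by_cases hgh : g = h
          · rwa [hgh]
          · exact h8 g (by simp [hg', hgh])
      simp [findColourBody]
      refine ⟨_, _, run_any _ hB (.inr le_rfl), fun h9 => ?_, fun h9 => ?_⟩
      · refine ⟨_, _, hf, _, _, run_good hB M S L hθ v h, fun h10 => ?_, fun h10 => ?_⟩
        · rw [ofProp_eq_nil, not_not] at h10
          exact absurd h10 hg
        · exact ⟨_, _, run_diff _ _ hB (.inr le_rfl), _, _, h8, rfl, by omega⟩
      · rw [ofProp_eq_nil] at h9
        exact absurd hX h9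

theorem run_findPair (X : Finset (Fin n)) (M : Fin n → Finset (Fin n))
    (S : Finset (Fin n)) (L : Fin n → Finset (Fin q)) {θ : ℕ} (hθ : θ ≤ N ^ 2) :
    ∃ y : Val R, ((∃ v ∈ X, ∃ h ∈ L v, Good HN t M S L θ v h ∧ y = .cons (mask {v}) (mask {h})) ∨
      ((∀ v ∈ X, ∀ h ∈ L v, ¬ Good HN t M S L θ v h) ∧ y = .nil)) ∧
    Calls (prog HN t) fFindPair (ofList [mask X,
      ofList [mask S, masks L, masks M, ofNat θ]]) y ((X.card + 1) * N ^ 9) := by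
  have h2 := hB.le_sq
  have h3 : 1000 * N ^ 2 ≤ N ^ 3 := hB.pow_succ 2
  have h8 : 1000 * N ^ 8 ≤ N ^ 9 := hB.pow_succ 8
  have h38 : N ^ 3 ≤ N ^ 8 := Nat.pow_le_pow_right (by have := hB.thousand; omega) (by omega)
  have hcol : ∀ v, ((L v).card + 1) * N ^ 6 ≤ N ^ 8 := by
    intro v
    have : (L v).card ≤ q := by simpa using Finset.card_le_univ (L v)
    calc ((L v).card + 1) * N ^ 6 ≤ N ^ 2 * N ^ 6 := Nat.mul_le_mul_right _ (by omega)
      _ = N ^ 8 := by ring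
  induction hk : X.card using Nat.strong_induction_on generalizing X with
  | _ k ih =>
  subst hk
  rw [Nat.succ_mul]
  have h0 := Nat.zero_le (X.card * N ^ 9)
  rcases X.eq_empty_or_nonempty with rfl | hX
  · refine ⟨.nil, .inr ⟨by simp, rfl⟩, .of_wp (body := findPairBody) rfl ?_⟩
    simp [findPairBody]
    refine ⟨_, _, run_any _ hB (.inl le_rfl), fun h7 => ?_, fun h7 => ⟨rfl, by omega⟩⟩
    simp at h7
  · obtain ⟨v, hv, hf⟩ := run_first (R := R) (HN := HN) X hB (.inl le_rfl) hX
    have hlt : (X \ {v}).card < X.card :=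
      Finset.card_lt_card (by
        rw [Finset.ssubset_iff_of_subset Finset.sdiff_subset]
        exact ⟨v, hv, by simp⟩)
    have hmul : ((X \ {v}).card + 1) * N ^ 9 ≤ X.card * N ^ 9 := Nat.mul_le_mul_right _ hlt
    obtain ⟨y, h7, hy⟩ := ih _ hlt _ rfl
    obtain ⟨z, hz, hc⟩ := run_findColour (R := R) (HN := HN) hB (L v) M S L hθ v
    have hcv := hcol v
    rcases hz with ⟨h, hh, hg, rfl⟩ | ⟨hg, rfl⟩
    · refine ⟨_, .inl ⟨v, hv, h, hh, hg, rfl⟩, .of_wp (body := findPairBody) rfl ?_⟩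
      simp [findPairBody]
      refine ⟨_, _, run_any _ hB (.inl le_rfl), fun h9 => ?_, fun h9 => ?_⟩
      · refine ⟨_, _, hf, _, _, run_row hB (.inl le_rfl) v (fun i => mask (L i)), _, _, hc,
          fun h10 => ⟨rfl, by omega⟩, fun h10 => absurd h10 (mask_ne_nil h _)⟩
      · rw [ofProp_eq_nil] at h9
        exact absurd hX h9
    · refine ⟨y, ?_, .of_wp (body := findPairBody) rfl ?_⟩
      · rcases h7 with ⟨w, h8, h9⟩ | ⟨h8, h9⟩
        · exact .inl ⟨w, (Finset.mem_sdiff.1 h8).1, h9⟩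
        · refine .inr ⟨fun w hw => ?_, h9⟩
          by_cases hwv : w = v
          · rwa [hwv]
          · exact h8 w (by simp [hw, hwv])
      simp [findPairBody]
      refine ⟨_, _, run_any _ hB (.inl le_rfl), fun h9 => ?_, fun h9 => ?_⟩
      · refine ⟨_, _, hf, _, _, run_row hB (.inl le_rfl) v (fun i => mask (L i)), _, _, hc,
          fun h10 => absurd rfl h10, fun h10 => ?_⟩
        exact ⟨_, _, run_diff _ _ hB (.inl le_rfl), _, _, hy, rfl, by omega⟩
      · rw [ofProp_eq_nil] at h9
        exact absurd hX h9

theorem run_assignLists (M : Fin n → Finset (Fin n)) (L : Fin n → Finset (Fin q)) (v : Fin n)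
    (h : Fin q) :
    Calls (prog HN t) fAssignLists (ofList [(mask {v} : Val R), mask {h}, masks L, masks M])
      (masks (assignLists HN M L v h)) (N ^ 4) := by
  have h2 := hB.le_sq
  have h3 : 1000 * N ^ 2 ≤ N ^ 3 := hB.pow_succ 2
  have h4 : 1000 * N ^ 3 ≤ N ^ 4 := hB.pow_succ 3
  refine .of_wp (body := assignListsBody (masks HN)) rfl ?_
  simp [assignListsBody, lift_masks]
  have h8 := size_masks_le (HN := HN) hB
  exact ⟨_, _, run_row hB (.inl le_rfl) v (fun i => mask (M i)), _, _,
    run_row hB (.inr le_rfl) h (fun i => mask (HN i)), _, _, run_upd hB _ _ _, rfl, by omega⟩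

theorem run_remove (L : Fin n → Finset (Fin q)) (v : Fin n) (h : Fin q) :
    Calls (prog HN t) fRemove (ofList [(mask {v} : Val R), mask {h}, masks L])
      (masks (removeColour L v h)) (N ^ 4) := by
  have h2 := hB.le_sq
  have h3 : 1000 * N ^ 2 ≤ N ^ 3 := hB.pow_succ 2
  have h4 : 1000 * N ^ 3 ≤ N ^ 4 := hB.pow_succ 3
  refine .of_wp (body := removeBody) rfl ?_
  simp [removeBody]
  refine ⟨_, _, run_row hB (.inl le_rfl) v (fun i => mask (L i)), _, _,
    run_diff _ _ hB (.inr le_rfl), _, _, run_upd hB _ _ _, ?_, by omega⟩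
  congr 1
  funext u
  unfold removeColour
  by_cases hu : u = v
  · subst hu; simp
  · simp [hu]

variable {α β : Type*} {H : Graph α β} (e : Fin q ≃ V(H))

theorem run_assignTable {B : ℕ} (hBn : B ≤ n) {l : List ((V(H) →₀ ℕ) × R)} (hl : IsTable B l)
    (w : Fin n → Fin q → R) (v : Fin n) (h : Fin q) :
    Calls (prog HN t) fAssignTable (ofList [(mask {v} : Val R), mask {h}, encodeTable e l,
      ofFamily fun u => ofFamily fun i => .atom (w u i)])
      (encodeTable e (scale (e h) (w v h) l)) (N ^ 4) := by
  have h1 : 1000 * N ^ 1 ≤ N ^ 2 := hB.pow_succ 1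
  have h2 := hB.le_sq
  have h3 : 1000 * N ^ 2 ≤ N ^ 3 := hB.pow_succ 2
  have h4 : 1000 * N ^ 3 ≤ N ^ 4 := hB.pow_succ 3
  refine .of_wp (body := assignTableBody) rfl ?_
  simp [assignTableBody]
  have hlen : l.length ≤ N :=
    (hl.length_le e).trans ((Nat.pow_le_pow_left (by omega) _).trans hB.table_le)
  have h8 := calls_scale (A := masks HN) (T := ofNat t) (Z := ofNat q) e l h (w v h)
  rw [show (bits fun i => i = h : Val R) = mask {h} from bits_eq_mask (by simp)] at h8
  have h9 : l.length * (50 * q + 100) ≤ N * (51 * N) :=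
    Nat.mul_le_mul hlen (by have := hB.q_le; have := hB.thousand; omega)
  have h10 : N * (51 * N) = 51 * N ^ 2 := by ring
  exact ⟨_, _, run_row hB (.inl le_rfl) v (fun u => ofFamily fun i => .atom (w u i)), _, _,
    run_row hB (.inr le_rfl) h (fun i => .atom (w v i)), _, _, h8, rfl, by omega⟩

theorem run_addTable {B : ℕ} (hBn : B ≤ n) {a b : List ((V(H) →₀ ℕ) × R)} (ha : IsTable B a)
    (hb : IsTable B b) :
    Calls (prog HN t) fAddTable (ofList [encodeTable e a, encodeTable e b])
      (encodeTable e (addTable a b)) (N ^ 5) := by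
  have h1 : 1000 * N ^ 1 ≤ N ^ 2 := hB.pow_succ 1
  have h2 := hB.le_sq
  have h3 : 1000 * N ^ 2 ≤ N ^ 3 := hB.pow_succ 2
  have h4 : 1000 * N ^ 3 ≤ N ^ 4 := hB.pow_succ 3
  have h5 : 1000 * N ^ 4 ≤ N ^ 5 := hB.pow_succ 4
  refine (calls_addTable e a b ha.le hb).mono ?_
  have hlen : a.length ≤ N :=
    (ha.length_le e).trans ((Nat.pow_le_pow_left (by omega) _).trans hB.table_le)
  have hB1 : (B + 1) ^ q ≤ N := (Nat.pow_le_pow_left (by omega) _).trans hB.table_le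
  have h0 := hB.thousand
  have e1 : q * (60 * B + 80) ≤ N * (61 * N) :=
    Nat.mul_le_mul hB.q_le (by have := hB.n_le; omega)
  have e2 : (B + 1) ^ q * (q * (60 * B + 80) + 100) ≤ N * (N * (61 * N) + 100) :=
    Nat.mul_le_mul hB1 (by omega)
  have e3 : a.length * ((B + 1) ^ q * (q * (60 * B + 80) + 100) + 150)
      ≤ N * (N * (N * (61 * N) + 100) + 150) := Nat.mul_le_mul hlen (by omega)
  have e4 : N * (N * (N * (61 * N) + 100) + 150) = 61 * N ^ 4 + 100 * N ^ 2 + 150 * N ^ 1 := by ring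
  rw [e4] at e3
  linarith

end

end HCol

/-! ### The partition function of an induced subgraph -/

namespace HCol

open Lisp Lisp.Code Lisp.Val
open scoped Classical

section partition

variable {n q : ℕ} (HN : Fin q → Finset (Fin q)) (M : Fin n → Finset (Fin n))
  {P : Type*} [CommSemiring P] (x : Fin n → Fin q → P)

/-- The list colourings of the subgraph induced on `S`, extended by `none` outside `S`; `HN` and `M`
are the neighbourhoods in `H` and in `G`. -/
noncomputable def colourings (S : Finset (Fin n)) (L : Fin n → Finset (Fin q)) :
    Finset (Fin n → Option (Fin q)) :=
  Finset.univ.filter fun f => (∀ u, u ∉ S → f u = none) ∧ (∀ u ∈ S, ∃ h ∈ L u, f u = some h) ∧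
    ∀ u ∈ S, ∀ v ∈ S, v ∈ M u → ∀ a b, f u = some a → f v = some b → b ∈ HN a

/-- The partition function of the subgraph induced on `S`, with the factor `x u h` for a vertex `u` of
colour `h`. -/
noncomputable def partition (S : Finset (Fin n)) (L : Fin n → Finset (Fin q)) : P :=
  ∑ f ∈ colourings HN M S L, ∏ u ∈ S, (f u).elim 1 (x u)

variable {HN M x} {S : Finset (Fin n)} {L : Fin n → Finset (Fin q)}

theorem mem_colourings {f : Fin n → Option (Fin q)} : f ∈ colourings HN M S L ↔
    (∀ u, u ∉ S → f u = none) ∧ (∀ u ∈ S, ∃ h ∈ L u, f u = some h) ∧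
    ∀ u ∈ S, ∀ v ∈ S, v ∈ M u → ∀ a b, f u = some a → f v = some b → b ∈ HN a := by
  simp [colourings]

theorem partition_empty : partition HN M x ∅ L = 1 := by
  have : colourings HN M ∅ L = {fun _ => none} := by
    ext f
    simp [mem_colourings, funext_iff]
  simp [partition, this]

theorem partition_eq_zero {v : Fin n} (hv : v ∈ S) (hL : L v = ∅) : partition HN M x S L = 0 := by
  have : colourings HN M S L = ∅ := by
    rw [Finset.eq_empty_iff_forall_notMem]
    intro f hf
    obtain ⟨h, hh, -⟩ := (mem_colourings.1 hf).2.1 v hv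
    simp [hL] at hh
  simp [partition, this]

/-- Either `v` has the colour `h` or it has not. -/
theorem partition_branch (hM : ∀ u v, u ∈ M v ↔ v ∈ M u) (hM' : ∀ v, v ∉ M v)
    (hH : ∀ a b, a ∈ HN b ↔ b ∈ HN a) {v : Fin n} (hv : v ∈ S) {h : Fin q} (hh : h ∈ L v) :
    partition HN M x S L = x v h * partition HN M x (S \ {v}) (assignLists HN M L v h)
      + partition HN M x S (removeColour L v h) := by
  unfold partition
  rw [← Finset.sum_filter_add_sum_filter_not _ fun f => f v = some h]
  congr 1
  -- the colourings with `f v = h` correspond to those of `S \ {v}` with the updated lists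
  · rw [Finset.mul_sum]
    refine Finset.sum_nbij' (fun f => Function.update f v none)
      (fun f => Function.update f v (some h)) ?_ ?_ ?_ ?_ ?_
    · intro f hf
      obtain ⟨hf, hfv⟩ := Finset.mem_filter.1 hf
      obtain ⟨h1, h2, h3⟩ := mem_colourings.1 hf
      refine mem_colourings.2 ⟨fun u hu => ?_, fun u hu => ?_, fun u hu w hw huw a b ha hb => ?_⟩
      · by_cases huv : u = v
        · simp [huv]
        · rw [Function.update_of_ne huv]
          exact h1 u (by simpa [huv] using hu)
      · simp only [Finset.mem_sdiff, Finset.mem_singleton] at hu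
        rw [Function.update_of_ne hu.2]
        obtain ⟨a, ha, hfa⟩ := h2 u hu.1
        refine ⟨a, ?_, hfa⟩
        unfold assignLists
        split_ifs with huv
        · exact Finset.mem_inter.2 ⟨ha, h3 v hv u hu.1 huv h a hfv hfa⟩
        · exact ha
      · simp only [Finset.mem_sdiff, Finset.mem_singleton] at hu hw
        rw [Function.update_of_ne hu.2] at ha
        rw [Function.update_of_ne hw.2] at hb
        exact h3 u hu.1 w hw.1 huw a b ha hb
    · intro f hf
      obtain ⟨h1, h2, h3⟩ := mem_colourings.1 hf
      refine Finset.mem_filter.2 ⟨mem_colourings.2 ⟨fun u hu => ?_, fun u hu => ?_,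
        fun u hu w hw huw a b ha hb => ?_⟩, by simp⟩
      · rw [Function.update_of_ne (by rintro rfl; exact hu hv)]
        exact h1 u (by simp [hu])
      · by_cases huv : u = v
        · subst huv
          exact ⟨h, hh, by simp⟩
        · rw [Function.update_of_ne huv]
          obtain ⟨a, ha, hfa⟩ := h2 u (by simp [hu, huv])
          refine ⟨a, ?_, hfa⟩
          unfold assignLists at ha
          split_ifs at ha
          · exact (Finset.mem_inter.1 ha).1
          · exact ha
      · have key : ∀ w ∈ S, w ≠ v → w ∈ M v → ∀ b, f w = some b → b ∈ HN h := by
          intro w hw hwv hwM b hb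
          obtain ⟨a, ha, hfa⟩ := h2 w (by simp [hw, hwv])
          rw [hb, Option.some.injEq] at hfa
          subst hfa
          unfold assignLists at ha
          rw [if_pos hwM] at ha
          exact (Finset.mem_inter.1 ha).2
        by_cases huv : u = v <;> by_cases hwv : w = v
        · -- there are no loops in `G`
          subst huv hwv
          exact absurd huw (hM' _)
        · subst huv
          rw [Function.update_self, Option.some.injEq] at ha
          rw [Function.update_of_ne hwv] at hb
          rw [← ha]
          exact key w hw hwv huw b hb
        · subst hwv
          rw [Function.update_self, Option.some.injEq] at hb
          rw [Function.update_of_ne huv] at ha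
          rw [← hb, hH]
          exact key u hu huv ((hM _ _).1 huw) a ha
        · rw [Function.update_of_ne huv] at ha
          rw [Function.update_of_ne hwv] at hb
          exact h3 u (by simp [hu, huv]) w (by simp [hw, hwv]) huw a b ha hb
    · intro f hf
      obtain ⟨hf, hfv⟩ := Finset.mem_filter.1 hf
      simp [← hfv]
    · intro f hf
      have := (mem_colourings.1 hf).1 v (by simp)
      simp [← this]
    · intro f hf
      obtain ⟨hf, hfv⟩ := Finset.mem_filter.1 hf
      rw [← Finset.mul_prod_erase S _ hv, hfv, Finset.sdiff_singleton_eq_erase]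
      congr 1
      refine Finset.prod_congr rfl fun u hu => ?_
      rw [Function.update_of_ne (Finset.ne_of_mem_erase hu)]
  · refine Finset.sum_congr ?_ fun _ _ => rfl
    ext f
    simp only [Finset.mem_filter, mem_colourings]
    constructor
    · rintro ⟨⟨h1, h2, h3⟩, h4⟩
      refine ⟨h1, fun u hu => ?_, h3⟩
      obtain ⟨a, ha, hfa⟩ := h2 u hu
      refine ⟨a, ?_, hfa⟩
      unfold removeColour
      split_ifs with huv
      · subst huv
        simp only [Finset.mem_sdiff, Finset.mem_singleton]
        refine ⟨ha, ?_⟩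
        rintro rfl
        exact h4 hfa
      · exact ha
    · rintro ⟨h1, h2, h3⟩
      refine ⟨⟨h1, fun u hu => ?_, h3⟩, fun h4 => ?_⟩
      · obtain ⟨a, ha, hfa⟩ := h2 u hu
        refine ⟨a, ?_, hfa⟩
        unfold removeColour at ha
        split_ifs at ha
        · exact (Finset.mem_sdiff.1 ha).1
        · exact ha
      · obtain ⟨a, ha, hfa⟩ := h2 v hv
        rw [h4, Option.some.injEq] at hfa
        simp [removeColour, hfa] at ha

/-- A union `X` of connected components of `S` can be coloured independently of the rest. -/
theorem partition_split (hM : ∀ u v, u ∈ M v ↔ v ∈ M u) {X : Finset (Fin n)} (hX : X ⊆ S)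
    (hX' : ∀ a ∈ X, ∀ s ∈ S, s ∈ M a → s ∈ X) :
    partition HN M x S L = partition HN M x X L * partition HN M x (S \ X) L := by
  unfold partition
  rw [Finset.sum_mul_sum, ← Finset.sum_product']
  refine Finset.sum_nbij' (fun f => (fun u => if u ∈ X then f u else none,
    fun u => if u ∈ X then none else f u)) (fun f u => if u ∈ X then f.1 u else f.2 u)
    ?_ ?_ ?_ ?_ ?_
  · intro f hf
    obtain ⟨h1, h2, h3⟩ := mem_colourings.1 hf
    refine Finset.mem_product.2 ⟨mem_colourings.2 ⟨fun u hu => by simp [hu], fun u hu => ?_,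
      fun u hu w hw huw a b ha hb => ?_⟩, mem_colourings.2 ⟨fun u hu => ?_, fun u hu => ?_,
      fun u hu w hw huw a b ha hb => ?_⟩⟩
    · simpa [hu] using h2 u (hX hu)
    · simp only [hu, hw, if_true] at ha hb
      exact h3 u (hX hu) w (hX hw) huw a b ha hb
    · simp only [Finset.mem_sdiff, not_and, not_not] at hu
      by_cases huX : u ∈ X
      · simp [huX]
      · simp [huX, h1 u fun h => huX (hu h)]
    · simp only [Finset.mem_sdiff] at hu
      simpa [hu.2] using h2 u hu.1
    · simp only [Finset.mem_sdiff] at hu hw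
      simp only [hu.2, hw.2, if_false] at ha hb
      exact h3 u hu.1 w hw.1 huw a b ha hb
  · rintro ⟨f, g⟩ hf
    obtain ⟨hf, hg⟩ := Finset.mem_product.1 hf
    obtain ⟨h1, h2, h3⟩ := mem_colourings.1 hf
    obtain ⟨h1', h2', h3'⟩ := mem_colourings.1 hg
    refine mem_colourings.2 ⟨fun u hu => ?_, fun u hu => ?_,
      fun u hu w hw huw a b ha hb => ?_⟩
    · have huX : u ∉ X := fun h => hu (hX h)
      simpa [huX] using h1' u (by simp [hu])
    · by_cases huX : u ∈ X
      · simpa [huX] using h2 u huX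
      · simpa [huX] using h2' u (by simp [hu, huX])
    · by_cases huX : u ∈ X
      · have hwX := hX' u huX w hw huw
        simp only [huX, hwX, if_true] at ha hb
        exact h3 u huX w hwX huw a b ha hb
      · have hwX : w ∉ X := fun h => huX (hX' w h u hu ((hM _ _).1 huw))
        simp only [huX, hwX, if_false] at ha hb
        exact h3' u (by simp [hu, huX]) w (by simp [hw, hwX]) huw a b ha hb
  · intro f hf
    funext u
    by_cases huX : u ∈ X <;> simp [huX]
  · rintro ⟨f, g⟩ hf
    obtain ⟨hf, hg⟩ := Finset.mem_product.1 hf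
    have h1 := (mem_colourings.1 hf).1
    have h2 := (mem_colourings.1 hg).1
    ext1 <;> funext u <;> by_cases huX : u ∈ X
    · simp [huX]
    · simpa [huX] using (h1 u huX).symm
    · simpa [huX] using (h2 u (by simp [huX])).symm
    · simp [huX]
  · intro f hf
    rw [← Finset.prod_sdiff hX, mul_comm]
    congr 1
    · exact Finset.prod_congr rfl fun u hu => by simp [hu]
    · exact Finset.prod_congr rfl fun u hu => by simp [(Finset.mem_sdiff.1 hu).2]

end partition

/-- The partition function of `(G, L)` is that of the subgraph induced on all the vertices. -/
theorem partitionFunction_eq {α β : Type*} {R : Type u} [CommSemiring R] {H : Graph α β}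
    [Finite V(H)] {q n : ℕ} (e : Fin q ≃ V(H)) (G : SimpleGraph (Fin n))
    (L : Fin n → Set V(H)) (w : Fin n → V(H) → R) :
    partitionFunction H G L w =
      partition (fun i => Finset.univ.filter fun j => H.Adj (e i) (e j))
        (fun u => Finset.univ.filter fun v => G.Adj u v)
        (fun u i => MvPolynomial.C (w u (e i)) * MvPolynomial.X (e i)) Finset.univ
        (fun u => Finset.univ.filter fun i => e i ∈ L u) := by
  unfold partitionFunction partition
  refine Finset.sum_bij (fun f _ u => some (e.symm (f u))) ?_ ?_ ?_ ?_
  · intro f hf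
    obtain ⟨h1, h2⟩ := (Set.Finite.mem_toFinset _).1 hf
    rw [mem_colourings]
    refine ⟨by simp, fun u _ => ⟨_, ?_, rfl⟩, fun u _ v _ huv a b ha hb => ?_⟩
    · simpa using h2 u
    · rw [Option.some.injEq] at ha hb
      subst ha hb
      simpa using h1 u v (by simpa using huv)
  · intro f _ g _ hfg
    funext u
    simpa using congrFun hfg u
  · intro f hf
    obtain ⟨-, h1, h2⟩ := mem_colourings.1 hf
    choose g hg hfg using fun u => h1 u (Finset.mem_univ u)
    refine ⟨fun u => e (g u), (Set.Finite.mem_toFinset _).2 ⟨fun u v huv => ?_, fun u => ?_⟩, ?_⟩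
    · simpa using h2 u (Finset.mem_univ _) v (Finset.mem_univ _) (by simpa using huv) _ _
        (hfg u) (hfg v)
    · simpa using hg u
    · funext u; simp [hfg]
  · intro f _
    simp

end HCol

/-! ### Single steps of the second phase -/

namespace HCol

open Lisp Lisp.Code Lisp.Val
open scoped Classical

section runs

variable {R : Type u} [CommSemiring R] {n q t N : ℕ} {HN : Fin q → Finset (Fin q)}
  {α β : Type*} {H : Graph α β} (e : Fin q ≃ V(H)) (M : Fin n → Finset (Fin n))
  (w : Fin n → Fin q → R)

/-- The matrix of the weights. -/
def weights : Val R := ofFamily fun u => ofFamily fun i => .atom (w u i)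

/-- The arguments of `fSolve`. -/
noncomputable def solveArgs (S Q F : Finset (Fin n)) (L : Fin n → Finset (Fin q))
    (l : List ((V(H) →₀ ℕ) × R)) : Val R :=
  ofList [mask S, mask Q, mask F, masks L, encodeTable e l, masks M, weights w]

variable {e M w} {S Q F : Finset (Fin n)} {L : Fin n → Finset (Fin q)}
  {l : List ((V(H) →₀ ℕ) × R)} (hB : Big n q t N)
include hB

/-- The inequalities with which sums of costs are absorbed into one power of `N`. -/
theorem Big.chain : 1000 * N ^ 2 ≤ N ^ 3 ∧ 1000 * N ^ 3 ≤ N ^ 4 ∧ 1000 * N ^ 4 ≤ N ^ 5 ∧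
    1000 * N ^ 5 ≤ N ^ 6 ∧ 1000 * N ^ 6 ≤ N ^ 7 :=
  ⟨hB.pow_succ 2, hB.pow_succ 3, hB.pow_succ 4, hB.pow_succ 5, hB.pow_succ 6⟩

set_option maxRecDepth 4000 in
theorem run_solve_done : Calls (prog HN t) fSolve (solveArgs e M w ∅ ∅ F L l) (encodeTable e l)
    (N ^ 7) := by
  have h2 := hB.le_sq
  have h3 := hB.chain
  refine .of_wp (body := solveBody) rfl ?_
  simp [solveBody, solveArgs]
  refine ⟨_, _, run_any _ hB (.inl le_rfl), fun h => ?_, fun _ => ⟨_, _,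
    run_any _ hB (.inl le_rfl), fun h => ?_, fun _ => ⟨rfl, by omega⟩⟩⟩ <;>
  simp at h

set_option maxRecDepth 4000 in
/-- A step with nonempty `Q` branches on a colour `h` of a vertex `v ∈ Q`. -/
theorem run_solve_branch {B : ℕ} (hBn : B ≤ n) (hl : IsTable B l) (hQ : Q.Nonempty) :
    ∃ v ∈ Q, (L v = ∅ → Calls (prog HN t) fSolve (solveArgs e M w S Q F L l)
        (encodeTable e []) (N ^ 7)) ∧
      ((L v).Nonempty → ∃ h ∈ L v, ∀ l₁ l₂ K₁ K₂ B', B' ≤ n → IsTable B' l₁ → IsTable B' l₂ →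
        Calls (prog HN t) fSolve (solveArgs e M w (S \ {v}) (Q \ {v}) (F ∪ {v})
          (assignLists HN M L v h) (scale (e h) (w v h) l)) (encodeTable e l₁) K₁ →
        Calls (prog HN t) fSolve (solveArgs e M w S Q F (removeColour L v h) l)
          (encodeTable e l₂) K₂ →
        Calls (prog HN t) fSolve (solveArgs e M w S Q F L l)
          (encodeTable e (addTable l₁ l₂)) (N ^ 7 + K₁ + K₂)) := by
  have h2 := hB.le_sq
  have h3 := hB.chain
  obtain ⟨v, hv, hf⟩ := run_first (R := R) (HN := HN) Q hB (.inl le_rfl) hQ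
  have hrow := run_row (R := R) (HN := HN) hB (.inl le_rfl) v (fun i => mask (L i))
  refine ⟨v, hv, fun hL => ?_, fun hL => ?_⟩
  · refine .of_wp (body := solveBody) rfl ?_
    simp [solveBody, solveArgs]
    refine ⟨_, _, run_any _ hB (.inl le_rfl), fun h => ?_, fun h => ?_⟩
    · refine ⟨_, _, hf, _, _, hrow, _, _, run_any _ hB (.inr le_rfl), fun h4 => ?_,
        fun h4 => ⟨rfl, by omega⟩⟩
      rw [hL] at h4
      simp at h4
    · rw [ofProp_eq_nil] at h
      exact absurd hQ h
  · obtain ⟨h, hh, hg⟩ := run_first (R := R) (HN := HN) (L v) hB (.inr le_rfl) hL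
    refine ⟨h, hh, fun l₁ l₂ K₁ K₂ B' hB' h₁ h₂ hK₁ hK₂ => ?_⟩
    refine .of_wp (body := solveBody) rfl ?_
    simp [solveBody, solveArgs]
    refine ⟨_, _, run_any _ hB (.inl le_rfl), fun h4 => ?_, fun h4 => ?_⟩
    · refine ⟨_, _, hf, _, _, hrow, _, _, run_any _ hB (.inr le_rfl), fun h5 => ?_,
        fun h5 => ?_⟩
      · exact ⟨_, _, hg, _, _, run_diff _ _ hB (.inl le_rfl), _, _,
          run_diff _ _ hB (.inl le_rfl), _, _, run_or _ _ hB (.inl le_rfl), _, _,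
          run_assignLists hB M L v h, _, _, run_assignTable hB e hBn hl w v h, _, _, hK₁, _, _,
          run_remove hB L v h, _, _, hK₂, _, _, run_addTable hB e hB' h₁ h₂, rfl, by omega⟩
      · rw [ofProp_eq_nil] at h5
        exact absurd hL h5
    · rw [ofProp_eq_nil] at h4
      exact absurd hQ h4

set_option maxRecDepth 4000 in
/-- A step with empty `Q` splits off a connected component `X` of `S`. The minimality of `X` among the
closed sets that contain `r` expresses its connectedness. -/
theorem run_solve_split (hS : S.Nonempty) :
    ∃ r X Y, r ∈ X ∧ X ⊆ S ∧ (∀ a ∈ X, ∀ s ∈ S, s ∈ M a → s ∈ X) ∧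
      (∀ Z, r ∈ Z → (∀ b ∈ Z, ∀ s ∈ S, s ∈ M b → s ∈ Z) → X ⊆ Z) ∧
      ((∃ v ∈ F, (M v ∩ X).Nonempty ∧ Y = M v ∩ X) ∨
        ((∀ v ∈ F, ¬ (M v ∩ X).Nonempty) ∧ Y = {r})) ∧
      ∀ l₁ l₂ K₁ K₂,
        Calls (prog HN t) fSolve (solveArgs e M w X Y ∅ L l) (encodeTable e l₁) K₁ →
        Calls (prog HN t) fSolve (solveArgs e M w (S \ X) ∅ F L l₁) (encodeTable e l₂) K₂ →
        Calls (prog HN t) fSolve (solveArgs e M w S ∅ F L l) (encodeTable e l₂)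
          (N ^ 7 + K₁ + K₂) := by
  have h2 := hB.le_sq
  have h3 := hB.chain
  obtain ⟨r, hr, hf⟩ := run_first (R := R) (HN := HN) S hB (.inl le_rfl) hS
  obtain ⟨X, hX1, hX2, hX3, hX4, hX5⟩ := run_reach (R := R) (HN := HN) hB S {r} M (by simpa using hr)
  obtain ⟨Y, hY, hY'⟩ := run_pick (R := R) (HN := HN) hB F M X {r}
  refine ⟨r, X, Y, hX1 (by simp), hX2, hX3, fun Z hZ => hX4 Z (by simpa using hZ), hY,
    fun l₁ l₂ K₁ K₂ hK₁ hK₂ => ?_⟩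
  have hc : ((S \ {r}).card + 1) * N ^ 4 ≤ N ^ 6 := by
    have : (S \ {r}).card ≤ n := by simpa using Finset.card_le_univ (S \ {r})
    calc ((S \ {r}).card + 1) * N ^ 4 ≤ N ^ 2 * N ^ 4 := Nat.mul_le_mul_right _ (by omega)
      _ = N ^ 6 := by ring
  refine .of_wp (body := solveBody) rfl ?_
  simp [solveBody, solveArgs]
  refine ⟨_, _, run_any _ hB (.inl le_rfl), fun h => ?_, fun _ => ⟨_, _,
    run_any _ hB (.inl le_rfl), fun h => ?_, fun h => ?_⟩⟩
  · simp at h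
  · exact ⟨_, _, hf, _, _, hX5, _, _, run_diff _ _ hB (.inl le_rfl), _, _, hf, _, _, hY', _, _,
      hK₁, _, _, hK₂, rfl, by omega⟩
  · rw [ofProp_eq_nil] at h
    exact absurd hS h

end runs

/-! ### Induced paths -/

/-- The list is an induced path of `G`: of the entries after a given one, only the next is adjacent to
it. -/
def IsInducedPath {V : Type*} (G : SimpleGraph V) : List V → Prop
  | [] => True
  | x :: p => IsInducedPath G p ∧ x ∉ p ∧ ∀ y ∈ p, G.Adj x y ↔ p.head? = some y

theorem IsInducedPath.nodup {V : Type*} {G : SimpleGraph V} {p : List V}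
    (hp : IsInducedPath G p) : p.Nodup := by
  induction p with
  | nil => simp
  | cons y p ih => exact List.nodup_cons.2 ⟨hp.2.1, ih hp.1⟩

theorem IsInducedPath.adj_iff {V : Type*} {G : SimpleGraph V} {p : List V}
    (hp : IsInducedPath G p) (i j : ℕ) (hi : i < p.length) (hj : j < p.length) :
    G.Adj p[i] p[j] ↔ i + 1 = j ∨ j + 1 = i := by
  induction p generalizing i j with
  | nil => simp at hi
  | cons x p ih =>
    obtain ⟨h1, h2, h3⟩ := hp
    have key : ∀ j (hj : j < p.length), G.Adj x p[j] ↔ j = 0 := by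
      intro j hj
      rw [h3 _ (List.getElem_mem hj)]
      rw [List.head?_eq_getElem?, List.getElem?_eq_getElem (by omega), Option.some.injEq,
        h1.nodup.getElem_inj_iff, eq_comm]
    cases i with
    | zero =>
      cases j with
      | zero => simp
      | succ j => simpa [eq_comm] using key j (by simpa using hj)
    | succ i =>
      cases j with
      | zero => simpa [G.adj_comm, eq_comm] using key i (by simpa using hi)
      | succ j =>
        simpa using ih h1 i j (by simpa using hi) (by simpa using hj)

theorem IsInducedPath.length_lt {V : Type*} {G : SimpleGraph V} {p : List V} {t : ℕ}
    (hG : ¬ SimpleGraph.pathGraph t ⊴ G) (hp : IsInducedPath G p) : p.length < t := by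
  by_contra h
  refine hG ⟨⟨⟨fun i => p[i.1]'(by omega), fun i j hij => ?_⟩, fun {i j} => ?_⟩⟩
  · exact Fin.ext ((hp.nodup.getElem_inj_iff).1 hij)
  · exact (hp.adj_iff _ _ _ _).trans SimpleGraph.pathGraph_adj.symm

end HCol

/-! ### The second phase: searching along induced paths -/

namespace HCol

open Lisp Lisp.Code Lisp.Val
open scoped Classical

/-- The neighbourhoods of `G` as finite sets. -/
noncomputable def nbrs {n : ℕ} (G : SimpleGraph (Fin n)) (u : Fin n) : Finset (Fin n) :=
  Finset.univ.filter fun v => G.Adj u v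

@[simp] theorem mem_nbrs {n : ℕ} {G : SimpleGraph (Fin n)} {u v : Fin n} :
    v ∈ nbrs G u ↔ G.Adj u v := by simp [nbrs]

/-- The invariant of the second phase. The vertices of `S` are uncoloured. The induced path `p` has
been built by the calls in progress; `Q` and `F` are the uncoloured and the coloured neighbours of
its first vertex in the component at hand (or the starting vertex, if `p` is empty). -/
structure Frontier {n : ℕ} (G : SimpleGraph (Fin n)) (S Q F : Finset (Fin n))
    (p : List (Fin n)) : Prop where
  /-- `Q` consists of uncoloured vertices. -/
  subset : Q ⊆ S
  /-- Every vertex of `Q` and of `F` extends the path. -/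
  path : ∀ x ∈ Q ∪ F, IsInducedPath G (x :: p)
  /-- The vertices of `F` and of the path are coloured. -/
  disj : ∀ s ∈ S, s ∉ F ∧ s ∉ p
  /-- The uncoloured vertices outside `Q` have no neighbour on the path. -/
  away : ∀ s ∈ S \ Q, ∀ y ∈ p, ¬ G.Adj s y
  /-- Every component of `S` contains a vertex of `Q` or has a neighbour in `F`. -/
  meets : ∀ X ⊆ S, X.Nonempty → (∀ a ∈ X, ∀ s ∈ S, s ∈ nbrs G a → s ∈ X) →
    (X ∩ Q).Nonempty ∨ ∃ v ∈ F, (nbrs G v ∩ X).Nonempty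

namespace Frontier

variable {n : ℕ} {G : SimpleGraph (Fin n)} {S Q F X : Finset (Fin n)} {p : List (Fin n)}

/-- Colouring a vertex of `Q` preserves the invariant. -/
theorem assign (h : Frontier G S Q F p) {v : Fin n} (hv : v ∈ Q) :
    Frontier G (S \ {v}) (Q \ {v}) (F ∪ {v}) p where
  subset := Finset.sdiff_subset_sdiff h.subset le_rfl
  path x hx := h.path x (by
    simp only [Finset.mem_union, Finset.mem_sdiff, Finset.mem_singleton] at hx ⊢
    rcases hx with hx | hx | rfl
    · exact .inl hx.1
    · exact .inr hx
    · exact .inl hv)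
  disj s hs := by
    simp only [Finset.mem_sdiff, Finset.mem_singleton, Finset.mem_union] at hs ⊢
    have := h.disj s hs.1
    tauto
  away s hs := h.away s (by
    simp only [Finset.mem_sdiff, Finset.mem_singleton] at hs ⊢
    tauto)
  meets X hX hne hcl := by
    by_cases hvX : ∃ a ∈ X, G.Adj v a
    · obtain ⟨a, ha, hva⟩ := hvX
      exact .inr ⟨v, by simp, a, by simp [ha, hva]⟩
    · push Not at hvX
      rcases h.meets X (hX.trans Finset.sdiff_subset) hne (fun a ha s hs has => by
        by_cases hsv : s = v
        · subst hsv
          exact absurd (G.adj_symm (mem_nbrs.1 has)) (hvX a ha)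
        · exact hcl a ha s (by simp [hs, hsv]) has) with ⟨a, ha⟩ | ⟨u, hu, hu'⟩
      · refine .inl ⟨a, ?_⟩
        simp only [Finset.mem_inter] at ha ⊢
        have := hX ha.1
        simp only [Finset.mem_sdiff] at this ⊢
        exact ⟨ha.1, ha.2, this.2⟩
      · exact .inr ⟨u, by simp [hu], hu'⟩

/-- A minimal closed set is connected, so it has no proper nonempty closed subset. -/
theorem eq_of_closed {r : Fin n}
    (hcl : ∀ a ∈ X, ∀ s ∈ S, s ∈ nbrs G a → s ∈ X)
    (hmin : ∀ Z, r ∈ Z → (∀ b ∈ Z, ∀ s ∈ S, s ∈ nbrs G b → s ∈ Z) → X ⊆ Z) (hr : r ∈ X)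
    {Z : Finset (Fin n)} (hZ : Z ⊆ X) (hne : Z.Nonempty)
    (hZcl : ∀ a ∈ Z, ∀ s ∈ X, s ∈ nbrs G a → s ∈ Z) : Z = X := by
  refine Finset.Subset.antisymm hZ ?_
  by_cases hrZ : r ∈ Z
  · exact hmin Z hrZ fun b hb s hs hsb => hZcl b hb s (hcl b (hZ hb) s hs hsb) hsb
  · have := hmin (X \ Z) (by simp [hr, hrZ]) fun b hb s hs hsb => by
      simp only [Finset.mem_sdiff] at hb ⊢
      refine ⟨hcl b hb.1 s hs hsb, fun hsZ => hb.2 (hZcl s hsZ b hb.1 ?_)⟩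
      rw [mem_nbrs] at hsb ⊢
      exact G.adj_symm hsb
    obtain ⟨z, hz⟩ := hne
    exact absurd hz (Finset.mem_sdiff.1 (this (hZ hz))).2

/-- When `Q` is empty, a component `X` of `S` with a neighbour `v ∈ F` can be entered through `v`: the
induced path grows by `v`, and the neighbours of `v` in `X` are the new `Q`. -/
theorem nested (h : Frontier G S ∅ F p) {r : Fin n} (hX : X ⊆ S)
    (hcl : ∀ a ∈ X, ∀ s ∈ S, s ∈ nbrs G a → s ∈ X)
    (hmin : ∀ Z, r ∈ Z → (∀ b ∈ Z, ∀ s ∈ S, s ∈ nbrs G b → s ∈ Z) → X ⊆ Z) (hr : r ∈ X)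
    {v : Fin n} (hv : v ∈ F) (hne : (nbrs G v ∩ X).Nonempty) :
    Frontier G X (nbrs G v ∩ X) ∅ (v :: p) where
  subset := Finset.inter_subset_right
  path x hx := by
    simp only [Finset.union_empty, Finset.mem_inter, mem_nbrs] at hx
    have h1 := h.path v (by simp [hv])
    have h2 := h.disj x (hX hx.2)
    have h3 : x ≠ v := by rintro rfl; exact h2.1 hv
    refine ⟨h1, by simp [h3, h2.2], fun y hy => ?_⟩
    rcases List.mem_cons.1 hy with rfl | hy
    · simp [G.adj_symm hx.1]
    · have h4 := h.away x (by simp [hX hx.2]) y hy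
      simp only [h4, List.head?_cons, Option.some.injEq, false_iff]
      rintro rfl
      exact h1.2.1 hy
  disj s hs := by
    have h2 := h.disj s (hX hs)
    have h3 : s ≠ v := by rintro rfl; exact h2.1 hv
    simp [h2.2, h3]
  away s hs y hy := by
    simp only [Finset.mem_sdiff, Finset.mem_inter, mem_nbrs, not_and'] at hs
    rcases List.mem_cons.1 hy with rfl | hy
    · exact fun h => hs.2 hs.1 (G.adj_symm h)
    · exact h.away s (by simp [hX hs.1]) y hy
  meets Z hZ hZne hZcl := by
    rw [eq_of_closed hcl hmin hr hZ hZne hZcl]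
    obtain ⟨a, ha⟩ := hne
    exact .inl ⟨a, by simp at ha ⊢; tauto⟩

/-- A component can be entered through any of its vertices, with the empty path. -/
theorem root {r : Fin n} (hcl : ∀ a ∈ X, ∀ s ∈ S, s ∈ nbrs G a → s ∈ X)
    (hmin : ∀ Z, r ∈ Z → (∀ b ∈ Z, ∀ s ∈ S, s ∈ nbrs G b → s ∈ Z) → X ⊆ Z) (hr : r ∈ X) :
    Frontier G X {r} ∅ [] where
  subset := by simpa using hr
  path x hx := by simp [IsInducedPath]
  disj s hs := by simp
  away s hs y hy := by simp at hy
  meets Z hZ hZne hZcl := by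
    rw [eq_of_closed hcl hmin hr hZ hZne hZcl]
    exact .inl ⟨r, by simp [hr]⟩

/-- The invariant holds for the components that remain after one of them has been treated. -/
theorem rest (h : Frontier G S ∅ F p)
    (hcl : ∀ a ∈ X, ∀ s ∈ S, s ∈ nbrs G a → s ∈ X) : Frontier G (S \ X) ∅ F p where
  subset := by simp
  path := h.path
  disj s hs := h.disj s (Finset.mem_sdiff.1 hs).1
  away s hs := h.away s (by simp at hs ⊢; tauto)
  meets Z hZ hZne hZcl := by
    refine h.meets Z (hZ.trans Finset.sdiff_subset) hZne fun a ha s hs has => ?_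
    refine hZcl a ha s (Finset.mem_sdiff.2 ⟨hs, fun hsX => ?_⟩) has
    have h1 := Finset.mem_sdiff.1 (hZ ha)
    exact h1.2 (hcl s hsX a h1.1 (by rw [mem_nbrs] at has ⊢; exact G.adj_symm has))

end Frontier

/-- A bound for the number of calls in the second phase, where `d` bounds the number of vertices by
which the induced path can still grow. A vertex of `Q` with `c` colours contributes the factor
`2 * c + 1`, not `c`, to pay for the calls in which its list is inspected or found empty; `K` bounds
the product of these factors over any set `Q`. -/
def searchBound {n q : ℕ} (K d : ℕ) (S Q : Finset (Fin n))
    (L : Fin n → Finset (Fin q)) : ℕ :=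
  (∏ v ∈ Q, (2 * (L v).card + 1)) * (K ^ d * (1 + 2 * d * S.card))

section bound

variable {n q : ℕ} {K d : ℕ} {S Q : Finset (Fin n)} {L : Fin n → Finset (Fin q)}

theorem searchBound_pos (hK : 1 ≤ K) : 1 ≤ searchBound K d S Q L := by
  have : 0 < ∏ v ∈ Q, (2 * (L v).card + 1) := Finset.prod_pos fun _ _ => by omega
  unfold searchBound
  have : 0 < K ^ d := Nat.pow_pos hK
  exact Nat.succ_le_of_lt (by positivity)

theorem card_assignLists_le {HN : Fin q → Finset (Fin q)} {M : Fin n → Finset (Fin n)}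
    {v u : Fin n} {h : Fin q} : (assignLists HN M L v h u).card ≤ (L u).card := by
  apply Finset.card_le_card
  unfold assignLists
  split_ifs
  · exact Finset.inter_subset_left
  · exact le_rfl

theorem searchBound_branch (hK : 1 ≤ K) {HN : Fin q → Finset (Fin q)} {M : Fin n → Finset (Fin n)}
    {v : Fin n} (hv : v ∈ Q) {h : Fin q} (hh : h ∈ L v) :
    1 + searchBound K d (S \ {v}) (Q \ {v}) (assignLists HN M L v h) +
      searchBound K d S Q (removeColour L v h) ≤ searchBound K d S Q L := by
  unfold searchBound
  rw [← Finset.mul_prod_erase Q (fun v => 2 * (L v).card + 1) hv,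
    ← Finset.mul_prod_erase Q (fun u => 2 * (removeColour L v h u).card + 1) hv,
    Finset.sdiff_singleton_eq_erase v Q]
  have h1 : ∏ u ∈ Q.erase v, (2 * (removeColour L v h u).card + 1)
      = ∏ u ∈ Q.erase v, (2 * (L u).card + 1) :=
    Finset.prod_congr rfl fun u hu => by simp [removeColour, Finset.ne_of_mem_erase hu]
  have h2 : ∏ u ∈ Q.erase v, (2 * (assignLists HN M L v h u).card + 1)
      ≤ ∏ u ∈ Q.erase v, (2 * (L u).card + 1) :=
    Finset.prod_le_prod' fun u _ => by
      have := card_assignLists_le (HN := HN) (M := M) (L := L) (v := v) (u := u) (h := h)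
      omega
  have h3 : (removeColour L v h v).card + 1 = (L v).card := by
    simp [removeColour, Finset.sdiff_singleton_eq_erase, Finset.card_erase_add_one hh]
  have h4 : K ^ d * (1 + 2 * d * (S \ {v}).card) ≤ K ^ d * (1 + 2 * d * S.card) := by
    gcongr
    exact Finset.sdiff_subset
  rw [h1, ← h3]
  generalize (removeColour L v h v).card = c
  have h5 : 0 < ∏ u ∈ Q.erase v, (2 * (L u).card + 1) := Finset.prod_pos fun _ _ => by omega
  have h6 : 0 < K ^ d * (1 + 2 * d * S.card) := by
    have : 0 < K ^ d := Nat.pow_pos hK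
    positivity
  have h7 := Nat.mul_le_mul h2 h4
  generalize K ^ d * (1 + 2 * d * S.card) = Y at *
  generalize ∏ u ∈ Q.erase v, (2 * (L u).card + 1) = b at *
  have h8 : 1 ≤ b * Y := Nat.succ_le_of_lt (by positivity)
  nlinarith

theorem searchBound_split (hK : 1 ≤ K) {X Y : Finset (Fin n)} (hX : X ⊆ S) (hne : X.Nonempty)
    (hY : (2 * q + 1) ^ Y.card ≤ K) :
    1 + searchBound K d X Y L + searchBound K (d + 1) (S \ X) ∅ L
      ≤ searchBound K (d + 1) S ∅ L := by
  unfold searchBound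
  have h1 : ∏ v ∈ Y, (2 * (L v).card + 1) ≤ K := by
    refine (Finset.prod_le_pow_card _ _ _ fun v _ => ?_).trans hY
    have : (L v).card ≤ q := by simpa using Finset.card_le_univ (L v)
    omega
  have h2 : (S \ X).card + X.card = S.card := Finset.card_sdiff_add_card_eq_card hX
  have h3 : 1 ≤ X.card := hne.card_pos
  have h4 : 1 ≤ K ^ d := Nat.pow_pos hK
  have h5 := Nat.mul_le_mul_right (K ^ d * (1 + 2 * d * X.card)) h1
  rw [← h2, pow_succ]
  simp only [Finset.prod_empty, one_mul]
  have h6 : 1 ≤ K ^ d * K := Nat.succ_le_of_lt (by positivity)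
  have h7 : K * (K ^ d * (1 + 2 * d * X.card)) = (K ^ d * K) * (1 + 2 * d * X.card) := by ring
  rw [h7] at h5
  generalize K ^ d * K = Z at *
  nlinarith

end bound

section solve

variable {R : Type u} [CommSemiring R] {n q t N : ℕ} (HN : Fin q → Finset (Fin q)) (t)
  {α β : Type*} {H : Graph α β} (e : Fin q ≃ V(H)) (G : SimpleGraph (Fin n))
  (w : Fin n → Fin q → R)

/-- The factor contributed by the vertex `u` of colour `i`. -/
noncomputable def term (u : Fin n) (i : Fin q) : MvPolynomial V(H) R :=
  MvPolynomial.C (w u i) * MvPolynomial.X (e i)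

/-- With the accumulator `l`, the second phase returns, in at most `K` steps, a table of the product of
`l` and the partition function on `S`. -/
def Solves (S Q F : Finset (Fin n)) (L : Fin n → Finset (Fin q))
    (l : List ((V(H) →₀ ℕ) × R)) (B K : ℕ) : Prop :=
  ∃ l', IsTable (B + S.card) l' ∧
    tableSum l' = tableSum l * partition HN (nbrs G) (term e w) S L ∧
    Calls (prog HN t) fSolve (solveArgs e (nbrs G) w S Q F L l) (encodeTable e l') K

variable {HN t e G w}

/-- The cost of the second phase within a component, if the degrees in `S₀` are at most `Δ`. As
`p.length < t`, the bound is exponential in `Δ * t` only. -/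
theorem exists_solve (hB : Big n q t N) (hH : ∀ a b, a ∈ HN b ↔ b ∈ HN a)
    (hG : ¬ SimpleGraph.pathGraph t ⊴ G) {S₀ : Finset (Fin n)} {Δ : ℕ}
    (hΔ : ∀ v ∈ S₀, (nbrs G v ∩ S₀).card ≤ Δ)
    {S Q F : Finset (Fin n)} {p : List (Fin n)} (hf : Frontier G S Q F p) (hS : S ⊆ S₀)
    (hF : F ⊆ S₀) (L : Fin n → Finset (Fin q)) {l : List ((V(H) →₀ ℕ) × R)} {B : ℕ}
    (hl : IsTable B l) (hBn : B + S.card ≤ n) :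
    Solves HN t e G w S Q F L l B
      (searchBound ((2 * q + 1) ^ Δ) (t - p.length) S Q L * N ^ 7) := by
  have hK : 1 ≤ (2 * q + 1) ^ Δ := Nat.pow_pos (by omega)
  induction hk : searchBound ((2 * q + 1) ^ Δ) (t - p.length) S Q L using
    Nat.strong_induction_on generalizing S Q F p L l B with
  | _ k ih =>
  subst hk
  have hM : ∀ u v, u ∈ nbrs G v ↔ v ∈ nbrs G u := fun u v => by simp [G.adj_comm]
  have hpos : N ^ 7 ≤ searchBound ((2 * q + 1) ^ Δ) (t - p.length) S Q L * N ^ 7 :=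
    Nat.le_mul_of_pos_left _ (searchBound_pos hK)
  rcases Q.eq_empty_or_nonempty with rfl | hQ
  · rcases S.eq_empty_or_nonempty with rfl | hne
    · exact ⟨l, by simpa using hl, by simp [partition_empty], (run_solve_done hB).mono hpos⟩
    · obtain ⟨r, X, Y, hr, hX, hcl, hmin, hY, hrun⟩ :=
        run_solve_split (HN := HN) (e := e) (M := nbrs G) (w := w) (F := F) (L := L) (l := l) hB hne
      obtain ⟨v, hv, hvX, rfl⟩ : ∃ v ∈ F, (nbrs G v ∩ X).Nonempty ∧ Y = nbrs G v ∩ X := by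
        rcases hY with hY | ⟨hY, -⟩
        · exact hY
        · rcases hf.meets X hX ⟨r, hr⟩ hcl with ⟨a, ha⟩ | ⟨v, hv, hvX⟩
          · simp at ha
          · exact absurd hvX (hY v hv)
      have hf₁ := hf.nested hX hcl hmin hr hv hvX
      have hf₂ := hf.rest hcl
      obtain ⟨x, hx⟩ := hvX
      -- the path `x :: v :: p` is induced, so the depth can still decrease
      have hlen := (hf₁.path x (by simpa using hx)).length_lt hG
      obtain ⟨d, hd⟩ : ∃ d, t - p.length = d + 1 :=
        ⟨t - p.length - 1, by simp only [List.length_cons] at hlen; omega⟩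
      have hd' : t - (v :: p).length = d := by simp only [List.length_cons]; omega
      have hYK : (2 * q + 1) ^ (nbrs G v ∩ X).card ≤ (2 * q + 1) ^ Δ :=
        Nat.pow_le_pow_right (by omega) ((Finset.card_le_card
          (Finset.inter_subset_inter le_rfl (hX.trans hS))).trans (hΔ v (hF hv)))
      have hsb := searchBound_split (d := d) (L := L) hK hX ⟨r, hr⟩ hYK
      rw [hd] at ih hpos ⊢
      have hcard : (S \ X).card + X.card = S.card := Finset.card_sdiff_add_card_eq_card hX
      obtain ⟨l₁, h₁, hs₁, hc₁⟩ := ih (searchBound ((2 * q + 1) ^ Δ) d X (nbrs G v ∩ X) L)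
        (by omega) hf₁ (hX.trans hS) (by simp) L hl
        (by omega) (by rw [hd'])
      obtain ⟨l₂, h₂, hs₂, hc₂⟩ := ih (searchBound ((2 * q + 1) ^ Δ) (d + 1) (S \ X) ∅ L)
        (by omega) hf₂ (Finset.sdiff_subset.trans hS) hF L h₁
        (by omega) (by rw [hd])
      refine ⟨l₂, ?_, ?_, (hrun _ _ _ _ hc₁ hc₂).mono ?_⟩
      · rwa [show B + S.card = B + X.card + (S \ X).card by omega]
      · rw [hs₂, hs₁, partition_split hM hX hcl, mul_assoc]
      · have := Nat.mul_le_mul_right (N ^ 7) hsb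
        rw [add_mul, add_mul, one_mul] at this
        exact this
  · obtain ⟨v, hv, h0, h1⟩ := run_solve_branch (HN := HN) (e := e) (M := nbrs G) (w := w) (S := S)
      (F := F) (L := L) hB (show B ≤ n by omega) hl hQ
    have hvS := hf.subset hv
    rcases (L v).eq_empty_or_nonempty with hL | hL
    · exact ⟨[], ⟨by simp, by simp⟩, by rw [partition_eq_zero hvS hL]; simp [tableSum],
        (h0 hL).mono hpos⟩
    · obtain ⟨h, hh, hrun⟩ := h1 hL
      have hsb := searchBound_branch (d := t - p.length) (S := S) (HN := HN) (M := nbrs G) hK hv hh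
      have hcard : (S \ {v}).card + 1 = S.card := by
        rw [Finset.sdiff_singleton_eq_erase, Finset.card_erase_add_one hvS]
      obtain ⟨l₁, h₁, hs₁, hc₁⟩ := ih _ (by omega) (hf.assign hv) (Finset.sdiff_subset.trans hS)
        (Finset.union_subset hF (by simpa using hS hvS)) (assignLists HN (nbrs G) L v h)
        (hl.scale (e h) (w v h)) (by omega) rfl
      obtain ⟨l₂, h₂, hs₂, hc₂⟩ := ih _ (by omega) hf hS hF (removeColour L v h) hl hBn rfl
      rw [show B + 1 + (S \ {v}).card = B + S.card by omega] at h₁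
      refine ⟨addTable l₁ l₂, .addTable h₁.le h₂, ?_,
        (hrun _ _ _ _ _ hBn h₁ h₂ hc₁ hc₂).mono ?_⟩
      · rw [tableSum_addTable, hs₁, hs₂, tableSum_scale,
          partition_branch hM (by simp) hH hvS hh, term]
        ring
      · have := Nat.mul_le_mul_right (N ^ 7) hsb
        rw [add_mul, add_mul, one_mul] at this
        exact this

/-- The cost of the second phase. At the top level, `F` is empty, and every component is entered
through an arbitrary vertex. -/
theorem exists_solve_top (hB : Big n q t N) (hH : ∀ a b, a ∈ HN b ↔ b ∈ HN a)
    (hG : ¬ SimpleGraph.pathGraph t ⊴ G) {Δ : ℕ} {S : Finset (Fin n)}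
    (hΔ : ∀ v ∈ S, (nbrs G v ∩ S).card ≤ Δ)
    (L : Fin n → Finset (Fin q)) {l : List ((V(H) →₀ ℕ) × R)} {B : ℕ}
    (hl : IsTable B l) (hBn : B + S.card ≤ n) :
    Solves HN t e G w S ∅ ∅ L l B
      (((2 * q + 1) ^ (Δ * t + 1) * ((2 * t + 2) * S.card) + 1) * N ^ 7) := by
  induction hk : S.card using Nat.strong_induction_on generalizing S l B with
  | _ k ih =>
  subst hk
  have hM : ∀ u v, u ∈ nbrs G v ↔ v ∈ nbrs G u := fun u v => by simp [G.adj_comm]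
  rcases S.eq_empty_or_nonempty with rfl | hne
  · exact ⟨l, by simpa using hl, by simp [partition_empty], (run_solve_done hB).mono (by simp)⟩
  · obtain ⟨r, X, Y, hr, hX, hcl, hmin, hY, hrun⟩ :=
      run_solve_split (HN := HN) (e := e) (M := nbrs G) (w := w) (F := ∅) (L := L) (l := l) hB hne
    have hY : Y = {r} := by simpa using hY
    subst hY
    have hcard : (S \ X).card + X.card = S.card := Finset.card_sdiff_add_card_eq_card hX
    have hX1 : 1 ≤ X.card := Finset.card_pos.2 ⟨r, hr⟩
    obtain ⟨l₁, h₁, hs₁, hc₁⟩ := exists_solve (HN := HN) (e := e) (w := w) hB hH hG hΔ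
      (Frontier.root hcl hmin hr) hX (by simp) L hl (by omega)
    obtain ⟨l₂, h₂, hs₂, hc₂⟩ := ih (S \ X).card (by omega) (S := S \ X)
      (fun v hv => (Finset.card_le_card (Finset.inter_subset_inter le_rfl Finset.sdiff_subset)).trans
        (hΔ v (Finset.mem_sdiff.1 hv).1)) h₁ (by omega) rfl
    refine ⟨l₂, ?_, ?_, (hrun _ _ _ _ hc₁ hc₂).mono ?_⟩
    · rwa [show B + S.card = B + X.card + (S \ X).card by omega]
    · rw [hs₂, hs₁, partition_split hM hX hcl, mul_assoc]
    · rw [← hcard]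
      have h5 : searchBound ((2 * q + 1) ^ Δ) (t - ([] : List (Fin n)).length) X {r} L
          ≤ (2 * q + 1) ^ (Δ * t + 1) * ((2 * t + 1) * X.card) := by
        simp only [searchBound, Finset.prod_singleton, List.length_nil, Nat.sub_zero, ← pow_mul]
        have : (L r).card ≤ q := by simpa using Finset.card_le_univ (L r)
        calc (2 * (L r).card + 1) * ((2 * q + 1) ^ (Δ * t) * (1 + 2 * t * X.card))
            ≤ (2 * q + 1) * ((2 * q + 1) ^ (Δ * t) * ((2 * t + 1) * X.card)) :=
              Nat.mul_le_mul (by omega) (Nat.mul_le_mul_left _ (by nlinarith))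
          _ = (2 * q + 1) ^ (Δ * t + 1) * ((2 * t + 1) * X.card) := by ring
      have h6 : 1 ≤ (2 * q + 1) ^ (Δ * t + 1) := Nat.pow_pos (by omega)
      have h7 := Nat.mul_le_mul_right (N ^ 7) h5
      generalize (2 * q + 1) ^ (Δ * t + 1) = W at *
      have h8 : 1 + W * ((2 * t + 1) * X.card) + (W * ((2 * t + 2) * (S \ X).card) + 1)
          ≤ W * ((2 * t + 2) * ((S \ X).card + X.card)) + 1 := by nlinarith
      have h9 := Nat.mul_le_mul_right (N ^ 7) h8
      rw [add_mul, add_mul, one_mul] at h9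
      omega

end solve

end HCol

/-! ### The first phase: branching on good pairs -/

namespace HCol

open Lisp Lisp.Code Lisp.Val
open scoped Classical

/-- A bound for the cost of the first phase, where `a` bounds the cost of one node together with that
of the second phase started there, `m` the total size of the lists at the beginning and `μ` the
present one, and where every branching decreases `μ` by at least `D` on one side. There are at most
`(m + 2) ^ (μ / D)` ways to take the side of the large decrease, and at most `μ + 1` steps between. -/
def branchBound (m D a μ : ℕ) : ℕ := (m + 2) ^ (μ / D) * (2 * a * (μ + 1))

section bound

variable {m D a μ ν ν' : ℕ}

theorem branchBound_mono (h : ν ≤ μ) : branchBound m D a ν ≤ branchBound m D a μ := by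
  unfold branchBound
  exact Nat.mul_le_mul (Nat.pow_le_pow_right (by omega) (Nat.div_le_div_right h))
    (Nat.mul_le_mul_left _ (by omega))

theorem branchBound_succ_le (h : ν < μ) :
    (m + 2) ^ (μ / D) * (2 * a) + branchBound m D a ν ≤ branchBound m D a μ := by
  unfold branchBound
  have h1 : (m + 2) ^ (ν / D) * (2 * a * (ν + 1)) ≤ (m + 2) ^ (μ / D) * (2 * a * μ) :=
    Nat.mul_le_mul (Nat.pow_le_pow_right (by omega) (Nat.div_le_div_right h.le))
      (Nat.mul_le_mul_left _ (by omega))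
  calc _ ≤ (m + 2) ^ (μ / D) * (2 * a) + (m + 2) ^ (μ / D) * (2 * a * μ) := by omega
    _ = _ := by ring

/-- The step at a vertex with one colour only: the other side of the branching ends at once. -/
theorem branchBound_forced (h : ν < μ) : 2 * a + branchBound m D a ν ≤ branchBound m D a μ := by
  refine le_trans ?_ (branchBound_succ_le h)
  have : 2 * a ≤ (m + 2) ^ (μ / D) * (2 * a) := Nat.le_mul_of_pos_left _ (Nat.pow_pos (by omega))
  omega

/-- The step at a pair `(v, h)` such that `h` for `v` decreases the total size of the lists to `ν'`. -/
theorem branchBound_branch (hμ : μ ≤ m) (hD : 1 ≤ D) (h : ν < μ) (h' : ν' + D ≤ μ) :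
    a + branchBound m D a ν' + branchBound m D a ν ≤ branchBound m D a μ := by
  refine le_trans ?_ (branchBound_succ_le h)
  gcongr
  refine (Nat.add_le_add_left (branchBound_mono (show ν' ≤ μ - D by omega)) _).trans ?_
  unfold branchBound
  obtain ⟨k, hk⟩ : ∃ k, μ / D = k + 1 :=
    ⟨μ / D - 1, by have := Nat.div_pos (show D ≤ μ by omega) hD; omega⟩
  have hk' : (μ - D) / D = k := by
    have := Nat.div_eq_sub_div (show 0 < D by omega) (show D ≤ μ by omega)
    omega
  rw [hk, hk', pow_succ]
  have h1 : 1 ≤ (m + 2) ^ k := Nat.pow_pos (by omega)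
  have h2 : 2 * a * (μ - D + 1) ≤ 2 * a * (m + 1) := Nat.mul_le_mul_left _ (by omega)
  have h3 := Nat.mul_le_mul_left ((m + 2) ^ k) h2
  have h4 := Nat.mul_le_mul_right (2 * a) h1
  calc a + (m + 2) ^ k * (2 * a * (μ - D + 1))
      ≤ (m + 2) ^ k * (2 * a) + (m + 2) ^ k * (2 * a * (m + 1)) := by omega
    _ = _ := by ring

end bound

section branch

variable {R : Type u} [CommSemiring R] {n q t N : ℕ} {HN : Fin q → Finset (Fin q)}
  {α β : Type*} {H : Graph α β} (e : Fin q ≃ V(H)) (M : Fin n → Finset (Fin n))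
  (w : Fin n → Fin q → R)

/-- The arguments of `fBranch`. -/
noncomputable def branchArgs (S : Finset (Fin n)) (L : Fin n → Finset (Fin q))
    (l : List ((V(H) →₀ ℕ) × R)) (θ : ℕ) : Val R :=
  ofList [mask S, masks L, encodeTable e l, masks M, weights w, ofNat θ]

variable {e M w} {S : Finset (Fin n)} {L : Fin n → Finset (Fin q)}
  {l : List ((V(H) →₀ ℕ) × R)} {θ : ℕ} (hB : Big n q t N)
include hB

theorem Big.chain' : N ^ 7 ≤ N ^ 11 ∧ 1000 * N ^ 11 ≤ N ^ 12 :=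
  ⟨Nat.pow_le_pow_right (by have := hB.thousand; omega) (by omega), hB.pow_succ 11⟩

set_option maxRecDepth 4000 in
theorem run_branch_dead (hd : ∃ v ∈ S, L v = ∅) :
    Calls (prog HN t) fBranch (branchArgs e M w S L l θ) (encodeTable e []) (N ^ 12) := by
  have h2 := hB.le_sq
  have h3 := hB.chain
  have h4 := hB.chain'
  refine .of_wp (body := branchBody) rfl ?_
  simp [branchBody, branchArgs]
  refine ⟨_, _, run_dead hB _ _, fun h => ⟨rfl, by omega⟩, fun h => ?_⟩
  rw [ofProp_eq_nil] at h
  exact absurd hd h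

set_option maxRecDepth 4000 in
/-- If no list is empty, then the first phase branches on a good pair, or passes to the second phase if
there is none. -/
theorem run_branch (hd : ¬ ∃ v ∈ S, L v = ∅) (hθ : θ ≤ N ^ 2) {B : ℕ} (hBn : B ≤ n)
    (hl : IsTable B l) :
    (∃ v ∈ S, ∃ h ∈ L v, Good HN t M S L θ v h ∧
      ∀ l₁ l₂ K₁ K₂ B', B' ≤ n → IsTable B' l₁ → IsTable B' l₂ →
        Calls (prog HN t) fBranch (branchArgs e M w (S \ {v})
          (assignLists HN M L v h) (scale (e h) (w v h) l) θ) (encodeTable e l₁) K₁ →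
        Calls (prog HN t) fBranch (branchArgs e M w S (removeColour L v h) l θ)
          (encodeTable e l₂) K₂ →
        Calls (prog HN t) fBranch (branchArgs e M w S L l θ)
          (encodeTable e (addTable l₁ l₂)) (N ^ 12 + K₁ + K₂)) ∨
    (∀ v ∈ S, ∀ h ∈ L v, ¬ Good HN t M S L θ v h) ∧
      ∀ l' K, Calls (prog HN t) fSolve (solveArgs e M w S ∅ ∅ L l) (encodeTable e l') K →
        Calls (prog HN t) fBranch (branchArgs e M w S L l θ) (encodeTable e l') (N ^ 12 + K) := by
  have h2 := hB.le_sq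
  have h3 := hB.chain
  have h4 := hB.chain'
  have hc : (S.card + 1) * N ^ 9 ≤ N ^ 11 := by
    have : S.card ≤ n := by simpa using Finset.card_le_univ S
    calc (S.card + 1) * N ^ 9 ≤ N ^ 2 * N ^ 9 := Nat.mul_le_mul_right _ (by omega)
      _ = N ^ 11 := by ring
  obtain ⟨y, hy, hp⟩ := run_findPair (R := R) (HN := HN) hB S M S L hθ
  rcases hy with ⟨v, hv, h, hh, hg, rfl⟩ | ⟨hg, rfl⟩
  · refine .inl ⟨v, hv, h, hh, hg, fun l₁ l₂ K₁ K₂ B' hB' h₁ h₂ hK₁ hK₂ => ?_⟩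
    refine .of_wp (body := branchBody) rfl ?_
    simp [branchBody, branchArgs]
    refine ⟨_, _, run_dead hB _ _, fun h => ?_, fun h5 => ?_⟩
    · rw [ofProp_eq_nil, not_not] at h
      exact absurd h hd
    · refine ⟨_, _, hp, fun h6 => ?_, fun h6 => by simp at h6⟩
      exact ⟨_, _, run_diff _ _ hB (.inl le_rfl), _, _,
          run_assignLists hB M L v h, _, _, run_assignTable hB e hBn hl w v h, _, _, hK₁, _, _,
          run_remove hB L v h, _, _, hK₂, _, _, run_addTable hB e hB' h₁ h₂, rfl, by omega⟩
  · refine .inr ⟨hg, fun l' K hK => ?_⟩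
    refine .of_wp (body := branchBody) rfl ?_
    simp [branchBody, branchArgs]
    refine ⟨_, _, run_dead hB _ _, fun h => ?_, fun h5 => ?_⟩
    · rw [ofProp_eq_nil, not_not] at h
      exact absurd h hd
    · refine ⟨_, _, hp, fun h6 => absurd rfl h6, fun h6 => ?_⟩
      have hz := calls_zeros (A := masks HN) (T := ofNat t) (Z := ofNat q)
        (fun i : Fin n => (ofProp (i ∈ S) : Val R))
      have h0 : (ofFamily fun _ : Fin n => (.nil : Val R)) = mask (∅ : Finset (Fin n)) := by
        simp [mask, bits, ofProp]
      rw [h0] at hz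
      exact ⟨_, _, hz, _, _, hK, rfl, by omega⟩

end branch

section measure

variable {n q t : ℕ} {HN : Fin q → Finset (Fin q)} {M : Fin n → Finset (Fin n)}
  {S : Finset (Fin n)} {L : Fin n → Finset (Fin q)} {θ : ℕ}

/-- The choice of `h` for `v` decreases the total size of the lists by more than the number of lists
that it shrinks. -/
theorem sum_card_assign (hM : ∀ v, v ∉ M v) {v : Fin n} (hv : v ∈ S) {h : Fin q} (hh : h ∈ L v) :
    ∑ u ∈ S \ {v}, (assignLists HN M L v h u).card + (hit HN M S L v h).card + 1
      ≤ ∑ u ∈ S, (L u).card := by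
  rw [← Finset.add_sum_erase S _ hv, Finset.sdiff_singleton_eq_erase]
  have h1 : 1 ≤ (L v).card := Finset.card_pos.2 ⟨h, hh⟩
  have h2 : hit HN M S L v h = (S.erase v).filter fun u => u ∈ M v ∧ ¬ L u ⊆ HN h := by
    ext u
    simp only [hit, Finset.mem_filter, Finset.mem_inter, Finset.mem_erase]
    constructor
    · rintro ⟨⟨h3, h4⟩, h5⟩
      refine ⟨⟨?_, h4⟩, h3, h5⟩
      rintro rfl
      exact hM _ h3
    · tauto
  rw [h2, Finset.card_filter, ← Finset.sum_add_distrib]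
  have h3 : ∑ u ∈ S.erase v, ((assignLists HN M L v h u).card +
      if u ∈ M v ∧ ¬ L u ⊆ HN h then 1 else 0) ≤ ∑ u ∈ S.erase v, (L u).card := by
    refine Finset.sum_le_sum fun u _ => ?_
    split_ifs with h4
    · refine Finset.card_lt_card ?_
      rw [assignLists, if_pos h4.1]
      refine Finset.ssubset_iff_subset_ne.2 ⟨Finset.inter_subset_left, fun h5 => h4.2 ?_⟩
      exact Finset.inter_eq_left.1 h5
    · exact card_assignLists_le
  omega

theorem sum_card_remove {v : Fin n} (hv : v ∈ S) {h : Fin q} (hh : h ∈ L v) :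
    ∑ u ∈ S, (removeColour L v h u).card < ∑ u ∈ S, (L u).card := by
  refine Finset.sum_lt_sum (fun u _ => Finset.card_le_card ?_) ⟨v, hv, Finset.card_lt_card ?_⟩
  · unfold removeColour
    split_ifs
    · exact Finset.sdiff_subset
    · exact le_rfl
  · rw [removeColour, if_pos rfl]
    exact Finset.sdiff_ssubset (by simpa using hh) (by simp)

/-- If there is no good pair, then the degrees are small. Indeed all lists have at least two elements,
and for distinct colours `a, b` of `v` at least one of the choices of `a` and `b` for `v` shrinks
the list of a given neighbour of `v`, because `a` and `b` have at most one common neighbour. -/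
theorem card_nbrs_le (hcommon : ∀ a b, a ≠ b → (HN a ∩ HN b).card ≤ 1) {D : ℕ}
    (hD : ∀ r, θ ≤ r * (r * t) ↔ D ≤ r) (hd : ¬ ∃ v ∈ S, L v = ∅)
    (hg : ∀ v ∈ S, ∀ h ∈ L v, ¬ Good HN t M S L θ v h) {v : Fin n} (hv : v ∈ S) :
    (M v ∩ S).card ≤ 2 * (D - 1) := by
  have two : ∀ u ∈ S, ∃ a ∈ L u, ∃ b ∈ L u, a ≠ b := by
    intro u hu
    obtain ⟨a, ha⟩ := Finset.nonempty_iff_ne_empty.2 fun h => hd ⟨u, hu, h⟩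
    have h1 := hg u hu a ha
    rw [Good, not_or] at h1
    obtain ⟨b, hb⟩ := Finset.nonempty_iff_ne_empty.2 h1.1
    simp only [Finset.mem_sdiff, Finset.mem_singleton] at hb
    exact ⟨a, ha, b, hb.1, fun h => hb.2 h.symm⟩
  have small : ∀ h ∈ L v, (hit HN M S L v h).card + 1 ≤ D := by
    intro h hh
    have h1 := hg v hv h hh
    rw [Good, not_or, hD, not_le] at h1
    exact h1.2
  obtain ⟨a, ha, b, hb, hab⟩ := two v hv
  have hsub : M v ∩ S ⊆ hit HN M S L v a ∪ hit HN M S L v b := by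
    intro u hu
    simp only [hit, Finset.mem_union, Finset.mem_filter, hu, true_and]
    by_contra hcon
    rw [not_or, not_not, not_not] at hcon
    obtain ⟨c, hc, d, hd, hcd⟩ := two u (Finset.mem_inter.1 hu).2
    exact hcd (Finset.card_le_one.1 (hcommon a b hab) c
      (Finset.mem_inter.2 ⟨hcon.1 hc, hcon.2 hc⟩) d (Finset.mem_inter.2 ⟨hcon.1 hd, hcon.2 hd⟩))
  have h1 := small a ha
  have h2 := small b hb
  have h3 := (Finset.card_le_card hsub).trans (Finset.card_union_le _ _)
  omega

end measure

/-! ### Correctness and cost of the program -/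

section main

variable {R : Type u} [CommSemiring R] {n q t N : ℕ} {HN : Fin q → Finset (Fin q)}
  {α β : Type*} {H : Graph α β} {e : Fin q ≃ V(H)} {G : SimpleGraph (Fin n)}
  {w : Fin n → Fin q → R}

/-- A bound for the cost of a call of the first phase that starts the second phase, when the degrees
are at most `2 * (D - 1)`. -/
def leafBound (n q t N D : ℕ) : ℕ :=
  N ^ 12 + ((2 * q + 1) ^ (2 * (D - 1) * t + 1) * ((2 * t + 2) * n) + 1) * N ^ 7

/-- The first phase, with its cost. The threshold `D` is the least `r` with `θ ≤ r * (r * t)`. -/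
theorem exists_branch (hB : Big n q t N) (hH : ∀ a b, a ∈ HN b ↔ b ∈ HN a)
    (hcommon : ∀ a b, a ≠ b → (HN a ∩ HN b).card ≤ 1)
    (hG : ¬ SimpleGraph.pathGraph t ⊴ G) {θ D : ℕ} (hθ : θ ≤ N ^ 2)
    (hD : ∀ r, θ ≤ r * (r * t) ↔ D ≤ r) (hD1 : 1 ≤ D) (S : Finset (Fin n))
    (L : Fin n → Finset (Fin q)) {l : List ((V(H) →₀ ℕ) × R)} {B : ℕ}
    (hl : IsTable B l) (hBn : B + S.card ≤ n) :
    ∃ l', IsTable (B + S.card) l' ∧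
      tableSum l' = tableSum l * partition HN (nbrs G) (term e w) S L ∧
      Calls (prog HN t) fBranch (branchArgs e (nbrs G) w S L l θ) (encodeTable e l')
        (branchBound (n * q) D (leafBound n q t N D) (∑ u ∈ S, (L u).card)) := by
  induction hk : ∑ u ∈ S, (L u).card using Nat.strong_induction_on generalizing S L l B with
  | _ k ih =>
  subst hk
  have hM : ∀ u v, u ∈ nbrs G v ↔ v ∈ nbrs G u := fun u v => by simp [G.adj_comm]
  have hM' : ∀ v, v ∉ nbrs G v := by simp
  have hleaf : leafBound n q t N D ≤ branchBound (n * q) D (leafBound n q t N D)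
      (∑ u ∈ S, (L u).card) := by
    unfold branchBound
    have : 1 ≤ (n * q + 2) ^ ((∑ u ∈ S, (L u).card) / D) := Nat.pow_pos (by omega)
    nlinarith [Nat.zero_le (leafBound n q t N D * ∑ u ∈ S, (L u).card),
      Nat.mul_le_mul_right (2 * leafBound n q t N D * (∑ u ∈ S, (L u).card + 1)) this]
  have ha : N ^ 12 ≤ leafBound n q t N D := Nat.le_add_right _ _
  by_cases hd : ∃ v ∈ S, L v = ∅
  · obtain ⟨v, hv, hL⟩ := hd
    exact ⟨[], ⟨by simp, by simp⟩, by rw [partition_eq_zero hv hL]; simp [tableSum],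
      (run_branch_dead hB ⟨v, hv, hL⟩).mono (ha.trans hleaf)⟩
  rcases run_branch (HN := HN) (e := e) (M := nbrs G) (w := w) (l := l) hB hd hθ
    (show B ≤ n by omega) hl with ⟨v, hv, h, hh, hg, hrun⟩ | ⟨hg, hrun⟩
  · have hcard : (S \ {v}).card + 1 = S.card := by
      rw [Finset.sdiff_singleton_eq_erase, Finset.card_erase_add_one hv]
    have hμ₁ := sum_card_assign (HN := HN) hM' hv hh
    have hμ₂ := sum_card_remove hv hh
    have hμ : ∑ u ∈ S, (L u).card ≤ n * q := by
      refine (Finset.sum_le_card_nsmul _ _ q fun u _ => by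
        simpa using Finset.card_le_univ (L u)).trans ?_
      rw [smul_eq_mul]
      exact Nat.mul_le_mul_right _ (by simpa using Finset.card_le_univ S)
    obtain ⟨l₁, h₁, hs₁, hc₁⟩ := ih _ (by omega) (S \ {v}) (assignLists HN (nbrs G) L v h)
      (hl.scale (e h) (w v h)) (by omega) rfl
    rw [show B + 1 + (S \ {v}).card = B + S.card by omega] at h₁
    have hpart := partition_branch (P := MvPolynomial V(H) R) (x := term e w) hM hM' hH hv hh
    -- if `h` is the only colour of `v`, the second branch has an empty list and costs `N ^ 12` only
    by_cases hforced : L v \ {h} = ∅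
    · have hdead : removeColour L v h v = ∅ := by simpa [removeColour] using hforced
      refine ⟨_, .addTable h₁.le ⟨by simp, by simp⟩, ?_, (hrun l₁ [] _ _ _ hBn h₁
        ⟨by simp, by simp⟩ hc₁ (run_branch_dead hB ⟨v, hv, hdead⟩)).mono ?_⟩
      · rw [tableSum_addTable, hs₁, tableSum_scale, hpart, partition_eq_zero hv hdead, term]
        simp [tableSum, mul_assoc]
      · have := branchBound_forced (m := n * q) (D := D) (a := leafBound n q t N D)
          (show ∑ u ∈ S \ {v}, (assignLists HN (nbrs G) L v h u).card < ∑ u ∈ S, (L u).card by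
            omega)
        omega
    · obtain ⟨l₂, h₂, hs₂, hc₂⟩ := ih _ hμ₂ S (removeColour L v h) hl hBn rfl
      refine ⟨_, .addTable h₁.le h₂, ?_, (hrun l₁ l₂ _ _ _ hBn h₁ h₂ hc₁ hc₂).mono ?_⟩
      · rw [tableSum_addTable, hs₁, hs₂, tableSum_scale, hpart, term]
        ring
      · have hhit := (hD _).1 (hg.resolve_left hforced)
        have := branchBound_branch (a := leafBound n q t N D) hμ hD1 hμ₂
          (show ∑ u ∈ S \ {v}, (assignLists HN (nbrs G) L v h u).card + D
            ≤ ∑ u ∈ S, (L u).card by omega)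
        omega
  · obtain ⟨l', h₁, hs₁, hc₁⟩ := exists_solve_top (HN := HN) (e := e) (w := w) hB hH hG
      (fun v hv => card_nbrs_le hcommon hD hd hg hv) L hl hBn
    refine ⟨l', h₁, hs₁, (hrun _ _ hc₁).mono (le_trans ?_ hleaf)⟩
    unfold leafBound
    have : S.card ≤ n := by simpa using Finset.card_le_univ S
    gcongr

set_option maxRecDepth 4000 in
/-- The main function is correct, and its cost is bounded. -/
theorem exists_main (hB : Big n q t N) (hn : n < N) (hH : ∀ a b, a ∈ HN b ↔ b ∈ HN a)
    (hcommon : ∀ a b, a ≠ b → (HN a ∩ HN b).card ≤ 1)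
    (hG : ¬ SimpleGraph.pathGraph t ⊴ G) {D : ℕ}
    (hD : ∀ r, n * (Nat.log 2 n + 1) + 1 ≤ r * (r * t) ↔ D ≤ r) (hD1 : 1 ≤ D)
    (L : Fin n → Finset (Fin q)) :
    ∃ l, IsTable n l ∧ tableSum l = partition HN (nbrs G) (term e w) Finset.univ L ∧
      Calls (prog HN t) 0 (.cons (masks (nbrs G)) (.cons (masks L) (weights w)))
        (encodeTable e l)
        (N ^ 12 + branchBound (n * q) D (leafBound n q t N D) (n * q)) := by
  have h2 := hB.le_sq
  have h3 := hB.chain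
  have h4 := hB.chain'
  have hlog : Nat.log 2 n ≤ n := Nat.log_le_self _ _
  have hθ : n * (Nat.log 2 n + 1) + 1 ≤ N ^ 2 := by
    rcases Nat.eq_zero_or_pos n with rfl | hpos
    · omega
    · have h5 : Nat.log 2 n + 1 ≤ n := Nat.log_lt_self 2 (by omega)
      have h6 : n * (Nat.log 2 n + 1) ≤ n * n := Nat.mul_le_mul_left _ h5
      have h7 : n * n + 1 ≤ N ^ 2 := by nlinarith
      omega
  have hone : IsTable (R := R) 0 [((0 : V(H) →₀ ℕ), (1 : R))] := ⟨by simp, by simp⟩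
  obtain ⟨l, h₁, hs₁, hc₁⟩ := exists_branch (HN := HN) (e := e) (w := w) hB hH hcommon hG hθ hD hD1
    Finset.univ L hone (by simp)
  refine ⟨l, by simpa using h₁, ?_, ?_⟩
  · rw [hs₁]
    simp [tableSum]
  · refine .of_wp (body := mainBody (ofNat q)) rfl ?_
    simp [mainBody, lift_ofNat]
    have hz := calls_zeros (A := masks HN) (T := ofNat t) (Z := ofNat q)
      (fun i : Fin n => (mask (nbrs G i) : Val R))
    rw [← ofNat_eq_ofFamily] at hz
    have hfull := calls_full (A := masks HN) (T := ofNat t) (Z := ofNat q)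
      (fun i : Fin n => (.nil : Val R))
    rw [← ofNat_eq_ofFamily, show (bits fun _ : Fin n => True : Val R) = mask Finset.univ from
      bits_eq_mask (by simp)] at hfull
    have hμ : ∑ u, (L u).card ≤ n * q := by
      refine (Finset.sum_le_card_nsmul _ _ q fun u _ => by
        simpa using Finset.card_le_univ (L u)).trans ?_
      simp
    have henc : (ofList [.cons (ofNat q) (.atom 1)] : Val R)
        = encodeTable e [((0 : V(H) →₀ ℕ), (1 : R))] := by
      simp [encodeTable, encodeTerm, ofNat_zero, ofNat_eq_ofFamily q]
    rw [branchArgs, ← henc, ofNat_succ] at hc₁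
    have e1 : n * (10 * n + 30) + 10 * n + 30 ≤ N ^ 4 := by
      have := hB.n_le
      have := hB.thousand
      have h5 : n * (10 * n + 30) ≤ N * (11 * N) := Nat.mul_le_mul (by omega) (by omega)
      have h6 : N * (11 * N) = 11 * N ^ 2 := by ring
      omega
    have e2 : n * (20 * (Nat.log 2 n + 1) + 50) + 10 ≤ N ^ 4 := by
      have := hB.n_le
      have := hB.thousand
      have h5 : n * (20 * (Nat.log 2 n + 1) + 50) ≤ N * (21 * N) :=
        Nat.mul_le_mul (by omega) (by omega)
      have h6 : N * (21 * N) = 21 * N ^ 2 := by ring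
      omega
    have e3 : (ofNat q : Val Unit).size ≤ N ^ 2 := by rw [size_ofNat]; omega
    have e4 := branchBound_mono (m := n * q) (D := D) (a := leafBound n q t N D) hμ
    exact ⟨_, _, hz, _, _, hfull, _, _, calls_log n le_rfl, _, _, calls_mul _ _, _, _, hc₁, rfl,
      by omega⟩

end main

end HCol

/-! ### Growth estimates -/

namespace HCol

open Lisp Lisp.Code Lisp.Val
open scoped Classical

section growth

theorem add_le_pow {E x y : ℝ} {a b : ℕ} (hE : 2 ≤ E) (hx : x ≤ E ^ a) (hy : y ≤ E ^ b) :
    x + y ≤ E ^ (a + b + 1) := by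
  have h1 : (1 : ℝ) ≤ E := by linarith
  have h2 : E ^ a ≤ E ^ (a + b) := pow_le_pow_right₀ h1 (by omega)
  have h3 : E ^ b ≤ E ^ (a + b) := pow_le_pow_right₀ h1 (by omega)
  have h4 : (0 : ℝ) ≤ E ^ (a + b) := by positivity
  rw [pow_succ]
  nlinarith

theorem mul_le_pow {E x y : ℝ} {a b : ℕ} (hE : 2 ≤ E) (hy0 : 0 ≤ y) (hx : x ≤ E ^ a)
    (hy : y ≤ E ^ b) : x * y ≤ E ^ (a + b) := by
  rw [pow_add]
  exact mul_le_mul hx hy hy0 (by positivity)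

theorem natCast_le_pow {E : ℝ} (hE : 2 ≤ E) (c : ℕ) : (c : ℝ) ≤ E ^ c :=
  calc (c : ℝ) ≤ (2 : ℝ) ^ c := by exact_mod_cast (Nat.lt_two_pow_self (n := c)).le
    _ ≤ E ^ c := pow_le_pow_left₀ (by norm_num) hE c

theorem exp_pow_le {s : ℝ} {x : ℝ} {a : ℕ} (hx : x ≤ a * s) : Real.exp x ≤ Real.exp s ^ a := by
  rw [← Real.exp_nat_mul]
  exact Real.exp_le_exp.2 hx

theorem pow_le_exp {y z : ℝ} (hy : 0 < y) (hz : Real.log y ≤ z) (k : ℕ) :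
    y ^ k ≤ Real.exp (k * z) := by
  rw [← Real.exp_log (pow_pos hy k), Real.log_pow]
  exact Real.exp_le_exp.2 (mul_le_mul_of_nonneg_left hz (by positivity))

variable {n t D : ℕ}

theorem log_le_natLog (hn : 2 ≤ n) : Real.log n ≤ (Nat.log 2 n + 1 : ℕ) := by
  have h1 : n < 2 ^ (Nat.log 2 n + 1) := Nat.lt_pow_succ_log_self (by norm_num) n
  have h2 : (n : ℝ) ≤ 2 ^ (Nat.log 2 n + 1) := by exact_mod_cast h1.le
  have h3 := Real.log_le_log (by positivity) h2
  rw [Real.log_pow] at h3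
  have h4 := Real.log_two_lt_d9
  refine h3.trans (mul_le_of_le_one_right (by positivity) (by linarith))

theorem natLog_le_log (hn : 2 ≤ n) : ((Nat.log 2 n + 1 : ℕ) : ℝ) ≤ 4 * Real.log n := by
  have h1 : 2 ^ Nat.log 2 n ≤ n := Nat.pow_log_le_self 2 (by omega)
  have h2 : (2 : ℝ) ^ Nat.log 2 n ≤ n := by exact_mod_cast h1
  have h3 := Real.log_le_log (by positivity) h2
  rw [Real.log_pow] at h3
  have h4 := Real.log_two_gt_d9
  have h5 : Real.log 2 ≤ Real.log n := Real.log_le_log (by norm_num) (by exact_mod_cast hn)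
  have h6 : (0 : ℝ) ≤ Nat.log 2 n := by positivity
  push_cast
  nlinarith

theorem one_le_mul_log (hn : 2 ≤ n) : (1 : ℝ) ≤ n * Real.log n := by
  have h4 := Real.log_two_gt_d9
  have h5 : Real.log 2 ≤ Real.log n := Real.log_le_log (by norm_num) (by exact_mod_cast hn)
  have h6 : (2 : ℝ) ≤ n := by exact_mod_cast hn
  nlinarith

theorem log_le_sqrt (hn : 2 ≤ n) (ht : 4 ≤ t) : Real.log n ≤ √((t : ℝ) * n * Real.log n) := by
  apply Real.le_sqrt_of_sq_le
  have h1 : Real.log n ≤ n := (Real.log_le_sub_one_of_pos (by positivity)).trans (by linarith)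
  have h2 : 0 ≤ Real.log n := Real.log_natCast_nonneg n
  have h3 : (4 : ℝ) ≤ t := by exact_mod_cast ht
  have h4 : (0 : ℝ) ≤ n := by positivity
  rw [pow_two]
  exact mul_le_mul_of_nonneg_right (by nlinarith) h2

theorem sqrt_le_sqrt_mul (hn : 2 ≤ n) : √(t : ℝ) ≤ √((t : ℝ) * n * Real.log n) := by
  apply Real.sqrt_le_sqrt
  rw [mul_assoc]
  exact le_mul_of_one_le_right (by positivity) (one_le_mul_log hn)

/-- The cost is at most `2 ^ O(√(t n log n))`. As `D` is the least integer with `n log n ≤ D ^ 2 * t`,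
up to a constant factor, both `D * t` and `n / D * log n` are `O(√(t n log n))`; so are `log n` and
`log t`. All factors are therefore bounded by powers of `exp √(t n log n)`. -/
theorem exists_growth_bound (q : ℕ) : ∃ c : ℕ, ∀ n t D : ℕ, 2 ≤ n → 4 ≤ t →
    (∀ r, n * (Nat.log 2 n + 1) + 1 ≤ r * (r * t) ↔ D ≤ r) → 1 ≤ D →
    (((1000 + (n + 1) + q + t + (n + 1) ^ q) ^ 12 + branchBound (n * q) D
      (leafBound n q t (1000 + (n + 1) + q + t + (n + 1) ^ q) D) (n * q) + 2 : ℕ) : ℝ)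
      ≤ Real.exp √((t : ℝ) * n * Real.log n) ^ c := by
  refine ⟨1000 * (q + 1) ^ 2, fun n t D hn ht hD hD1 => ?_⟩
  have hlog0 : 0 ≤ Real.log n := Real.log_natCast_nonneg n
  have hn0 : (0 : ℝ) < n := by exact_mod_cast (by omega : 0 < n)
  have ht0 : (0 : ℝ) < t := by exact_mod_cast (by omega : 0 < t)
  have hD0 : (0 : ℝ) < D := by exact_mod_cast hD1
  have hs1 := log_le_sqrt hn ht
  have hs2 := sqrt_le_sqrt_mul (t := t) hn
  have hsq : √((t : ℝ) * n * Real.log n) ^ 2 = t * n * Real.log n := Real.sq_sqrt (by positivity)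
  have hs0 : 0 ≤ √((t : ℝ) * n * Real.log n) := Real.sqrt_nonneg _
  generalize √((t : ℝ) * n * Real.log n) = s at *
  have hst : 2 ≤ s := by
    refine le_trans ?_ hs2
    apply Real.le_sqrt_of_sq_le
    norm_num
    exact_mod_cast ht
  have hE : 2 ≤ Real.exp s := by linarith [Real.add_one_le_exp s]
  -- the number of vertices
  have bn : (n : ℝ) ≤ Real.exp s ^ 1 := by
    rw [pow_one, ← Real.exp_log hn0]
    exact Real.exp_le_exp.2 hs1
  have bt : (t : ℝ) ≤ Real.exp s ^ 2 := by
    have h1 : √(t : ℝ) ≤ Real.exp s := by linarith [Real.add_one_le_exp s]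
    calc (t : ℝ) = √(t : ℝ) ^ 2 := (Real.sq_sqrt ht0.le).symm
      _ ≤ _ := pow_le_pow_left₀ (Real.sqrt_nonneg _) h1 2
  have b1 : (1 : ℝ) ≤ Real.exp s ^ 1 := by simpa using natCast_le_pow hE 1
  have b2 : (2 : ℝ) ≤ Real.exp s ^ 2 := by simpa using natCast_le_pow hE 2
  have b1000 : (1000 : ℝ) ≤ Real.exp s ^ 10 :=
    le_trans (by norm_num) (pow_le_pow_left₀ zero_le_two hE 10)
  have bq := natCast_le_pow hE q
  have bn1 := add_le_pow hE bn b1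
  have bnq : ((n : ℝ) + 1) ^ q ≤ Real.exp s ^ ((1 + 1 + 1) * q) := by
    rw [pow_mul]
    exact pow_le_pow_left₀ (by positivity) bn1 q
  have bN := add_le_pow hE (add_le_pow hE (add_le_pow hE (add_le_pow hE b1000 bn1) bq) bt) bnq
  have hN0 : (0 : ℝ) ≤ 1000 + (n + 1) + q + t + (n + 1) ^ q := by positivity
  unfold branchBound leafBound
  push_cast
  generalize (1000 + (n + 1) + q + t + (n + 1) ^ q : ℝ) = N at *
  have bN12 := pow_le_pow_left₀ hN0 bN 12
  have bN7 := pow_le_pow_left₀ hN0 bN 7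
  rw [← pow_mul] at bN12 bN7
  -- the second phase: `((D - 1) * t) ^ 2 ≤ n * ℓ * t`
  have bsearch : (2 * (q : ℝ) + 1) ^ (2 * (D - 1) * t + 1) ≤ Real.exp s ^ (10 * q) := by
    have h1 : (D - 1) * ((D - 1) * t) ≤ n * (Nat.log 2 n + 1) := by
      by_contra hcon
      have := (hD (D - 1)).1 (by omega)
      omega
    have h2 : (((D - 1 : ℕ) : ℝ) * t) ^ 2 ≤ (2 * s) ^ 2 := by
      have h3 : ((D - 1 : ℕ) : ℝ) * ((D - 1 : ℕ) * t) ≤ n * (Nat.log 2 n + 1 : ℕ) := by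
        exact_mod_cast h1
      have h4 := mul_le_mul_of_nonneg_left (natLog_le_log hn) hn0.le
      calc (((D - 1 : ℕ) : ℝ) * t) ^ 2 = (((D - 1 : ℕ) : ℝ) * ((D - 1 : ℕ) * t)) * t := by ring
        _ ≤ (n * (4 * Real.log n)) * t := mul_le_mul_of_nonneg_right (h3.trans h4) ht0.le
        _ = 4 * (t * n * Real.log n) := by ring
        _ = (2 * s) ^ 2 := by rw [← hsq]; ring
    have h5 : ((D - 1 : ℕ) : ℝ) * t ≤ 2 * s := (pow_le_pow_iff_left₀ (by positivity) (by positivity) two_ne_zero).1 h2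
    refine (pow_le_exp (z := 2 * q) (by positivity) ?_ _).trans (exp_pow_le ?_)
    · exact (Real.log_le_sub_one_of_pos (by positivity)).trans (by linarith)
    · push_cast
      have h6 : (0 : ℝ) ≤ q := by positivity
      have h7 : 2 * ((D - 1 : ℕ) : ℝ) * t + 1 ≤ 5 * s := by linarith
      nlinarith
  -- the first phase: `n * log n ≤ D ^ 2 * t`
  have bbranch : ((n : ℝ) * q + 2) ^ (n * q / D) ≤ Real.exp s ^ (q * (q + 3)) := by
    have h1 : (n : ℝ) * Real.log n ≤ D * (D * t) := by
      have h2 : n * (Nat.log 2 n + 1) + 1 ≤ D * (D * t) := (hD D).2 le_rfl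
      have h3 : (n : ℝ) * (Nat.log 2 n + 1 : ℕ) + 1 ≤ D * (D * t) := by exact_mod_cast h2
      have h4 := mul_le_mul_of_nonneg_left (log_le_natLog hn) hn0.le
      linarith
    have h5 : (n : ℝ) * Real.log n ≤ D * s := by
      refine (pow_le_pow_iff_left₀ (by positivity) (by positivity) two_ne_zero).1 ?_
      calc ((n : ℝ) * Real.log n) ^ 2 = (n * Real.log n) * (n * Real.log n) := by ring
        _ ≤ (D * (D * t)) * (n * Real.log n) := mul_le_mul_of_nonneg_right h1 (by positivity)
        _ = D ^ 2 * (t * n * Real.log n) := by ring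
        _ = (D * s) ^ 2 := by rw [← hsq]; ring
    have h6 : Real.log (n * q + 2) ≤ (q + 3) * Real.log n := by
      have h7 : n * q + 2 ≤ n ^ (q + 3) := by
        have h8 : q + 2 < 2 ^ (q + 2) := Nat.lt_two_pow_self
        have h9 : 2 ^ (q + 2) ≤ n ^ (q + 2) := Nat.pow_le_pow_left hn _
        calc n * q + 2 ≤ n * (q + 2) := by rw [mul_add]; omega
          _ ≤ n * n ^ (q + 2) := Nat.mul_le_mul_left _ (by omega)
          _ = n ^ (q + 3) := by ring
      have h10 : (n : ℝ) * q + 2 ≤ n ^ (q + 3) := by exact_mod_cast h7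
      have := Real.log_le_log (by positivity) h10
      rw [Real.log_pow] at this
      exact_mod_cast this
    refine (pow_le_exp (by positivity) h6 _).trans (exp_pow_le ?_)
    have h11 : ((n * q / D : ℕ) : ℝ) ≤ n * q / D := by
      refine Nat.cast_div_le.trans ?_
      push_cast
      exact le_rfl
    have h12 : (n : ℝ) * Real.log n / D ≤ s := by
      rw [div_le_iff₀ hD0]; linarith
    calc ((n * q / D : ℕ) : ℝ) * ((q + 3) * Real.log n)
        ≤ (n * q / D) * ((q + 3) * Real.log n) :=
          mul_le_mul_of_nonneg_right h11 (by positivity)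
      _ = (q * (q + 3)) * (n * Real.log n / D) := by ring
      _ ≤ (q * (q + 3)) * s := mul_le_mul_of_nonneg_left h12 (by positivity)
      _ = _ := by push_cast; ring
  have bpoly := mul_le_pow hE hn0.le (add_le_pow hE (mul_le_pow hE ht0.le b2 bt) b2) bn
  have bleaf := add_le_pow hE bN12 (mul_le_pow hE (by positivity)
    (add_le_pow hE (mul_le_pow hE (by positivity) bsearch bpoly) b1) bN7)
  have bμ := add_le_pow hE (mul_le_pow hE (by positivity) bn bq) b1
  have btotal := add_le_pow hE (add_le_pow hE bN12 (mul_le_pow hE (by positivity) bbranch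
    (mul_le_pow hE (by positivity) (mul_le_pow hE (by positivity) b2 bleaf) bμ))) b2
  refine btotal.trans (pow_le_pow_right₀ (by linarith) ?_)
  nlinarith only [Nat.zero_le q, Nat.zero_le (q * q)]

end growth

end HCol

/-! ### The theorem -/

open HCol in
theorem theorem1 {α β : Type*} (H : Graph α β) [Finite V(H)]
    (hH : ∀ h ∈ V(H), ∀ h' ∈ V(H), h ≠ h' → (HCol.nbhd H h ∩ HCol.nbhd H h').encard ≤ 1) :
    ∃ C : ℝ, ∀ (q : ℕ) (e : Fin q ≃ V(H)) (t : ℕ), 4 ≤ t →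
      ∃ P : Lisp.Program,
        ∀ (R : Type u) [CommSemiring R] (n : ℕ) (G : SimpleGraph (Fin n)),
          ¬ SimpleGraph.pathGraph t ⊴ G →
          ∀ (L : Fin n → Set V(H)) (w : Fin n → V(H) → R),
            ∃ (y : Lisp.Val R) (k : ℕ),
              P.Runs (HCol.input e G L w) y k ∧
              HCol.IsCoeffTable e y (HCol.partitionFunction H G L w) ∧
              (2 ≤ n → (k : ℝ) ≤ 2 ^ (C * √((t : ℝ) * n * Real.log n))) := by
  classical
  obtain ⟨c, hc⟩ := exists_growth_bound (Nat.card V(H))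
  refine ⟨2 * c, fun q e t ht => ?_⟩
  obtain rfl : q = Nat.card V(H) := by simpa using Nat.card_congr e
  generalize hq : Nat.card V(H) = q at *
  let HN : Fin q → Finset (Fin q) := fun i => Finset.univ.filter fun j => H.Adj (e i) (e j)
  have hsymm : ∀ a b, a ∈ HN b ↔ b ∈ HN a := fun a b => by simp [HN, H.adj_comm]
  have hcommon : ∀ a b, a ≠ b → (HN a ∩ HN b).card ≤ 1 := by
    intro a b hab
    refine Finset.card_le_one.2 fun x hx y hy => ?_
    simp only [HN, Finset.mem_inter, Finset.mem_filter, Finset.mem_univ, true_and] at hx hy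
    have h1 := Set.encard_le_one_iff.1 (hH (e a) (e a).2 (e b) (e b).2
      fun h => hab (e.injective (Subtype.ext h))) (e x) (e y) hx hy
    exact e.injective (Subtype.ext h1)
  refine ⟨prog HN t, fun R _ n G hG L w => ?_⟩
  have hex : ∃ r, n * (Nat.log 2 n + 1) + 1 ≤ r * (r * t) :=
    ⟨n * (Nat.log 2 n + 1) + 1, Nat.le_mul_of_pos_right _ (Nat.mul_pos (by omega) (by omega))⟩
  -- `D` is the least `r` with `n * (Nat.log 2 n + 1) + 1 ≤ r * (r * t)`
  obtain ⟨D, hD⟩ : ∃ D, ∀ r, n * (Nat.log 2 n + 1) + 1 ≤ r * (r * t) ↔ D ≤ r := by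
    refine ⟨Nat.find hex, fun r => ⟨fun h => Nat.find_le h, fun h => ?_⟩⟩
    exact (Nat.find_spec hex).trans (Nat.mul_le_mul h (Nat.mul_le_mul_right _ h))
  have hD1 : 1 ≤ D := by
    by_contra h
    have := (hD 0).2 (by omega)
    omega
  -- the summand `n + 1`, instead of `n`, makes `N` larger than `n`
  have hB : Big n q t (1000 + (n + 1) + q + t + (n + 1) ^ q) :=
    ⟨by omega, by omega, by omega, by omega, by omega⟩
  obtain ⟨l, hl, hsum, body, hbody, k, hk, hrun⟩ := exists_main (HN := HN) (e := e)
    (w := fun u i => w u (e i)) hB (by omega) hsymm hcommon hG hD hD1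
    (fun u => Finset.univ.filter fun i => e i ∈ L u)
  have hin : input e G L w = .cons (masks (nbrs G))
      (.cons (masks fun u => Finset.univ.filter fun i => e i ∈ L u)
        (weights fun u i => w u (e i))) := by
    simp [input, masks, mask, bits, weights]
  refine ⟨_, 1 + k + 1, ?_, ⟨l, rfl, hl.nodup, ?_⟩, fun hn => ?_⟩
  · rw [hin]
    exact .call (.var rfl) hbody hrun
  · rw [partitionFunction_eq e]
    exact hsum
  · have h1 : 1 + k + 1 ≤ (1000 + (n + 1) + q + t + (n + 1) ^ q) ^ 12 + branchBound (n * q) D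
      (leafBound n q t (1000 + (n + 1) + q + t + (n + 1) ^ q) D) (n * q) + 2 := by omega
    refine (Nat.cast_le.2 h1).trans ((hc n t D hn ht hD hD1).trans ?_)
    rw [← Real.exp_nat_mul, Real.rpow_def_of_pos two_pos]
    refine Real.exp_le_exp.2 ?_
    -- `exp s ^ c ≤ 2 ^ (2 * c * s)`, since `1 / 2 ≤ log 2`
    have h2 := Real.log_two_gt_d9
    have h3 : 0 ≤ c * √((t : ℝ) * n * Real.log n) := by positivity
    nlinarith
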